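/- **Setting.** Let $C>3$, $\alpha_c=\alpha_c(d)=\frac{(2-\delta_d)\ln d}{d}$ with $\delta_d=C\,\frac{\ln\ln d+1}{\ln d}$, and let $\lambda_c=\lambda_c(d)=\frac{\alpha_c}{1-2\alpha_c}\left(\frac{1-\alpha_c}{1-2\alpha_c}\right)^{d-1}$ be the corresponding fugacity. Let $G$ be the random $d$-regular multigraph on $n$ vertices given by the configuration model (a uniformly random perfect matching of the $dn$ half-edges, $d$ at each vertex). Write $B_\rho(s)$ for the ball of radius $\rho$ around $s$ in $G$ and $\partial B_r(s)=B_r(s)\setminus B_{r-1}(s)$. For a set $S$ of $\lfloor n^{3/5}\rfloor$ vertices and a fixed integer $r\ge 1$, let $\tilde G$ be the punctured graph obtained by deleting $\bigcup_{s\in S}B_{r-1}(s)$ and all incident edges, and let $B=V(\tilde G)\cap\bigcup_{s\in S}\partial B_r(s)$. Call the puncture *typical* with constant $K$ if every vertex of $B$ has degree $d-1$ or $d-2$ in $\tilde G$ and at most $Kn^{1/5}$ of them have degree $d-2$. Fix $S$ and a typical puncture, that is, expose the matching on all half-edges at the deleted vertices; then $B$ is determined. Let $\hat{\mathbb P}$,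 $\hat{\mathbb E}$ be the conditional probability and expectation given this exposure; under $\hat{\mathbb P}$ the remaining half-edges are matched uniformly at random. For $\sigma\in\{0,1\}^B$ let $Z_{G,\sigma}=\sum_\omega\lambda^{|\omega|}$, the sum over the independent sets $\omega$ of $G$ whose restriction to $B$ is $\sigma$, and let $Z_G=\sum_{\sigma\in\{0,1\}^B} Z_{G,\sigma}$. **Proposition.** For every $C>3$ there is $d_0$ such that the following holds for all $d\ge d_0$, all $0<\lambda<\lambda_c(d)$, all integers $r\ge1$, all $K$ and all $c>0$. There is a sequence $\delta_n\to0$ (depending only on $C,d,\lambda,r,K,c$) such that for all $n$, all $S$ with $|S|=\lfloor n^{3/5}\rfloor$ and all typical punctures with constant $K$, the $\hat{\mathbb P}$-probability that there exists a set $\mathcal B\subset\{0,1\}^B$ with both $$\sum_{\sigma\in\mathcal B}Z_{G,\sigma}>\exp\left(cn^{3/5}\right)\sum_{\sigma\in\mathcal B}\hat{\mathbb E}\left(Z_{G,\sigma}\right)\quad\text{and}\quad \sum_{\sigma\in\mathcal B}Z_{G,\sigma}>\exp\left(-n^{4/7}\right)\hat{\mathbb E}\left(Z_G\right)$$ is at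 most $\exp\left(-n^{3/5}(c-\delta_n)\right)$. -/

import Mathlib

open scoped BigOperators

/-- Half-edges: each of the `n` vertices carries `d` of them. -/
abbrev HalfEdge (n d : ℕ) : Type := Fin n × Fin d

/-- A perfect matching of the `dn` half-edges, encoded as a fixed-point-free involution.
A uniformly random one is the configuration model `H(n,d)`. -/
abbrev Pairing (n d : ℕ) : Type :=
  {f : Equiv.Perm (HalfEdge n d) // ∀ h, f (f h) = h ∧ f h ≠ h}

namespace Pairing

variable {n d : ℕ}

/-- The simple graph underlying the multigraph of a pairing (it has the same distances). -/
def graph (p : Pairing n d) : SimpleGraph (Fin n) :=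
  SimpleGraph.fromRel fun u v => ∃ i j, p.1 (u, i) = (v, j)

open Classical in
/-- The ball `B_r(u) = {v : d(u,v) ≤ r}`. -/
noncomputable def ball (p : Pairing n d) (r : ℕ) (u : Fin n) : Finset (Fin n) :=
  Finset.univ.filter fun v => p.graph.edist u v ≤ r

open Classical in
/-- The vertex boundary `B_r(u) \ B_{r-1}(u)` (used for `r ≥ 1`). -/
noncomputable def sphere (p : Pairing n d) (r : ℕ) (u : Fin n) : Finset (Fin n) :=
  p.ball r u \ p.ball (r - 1) u

open Classical in
/-- The deleted vertices: the union of the balls `B_{r-1}(s)`, `s ∈ S`.  The punctured graph is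
what remains of the multigraph after these vertices and all incident edges are deleted. -/
noncomputable def deleted (p : Pairing n d) (S : Finset (Fin n)) (r : ℕ) : Finset (Fin n) :=
  S.biUnion (p.ball (r - 1))

open Classical in
/-- The boundary set `B`: the vertices of the punctured graph that lie on some sphere
of radius `r` around a point of `S`. -/
noncomputable def boundary (p : Pairing n d) (S : Finset (Fin n)) (r : ℕ) : Finset (Fin n) :=
  S.biUnion (p.sphere r) \ p.deleted S r

open Classical in
/-- The degree of a non-deleted vertex in the punctured graph: the number of its half-edges that
are not matched to a deleted vertex. -/
noncomputable def puncturedDegree (p : Pairing n d) (S : Finset (Fin n)) (r : ℕ) (v : Fin n) : ℕ :=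
  (Finset.univ.filter fun i : Fin d => (p.1 (v, i)).1 ∉ p.deleted S r).card

open Classical in
/-- The conditioning on the punctures: every vertex of `B` has degree `d - 1` or `d - 2` in the
punctured graph, and at most `K n^{1/5}` of them have degree `d - 2`. -/
structure Typical (p : Pairing n d) (S : Finset (Fin n)) (r : ℕ) (K : ℝ) : Prop where
  degree : ∀ v ∈ p.boundary S r,
    p.puncturedDegree S r v + 1 = d ∨ p.puncturedDegree S r v + 2 = d
  few : (((p.boundary S r).filter fun v => p.puncturedDegree S r v + 2 = d).card : ℝ)
    ≤ K * (n : ℝ) ^ (1 / 5 : ℝ)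

open Classical in
/-- The pairings that agree with `p` on every half-edge incident to a deleted vertex.  The uniform
law on this set is the law of the configuration model given the exposed neighbourhoods of `S`:
the half-edges that are still free are matched uniformly at random. -/
noncomputable def conditioned (p : Pairing n d) (S : Finset (Fin n)) (r : ℕ) :
    Finset (Pairing n d) :=
  Finset.univ.filter fun q => ∀ h : HalfEdge n d, h.1 ∈ p.deleted S r → q.1 h = p.1 h

/-- Independent sets of the multigraph of a pairing (a vertex with a loop is never in one). -/
def IsIndep (p : Pairing n d) (I : Finset (Fin n)) : Prop :=
  ∀ h : HalfEdge n d, h.1 ∈ I → (p.1 h).1 ∉ I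

open Classical in
/-- The hardcore partition function `Z_G`. -/
noncomputable def Z (lam : ℝ) (p : Pairing n d) : ℝ :=
  ∑ I ∈ Finset.univ.filter fun I : Finset (Fin n) => p.IsIndep I, lam ^ I.card

open Classical in
/-- The partition function `Z_{G,σ}` over independent sets whose restriction to `B` is `σ`.
A configuration in `{0,1}^B` is given by the set `σ ⊆ B` of its occupied vertices. -/
noncomputable def ZBdry (lam : ℝ) (p : Pairing n d) (B σ : Finset (Fin n)) : ℝ :=
  ∑ I ∈ Finset.univ.filter fun I : Finset (Fin n) => p.IsIndep I ∧ I ∩ B = σ, lam ^ I.card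

/-- Expectation in the conditioned model. -/
noncomputable def condE (p : Pairing n d) (S : Finset (Fin n)) (r : ℕ)
    (X : Pairing n d → ℝ) : ℝ :=
  (∑ q ∈ p.conditioned S r, X q) / ((p.conditioned S r).card : ℝ)

open Classical in
/-- Probability in the conditioned model. -/
noncomputable def condP (p : Pairing n d) (S : Finset (Fin n)) (r : ℕ)
    (A : Pairing n d → Prop) : ℝ :=
  (((p.conditioned S r).filter A).card : ℝ) / ((p.conditioned S r).card : ℝ)

/-- The event, for the multigraph of `q`, that the total weight of `𝓑` exceeds
`exp(c n^{3/5})` times its conditional expectation. -/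
def EventE1 (lam c : ℝ) (p : Pairing n d) (S : Finset (Fin n)) (r : ℕ)
    (𝓑 : Finset (Finset (Fin n))) (q : Pairing n d) : Prop :=
  Real.exp (c * (n : ℝ) ^ (3 / 5 : ℝ)) *
      ∑ σ ∈ 𝓑, p.condE S r (fun q' => q'.ZBdry lam (p.boundary S r) σ)
    < ∑ σ ∈ 𝓑, q.ZBdry lam (p.boundary S r) σ

/-- The event, for the multigraph of `q`, that the total weight of `𝓑` exceeds
`exp(-n^{4/7})` times the conditional expectation of `Z_G`. -/
def EventE2 (lam : ℝ) (p : Pairing n d) (S : Finset (Fin n)) (r : ℕ)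
    (𝓑 : Finset (Finset (Fin n))) (q : Pairing n d) : Prop :=
  Real.exp (-(n : ℝ) ^ (4 / 7 : ℝ)) * p.condE S r (fun q' => q'.Z lam)
    < ∑ σ ∈ 𝓑, q.ZBdry lam (p.boundary S r) σ

end Pairing

/-- The fugacity of the translation invariant hardcore measure of density `a` on the
`d`-regular tree. -/
noncomputable def fugacityOfDensity (d : ℕ) (a : ℝ) : ℝ :=
  a / (1 - 2 * a) * ((1 - a) / (1 - 2 * a)) ^ (d - 1)

/-- The critical density `α_c = (2 - δ_d) log d / d` with
`δ_d = C (log log d + 1) / log d`. -/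
noncomputable def criticalDensity (C : ℝ) (d : ℕ) : ℝ :=
  (2 - C * (Real.log (Real.log d) + 1) / Real.log d) * Real.log d / d

/-! The proof is a truncated second moment argument that needs no union bound over the families `𝓑`.
Let `U` consist of the deleted vertices and the boundary, and put `N = |Uᶜ|`, `b = |U|`, so that `b
= O(n^(3/5))`. Split the weight of the independent sets into pieces indexed by `(τ, k)`, the trace
on `U` and the number of vertices outside `U`. The total weight of any `𝓑` is a sum of whole pieces.
If it exceeds `T = exp(c n^(3/5))` times its mean, the pieces that are at most `T/4` times their own
means make up less than a quarter of it. The other pieces then carry at least three quarters of a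
total exceeding `exp(-n^(4/7))` times the mean of `Z`. The expected weight of all such exceptionally
large pieces is bounded independently of `𝓑`, and Markov's inequality finishes
(`card_filter_exists_subfamily_le`).

Two estimates on the pieces are needed. Let `α` be the critical density. If `k > α N`, the piece is
exponentially small against another piece with the same `τ` (`first_moment_le`): the ratio of
consecutive first moments at density `α'` is at most `λ / fugacityOfDensity d α'`, which is below 1
for some `α' < α`. If `k ≤ α N`, the second moment is at most `exp(O(n^(1/5)))` times the squared
mean (`second_moment_le`), which is negligible against `T`.

For the second moment, independence of `τ ∪ ω` means that its free half-edges contain no pair of a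
uniform matching of `2m` points. By symmetry the joint probability for two such sets depends only on
their sizes and overlap. Relative to independence, it grows at most like a Gaussian in the deviation
of the overlap from its mean (`pairRatio_le`), with exponent about `d (j - μ)² / (2N)` for `j`
common vertices and `μ = k²/N`. The hypergeometric law of `j` decays at least as fast as `exp(-K d
(j - μ)² / (2N))` with some `K > 1` (`overlapProb_le_gaussian`). On the upper side the binding case
is `j = k`, where the requirement is `K d α / 2 ≤ log (1/α) - 1`; this is what the choice of
`criticalDensity` provides. The mismatch of means caused by `U` costs `exp(O(d b² / N)) =
exp(O(n^(1/5)))`. -/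

/-! ### Sets that avoid the pairs of a random matching: exact counts by symmetry. -/

section MatchingCount

variable {X : Type*} [DecidableEq X]

/-- A set of points that contains no pair `{x, q x}`. -/
def AvoidsPairs (q : Equiv.Perm X) (A : Finset X) : Prop := ∀ x ∈ A, q x ∉ A

instance (q : Equiv.Perm X) : DecidablePred (AvoidsPairs q) := fun A =>
  inferInstanceAs (Decidable (∀ x ∈ A, q x ∉ A))

/-- A family of fixed-point-free involutions preserving `F`, closed under relabelling of `F`. -/
structure IsMatchingFamily (F : Finset X) (Ω : Finset (Equiv.Perm X)) : Prop where
  invol : ∀ q ∈ Ω, ∀ x, q (q x) = x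
  noFix : ∀ q ∈ Ω, ∀ x, q x ≠ x
  maps : ∀ q ∈ Ω, ∀ x ∈ F, q x ∈ F
  conj : ∀ q ∈ Ω, ∀ e : Equiv.Perm X, (∀ x, x ∉ F → e x = x) → e * q * e⁻¹ ∈ Ω

/-- The subsets of `F` of size `h` that avoid the pairs of `q`. -/
def avoidingSets (q : Equiv.Perm X) (F : Finset X) (h : ℕ) : Finset (Finset X) :=
  (F.powersetCard h).filter (AvoidsPairs q)

lemma mem_avoidingSets {q : Equiv.Perm X} {F : Finset X} {h : ℕ} {A : Finset X} :
    A ∈ avoidingSets q F h ↔ (A ⊆ F ∧ A.card = h) ∧ AvoidsPairs q A := by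
  simp [avoidingSets, Finset.mem_powersetCard]

/-- Two pairs of subsets with the same Venn-diagram cardinalities lie in one orbit of the
permutations of `F`. This is why avoidance probabilities depend only on sizes and overlap. -/
theorem exists_perm_map_pair [Fintype X] {F A₁ A₂ B₁ B₂ : Finset X} (hA₁ : A₁ ⊆ F) (hA₂ : A₂ ⊆ F)
    (hB₁ : B₁ ⊆ F) (hB₂ : B₂ ⊆ F) (h₁ : A₁.card = B₁.card) (h₂ : A₂.card = B₂.card)
    (h₁₂ : (A₁ ∩ A₂).card = (B₁ ∩ B₂).card) :
    ∃ e : Equiv.Perm X, (∀ x, x ∉ F → e x = x) ∧ A₁.map e.toEmbedding = B₁ ∧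
      A₂.map e.toEmbedding = B₂ := by
  classical
  -- Colour a point of `F` by its memberships and a point outside `F` by itself. A colour-preserving
  -- bijection then fixes the complement of `F`.
  let col : Finset X → Finset X → X → X ⊕ (Bool × Bool) := fun A A' x =>
    if x ∈ F then Sum.inr (decide (x ∈ A), decide (x ∈ A')) else Sum.inl x
  have key : ∀ c, Fintype.card {x // col A₁ A₂ x = c} = Fintype.card {x // col B₁ B₂ x = c} := by
    intro c
    rw [Fintype.card_subtype, Fintype.card_subtype]
    have hdA : ∀ A A' : Finset X, A ⊆ F → A' ⊆ F →
        (Finset.univ.filter fun x => col A A' x = Sum.inr (true, true)) = A ∩ A' ∧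
        (Finset.univ.filter fun x => col A A' x = Sum.inr (true, false)) = A \ A' ∧
        (Finset.univ.filter fun x => col A A' x = Sum.inr (false, true)) = A' \ A ∧
        (Finset.univ.filter fun x => col A A' x = Sum.inr (false, false)) = F \ (A ∪ A') := by
      intro A A' hA hA'
      refine ⟨?_, ?_, ?_, ?_⟩ <;>
      · ext x
        have := @hA x
        have := @hA' x
        by_cases hx : x ∈ F <;> simp [col, hx] <;> tauto
    obtain ⟨a1, a2, a3, a4⟩ := hdA A₁ A₂ hA₁ hA₂
    obtain ⟨b1, b2, b3, b4⟩ := hdA B₁ B₂ hB₁ hB₂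
    have e1 := Finset.card_sdiff_add_card_inter A₁ A₂
    have e2 := Finset.card_sdiff_add_card_inter B₁ B₂
    have e3 := Finset.card_sdiff_add_card_inter A₂ A₁
    have e4 := Finset.card_sdiff_add_card_inter B₂ B₁
    have e5 := Finset.card_union_add_card_inter A₁ A₂
    have e6 := Finset.card_union_add_card_inter B₁ B₂
    rw [Finset.inter_comm A₂ A₁] at e3
    rw [Finset.inter_comm B₂ B₁] at e4
    rcases c with y | ⟨_ | _, _ | _⟩
    · congr 1
      ext x
      by_cases hx : x ∈ F <;> simp [col, hx]
    · rw [a4, b4, Finset.card_sdiff_of_subset (Finset.union_subset hA₁ hA₂),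
        Finset.card_sdiff_of_subset (Finset.union_subset hB₁ hB₂)]
      omega
    · rw [a3, b3]; omega
    · rw [a2, b2]; omega
    · rw [a1, b1, h₁₂]
  let e : Equiv.Perm X := Equiv.ofFiberEquiv (f := col A₁ A₂) (g := col B₁ B₂)
    fun c => Fintype.equivOfCardEq (key c)
  have he : ∀ x, col B₁ B₂ (e x) = col A₁ A₂ x := fun x => Equiv.ofFiberEquiv_map _ x
  refine ⟨e, ?_, ?_, ?_⟩
  · intro x hx
    have := he x
    by_cases hex : e x ∈ F <;> simp [col, hx, hex] at this
    exact this
  · apply Finset.eq_of_subset_of_card_le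
    · intro y hy
      obtain ⟨x, hx, rfl⟩ := Finset.mem_map.1 hy
      have := he x
      by_cases hex : e x ∈ F <;> simp [col, hA₁ hx, hx, hex] at this
      exact this.1
    · rw [Finset.card_map, h₁]
  · apply Finset.eq_of_subset_of_card_le
    · intro y hy
      obtain ⟨x, hx, rfl⟩ := Finset.mem_map.1 hy
      have := he x
      by_cases hex : e x ∈ F <;> simp [col, hA₂ hx, hx, hex] at this
      exact this.2
    · rw [Finset.card_map, h₂]

lemma AvoidsPairs.conj {Y : Type*} {q e : Equiv.Perm Y} {A : Finset Y} (hA : AvoidsPairs q A) :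
    AvoidsPairs (e * q * e⁻¹) (A.map e.toEmbedding) := by
  intro y hy hy'
  obtain ⟨x, hx, rfl⟩ := Finset.mem_map.1 hy
  obtain ⟨z, hz, hzx⟩ := Finset.mem_map.1 hy'
  simp at hzx
  exact hA x hx (hzx ▸ hz)

/-- Conjugation by the permutation from `exists_perm_map_pair` injects one event into the other. -/
lemma card_filter_avoids_pair_le [Fintype X] {F : Finset X} {Ω : Finset (Equiv.Perm X)}
    (hΩ : IsMatchingFamily F Ω) {A₁ A₂ B₁ B₂ : Finset X} (hA₁ : A₁ ⊆ F) (hA₂ : A₂ ⊆ F)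
    (hB₁ : B₁ ⊆ F) (hB₂ : B₂ ⊆ F) (h₁ : A₁.card = B₁.card) (h₂ : A₂.card = B₂.card)
    (h₁₂ : (A₁ ∩ A₂).card = (B₁ ∩ B₂).card) :
    (Ω.filter fun q => AvoidsPairs q A₁ ∧ AvoidsPairs q A₂).card ≤
      (Ω.filter fun q => AvoidsPairs q B₁ ∧ AvoidsPairs q B₂).card := by
  obtain ⟨e, he, rfl, rfl⟩ := exists_perm_map_pair hA₁ hA₂ hB₁ hB₂ h₁ h₂ h₁₂
  apply Finset.card_le_card_of_injOn (fun q => e * q * e⁻¹)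
  · intro q hq
    simp only [Finset.coe_filter, Set.mem_ofPred_eq] at hq ⊢
    exact ⟨hΩ.conj q hq.1 e he, hq.2.1.conj, hq.2.2.conj⟩
  · intro q _ q' _ h
    simpa using h

theorem card_filter_avoids_pair_eq [Fintype X] {F : Finset X} {Ω : Finset (Equiv.Perm X)}
    (hΩ : IsMatchingFamily F Ω) {A₁ A₂ B₁ B₂ : Finset X} (hA₁ : A₁ ⊆ F) (hA₂ : A₂ ⊆ F)
    (hB₁ : B₁ ⊆ F) (hB₂ : B₂ ⊆ F) (h₁ : A₁.card = B₁.card) (h₂ : A₂.card = B₂.card)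
    (h₁₂ : (A₁ ∩ A₂).card = (B₁ ∩ B₂).card) :
    (Ω.filter fun q => AvoidsPairs q A₁ ∧ AvoidsPairs q A₂).card =
      (Ω.filter fun q => AvoidsPairs q B₁ ∧ AvoidsPairs q B₂).card :=
  le_antisymm (card_filter_avoids_pair_le hΩ hA₁ hA₂ hB₁ hB₂ h₁ h₂ h₁₂)
    (card_filter_avoids_pair_le hΩ hB₁ hB₂ hA₁ hA₂ h₁.symm h₂.symm h₁₂.symm)

theorem card_filter_avoids_eq [Fintype X] {F : Finset X} {Ω : Finset (Equiv.Perm X)}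
    (hΩ : IsMatchingFamily F Ω) {A B : Finset X} (hA : A ⊆ F) (hB : B ⊆ F)
    (h : A.card = B.card) :
    (Ω.filter fun q => AvoidsPairs q A).card = (Ω.filter fun q => AvoidsPairs q B).card := by
  have := card_filter_avoids_pair_eq hΩ hA hA hB hB h h (by simpa using h)
  simpa using this

lemma card_union_image_of_avoids {q : Equiv.Perm X} {A : Finset X} (hA : AvoidsPairs q A) :
    (A ∪ A.image q).card = 2 * A.card := by
  rw [Finset.card_union_of_disjoint, Finset.card_image_of_injective _ q.injective]
  · ring
  · rw [Finset.disjoint_left]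
    intro x hx hx'
    obtain ⟨y, hy, rfl⟩ := Finset.mem_image.1 hx'
    exact hA y hy hx

/-- Count pairs `(A, x)` with `x ∈ A` in two ways: removing `x` leaves an avoiding set of size `h`,
and `x` may be any point of `F` other than its `h` points and their `h` partners. -/
lemma card_avoidingSets_succ {q : Equiv.Perm X} (hq : ∀ x, q (q x) = x) (hq' : ∀ x, q x ≠ x)
    {F : Finset X} (hF : ∀ x ∈ F, q x ∈ F) (h : ℕ) :
    (avoidingSets q F (h + 1)).card * (h + 1) =
      (avoidingSets q F h).card * (F.card - 2 * h) := by
  have e1 : (avoidingSets q F (h + 1)).card * (h + 1) =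
      ((avoidingSets q F (h + 1)).sigma fun A => A).card := by
    rw [Finset.card_sigma, Finset.sum_const_nat]
    intro A hA
    exact (mem_avoidingSets.1 hA).1.2
  have e2 : (avoidingSets q F h).card * (F.card - 2 * h) =
      ((avoidingSets q F h).sigma fun A => F \ (A ∪ A.image q)).card := by
    rw [Finset.card_sigma, Finset.sum_const_nat]
    intro A hA
    obtain ⟨⟨hAF, hAc⟩, hAq⟩ := mem_avoidingSets.1 hA
    rw [Finset.card_sdiff_of_subset, card_union_image_of_avoids hAq, hAc]
    refine Finset.union_subset hAF fun x hx => ?_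
    obtain ⟨y, hy, rfl⟩ := Finset.mem_image.1 hx
    exact hF y (hAF hy)
  rw [e1, e2]
  refine Finset.card_bij' (fun p _ => ⟨p.1.erase p.2, p.2⟩) (fun p _ => ⟨insert p.2 p.1, p.2⟩)
    ?_ ?_ ?_ ?_
  · rintro ⟨A, x⟩ hp
    simp only [Finset.mem_sigma, mem_avoidingSets, Finset.mem_sdiff, Finset.mem_union,
      Finset.mem_image, Finset.mem_erase] at hp ⊢
    obtain ⟨⟨⟨hAF, hAc⟩, hAq⟩, hx⟩ := hp
    refine ⟨⟨⟨(Finset.erase_subset _ _).trans hAF, ?_⟩, ?_⟩, hAF hx, ?_⟩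
    · rw [Finset.card_erase_of_mem hx, hAc]; rfl
    · intro y hy hy'
      exact hAq y (Finset.mem_of_mem_erase hy) (Finset.mem_of_mem_erase hy')
    · rintro (⟨h1, -⟩ | ⟨y, ⟨-, hy⟩, rfl⟩)
      · exact h1 rfl
      · exact hAq y hy hx
  · rintro ⟨A, x⟩ hp
    simp only [Finset.mem_sigma, mem_avoidingSets, Finset.mem_sdiff, Finset.mem_union,
      Finset.mem_image, not_or, not_exists, not_and] at hp ⊢
    obtain ⟨⟨⟨hAF, hAc⟩, hAq⟩, hxF, hxA, hxi⟩ := hp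
    refine ⟨⟨⟨Finset.insert_subset hxF hAF, ?_⟩, ?_⟩, Finset.mem_insert_self _ _⟩
    · rw [Finset.card_insert_of_notMem hxA, hAc]
    · intro y hy hy'
      rw [Finset.mem_insert] at hy hy'
      rcases hy with rfl | hy <;> rcases hy' with hy' | hy'
      · exact hq' _ hy'
      · exact hxi _ hy' (hq _)
      · exact hxi y hy hy'
      · exact hAq y hy hy'
  · rintro ⟨A, x⟩ hp
    simp only [Finset.mem_sigma] at hp
    simp [Finset.insert_erase hp.2]
  · rintro ⟨A, x⟩ hp
    simp only [Finset.mem_sigma, Finset.mem_sdiff, Finset.mem_union, not_or] at hp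
    simp [Finset.erase_insert hp.2.2.1]

theorem card_avoidingSets {q : Equiv.Perm X} (hq : ∀ x, q (q x) = x) (hq' : ∀ x, q x ≠ x)
    {F : Finset X} (hF : ∀ x ∈ F, q x ∈ F) {m : ℕ} (hm : F.card = 2 * m) (h : ℕ) :
    (avoidingSets q F h).card = m.choose h * 2 ^ h := by
  induction h with
  | zero =>
    have : avoidingSets q F 0 = {∅} := by
      ext A
      rw [mem_avoidingSets, Finset.mem_singleton]
      constructor
      · rintro ⟨⟨-, h⟩, -⟩; exact Finset.card_eq_zero.1 h
      · rintro rfl; simp [AvoidsPairs]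
    simp [this]
  | succ h ih =>
    have h1 := card_avoidingSets_succ hq hq' hF h
    have h2 := Nat.choose_succ_right_eq m h
    have h3 : 2 * m - 2 * h = 2 * (m - h) := by omega
    rw [ih, hm, h3] at h1
    apply Nat.eq_of_mul_eq_mul_right (Nat.succ_pos h)
    rw [Nat.succ_eq_add_one, h1, pow_succ]
    calc m.choose h * 2 ^ h * (2 * (m - h)) = (m.choose h * (m - h)) * (2 ^ h * 2) := by ring
      _ = m.choose (h + 1) * (2 ^ h * 2) * (h + 1) := by rw [← h2]; ring

/-- The number of ways to place `u` points on `u` half-used and `ν` unused pairs. -/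
def crossCount (ν u : ℕ) : ℕ :=
  ∑ s ∈ Finset.range (u + 1), u.choose s * (ν.choose (u - s) * 2 ^ (u - s))

/-- Choose the `t` common points in `A`. Each of the `u` new points is either the partner of a point
of `A` that was not chosen, or lies in one of the `m - h` pairs missed by `A`. `crossCount` sums
over the number `s` of points of the first kind. -/
theorem card_avoidingSets_inter_le {q : Equiv.Perm X} (hq : ∀ x, q (q x) = x)
    (hq' : ∀ x, q x ≠ x) {F : Finset X} (hF : ∀ x ∈ F, q x ∈ F) {m : ℕ} (hm : F.card = 2 * m)
    {h t u : ℕ} (hu : h = t + u) {A : Finset X} (hA : A ∈ avoidingSets q F h) :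
    ((avoidingSets q F h).filter fun A' => (A ∩ A').card = t).card ≤
      h.choose t * crossCount (m - h) u := by
  obtain ⟨⟨hAF, hAc⟩, hAq⟩ := mem_avoidingSets.1 hA
  set G := F \ (A ∪ A.image q) with hG
  have himF : A.image q ⊆ F := by
    intro x hx
    obtain ⟨y, hy, rfl⟩ := Finset.mem_image.1 hx
    exact hF y (hAF hy)
  have hGc : G.card = 2 * (m - h) := by
    rw [hG, Finset.card_sdiff_of_subset (Finset.union_subset hAF himF),
      card_union_image_of_avoids hAq, hm, hAc]
    omega
  have hGq : ∀ x ∈ G, q x ∈ G := by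
    intro x hx
    simp only [hG, Finset.mem_sdiff, Finset.mem_union, Finset.mem_image, not_or, not_exists,
      not_and] at hx ⊢
    refine ⟨hF x hx.1, fun h' => hx.2.2 _ h' (hq x), fun y hy hyx => hx.2.1 ?_⟩
    rwa [← q.injective hyx]
  let T : Finset (Finset X) := (A.powersetCard t).biUnion fun a =>
    (Finset.range (u + 1)).biUnion fun s =>
      (((A \ a).image q).powersetCard s ×ˢ avoidingSets q G (u - s)).image
        fun p => a ∪ (p.1 ∪ p.2)
  have hsub : ((avoidingSets q F h).filter fun A' => (A ∩ A').card = t) ⊆ T := by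
    intro A' hA'
    rw [Finset.mem_filter, mem_avoidingSets] at hA'
    obtain ⟨⟨⟨hA'F, hA'c⟩, hA'q⟩, hAA'⟩ := hA'
    have hdisj : Disjoint A (A.image q) := by
      rw [Finset.disjoint_left]
      intro x hx hx'
      obtain ⟨y, hy, rfl⟩ := Finset.mem_image.1 hx'
      exact hAq y hy hx
    have hunion : (A ∩ A') ∪ ((A' ∩ A.image q) ∪ (A' ∩ G)) = A' := by
      ext x
      simp only [hG, Finset.mem_union, Finset.mem_inter, Finset.mem_sdiff]
      have := @hA'F x
      tauto
    have hd2 : Disjoint (A' ∩ A.image q) (A' ∩ G) := by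
      rw [Finset.disjoint_left]
      intro x hx hx'
      simp only [hG, Finset.mem_union, Finset.mem_inter, Finset.mem_sdiff] at hx hx'
      tauto
    have hd1 : Disjoint (A ∩ A') ((A' ∩ A.image q) ∪ (A' ∩ G)) := by
      rw [Finset.disjoint_left]
      intro x hx hx'
      have := Finset.disjoint_left.1 hdisj (Finset.mem_inter.1 hx).1
      simp only [hG, Finset.mem_union, Finset.mem_inter, Finset.mem_sdiff] at hx hx'
      tauto
    have hcard : t + ((A' ∩ A.image q).card + (A' ∩ G).card) = h := by
      rw [← hA'c, ← hAA', ← Finset.card_union_of_disjoint hd2,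
        ← Finset.card_union_of_disjoint hd1, hunion]
    simp only [T, Finset.mem_biUnion, Finset.mem_image, Finset.mem_product, Prod.exists,
      Finset.mem_powersetCard, Finset.mem_range, mem_avoidingSets]
    refine ⟨A ∩ A', ⟨Finset.inter_subset_left, hAA'⟩, (A' ∩ A.image q).card, by omega,
      A' ∩ A.image q, A' ∩ G, ⟨⟨?_, rfl⟩, ⟨Finset.inter_subset_right, by omega⟩, ?_⟩, hunion⟩
    · intro x hx
      obtain ⟨hx1, hx2⟩ := Finset.mem_inter.1 hx
      obtain ⟨y, hy, rfl⟩ := Finset.mem_image.1 hx2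
      refine Finset.mem_image.2 ⟨y, Finset.mem_sdiff.2 ⟨hy, fun hy' => ?_⟩, rfl⟩
      exact hA'q y (Finset.mem_inter.1 hy').2 hx1
    · intro x hx hx'
      exact hA'q x (Finset.mem_inter.1 hx).1 (Finset.mem_inter.1 hx').1
  refine (Finset.card_le_card hsub).trans ?_
  refine (Finset.card_biUnion_le_card_mul _ _ (crossCount (m - h) u) ?_).trans
    (by rw [Finset.card_powersetCard, hAc])
  intro a ha
  obtain ⟨haA, hac⟩ := Finset.mem_powersetCard.1 ha
  refine Finset.card_biUnion_le.trans (Finset.sum_le_sum fun s _ => ?_)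
  refine Finset.card_image_le.trans ?_
  rw [Finset.card_product, Finset.card_powersetCard,
    Finset.card_image_of_injective _ q.injective, Finset.card_sdiff_of_subset haA, hAc, hac,
    card_avoidingSets hq hq' hGq hGc, hu, Nat.add_sub_cancel_left]

theorem card_powersetCard_inter {O A : Finset X} (hA : A ⊆ O) {k j : ℕ} (hj : j ≤ k) :
    ((O.powersetCard k).filter fun A' => (A ∩ A').card = j).card =
      A.card.choose j * (O.card - A.card).choose (k - j) := by
  rw [← Finset.card_sdiff_of_subset hA, ← Finset.card_powersetCard, ← Finset.card_powersetCard,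
    ← Finset.card_product]
  refine Finset.card_bij' (fun A' _ => (A ∩ A', A' \ A)) (fun p _ => p.1 ∪ p.2) ?_ ?_ ?_ ?_
  · intro A' hA'
    simp only [Finset.mem_filter, Finset.mem_powersetCard, Finset.mem_product] at hA' ⊢
    refine ⟨⟨Finset.inter_subset_left, hA'.2⟩,
      Finset.sdiff_subset_sdiff hA'.1.1 le_rfl, ?_⟩
    have := Finset.card_sdiff_add_card_inter A' A
    rw [Finset.inter_comm] at this
    omega
  · rintro ⟨a, b⟩ hp
    simp only [Finset.mem_filter, Finset.mem_powersetCard, Finset.mem_product] at hp ⊢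
    obtain ⟨⟨ha, hac⟩, hb, hbc⟩ := hp
    have hdis : Disjoint a b :=
      Finset.disjoint_of_subset_left ha (Finset.disjoint_of_subset_right hb Finset.disjoint_sdiff)
    refine ⟨⟨Finset.union_subset (ha.trans hA) (hb.trans Finset.sdiff_subset), ?_⟩, ?_⟩
    · rw [Finset.card_union_of_disjoint hdis]; omega
    · rw [← hac]; congr 1
      ext x
      have := @ha x
      have := @hb x
      simp only [Finset.mem_inter, Finset.mem_union, Finset.mem_sdiff] at *
      tauto
  · intro A' _
    ext x
    simp only [Finset.mem_inter, Finset.mem_union, Finset.mem_sdiff]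
    tauto
  · rintro ⟨a, b⟩ hp
    simp only [Finset.mem_powersetCard, Finset.mem_product] at hp
    obtain ⟨⟨ha, hac⟩, hb, hbc⟩ := hp
    ext x
    all_goals
      have := @ha x
      have := @hb x
      simp only [Finset.mem_inter, Finset.mem_union, Finset.mem_sdiff] at *
      tauto

/-- The number of matchings avoided by `A` depends only on `|A|`, so it can be averaged over all
sets of that size; exchanging the sums leaves the count for one fixed matching. -/
theorem card_filter_avoids_mul [Fintype X] {F : Finset X} {Ω : Finset (Equiv.Perm X)}
    (hΩ : IsMatchingFamily F Ω) {m : ℕ} (hm : F.card = 2 * m) {A : Finset X} (hA : A ⊆ F) :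
    (Ω.filter fun q => AvoidsPairs q A).card * (2 * m).choose A.card =
      Ω.card * (m.choose A.card * 2 ^ A.card) := by
  have h1 := Finset.sum_card_bipartiteAbove_eq_sum_card_bipartiteBelow
    (s := F.powersetCard A.card) (t := Ω) (fun A' q => AvoidsPairs q A')
  rw [Finset.sum_const_nat (m := (Ω.filter fun q => AvoidsPairs q A).card),
    Finset.sum_const_nat (m := m.choose A.card * 2 ^ A.card), Finset.card_powersetCard, hm] at h1
  · rw [mul_comm, h1]
  · intro q hq
    exact card_avoidingSets (hΩ.invol q hq) (hΩ.noFix q hq) (hΩ.maps q hq) hm A.card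
  · intro A' hA'
    obtain ⟨h, hc⟩ := Finset.mem_powersetCard.1 hA'
    exact card_filter_avoids_eq hΩ h hA hc

/-- The averaging of `card_filter_avoids_mul`, now over ordered pairs of `h`-sets with overlap `t`.
Both counts contain the factor `h.choose t`, which is cancelled. -/
theorem card_filter_avoids_pair_mul_le [Fintype X] {F : Finset X} {Ω : Finset (Equiv.Perm X)}
    (hΩ : IsMatchingFamily F Ω) {m : ℕ} (hm : F.card = 2 * m) {A B : Finset X} (hA : A ⊆ F)
    (hB : B ⊆ F) {h t u : ℕ} (hAc : A.card = h) (hBc : B.card = h) (ht : (A ∩ B).card = t)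
    (hu : h = t + u) :
    (Ω.filter fun q => AvoidsPairs q A ∧ AvoidsPairs q B).card *
        ((2 * m).choose h * (2 * m - h).choose u) ≤
      Ω.card * (m.choose h * 2 ^ h * crossCount (m - h) u) := by
  let pairs : Finset (Finset X × Finset X) :=
    (F.powersetCard h ×ˢ F.powersetCard h).filter fun p => (p.1 ∩ p.2).card = t
  have hpc : pairs.card = (2 * m).choose h * (h.choose t * (2 * m - h).choose u) := by
    have : pairs = (F.powersetCard h).biUnion fun A => ((F.powersetCard h).filter
        fun A' => (A ∩ A').card = t).image (Prod.mk A) := by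
      ext ⟨a, b⟩
      simp [pairs]
      tauto
    rw [this, Finset.card_biUnion, Finset.sum_const_nat (m := h.choose t * (2 * m - h).choose u),
      Finset.card_powersetCard, hm]
    · intro A hA
      obtain ⟨hA1, hA2⟩ := Finset.mem_powersetCard.1 hA
      rw [Finset.card_image_of_injective _ (Prod.mk_right_injective A),
        card_powersetCard_inter hA1 (by omega : t ≤ h), hA2, hm, hu, Nat.add_sub_cancel_left]
    · intro a _ b _ hab
      simp only [Function.onFun]
      rw [Finset.disjoint_left]
      rintro x hx hx'
      obtain ⟨y, -, rfl⟩ := Finset.mem_image.1 hx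
      obtain ⟨z, -, hz⟩ := Finset.mem_image.1 hx'
      exact hab (congrArg Prod.fst hz).symm
  have h1 := Finset.sum_card_bipartiteAbove_eq_sum_card_bipartiteBelow
    (s := pairs) (t := Ω) (fun p q => AvoidsPairs q p.1 ∧ AvoidsPairs q p.2)
  rw [Finset.sum_const_nat
    (m := (Ω.filter fun q => AvoidsPairs q A ∧ AvoidsPairs q B).card), hpc] at h1
  · have h2 : ∀ q ∈ Ω, (Finset.bipartiteBelow
        (fun (p : Finset X × Finset X) q => AvoidsPairs q p.1 ∧ AvoidsPairs q p.2) pairs q).card ≤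
        m.choose h * 2 ^ h * (h.choose t * crossCount (m - h) u) := by
      intro q hq
      have hsub : Finset.bipartiteBelow
          (fun (p : Finset X × Finset X) q => AvoidsPairs q p.1 ∧ AvoidsPairs q p.2) pairs q ⊆
          (avoidingSets q F h).biUnion fun A => ((avoidingSets q F h).filter
            fun A' => (A ∩ A').card = t).image (Prod.mk A) := by
        rintro ⟨a, b⟩ hab
        simp [pairs, Finset.bipartiteBelow, mem_avoidingSets] at hab ⊢
        tauto
      refine (Finset.card_le_card hsub).trans ?_
      rw [← card_avoidingSets (hΩ.invol q hq) (hΩ.noFix q hq) (hΩ.maps q hq) hm h]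
      refine Finset.card_biUnion_le_card_mul _ _ _ fun A hA => Finset.card_image_le.trans ?_
      exact card_avoidingSets_inter_le (hΩ.invol q hq) (hΩ.noFix q hq) (hΩ.maps q hq) hm hu hA
    have h3 := Finset.sum_le_sum h2
    rw [← h1, Finset.sum_const, smul_eq_mul] at h3
    have hpos : 0 < h.choose t := Nat.choose_pos (by omega)
    refine Nat.le_of_mul_le_mul_left ?_ hpos
    calc _ = (2 * m).choose h * (h.choose t * (2 * m - h).choose u) *
          (Ω.filter fun q => AvoidsPairs q A ∧ AvoidsPairs q B).card := by ring
      _ ≤ _ := h3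
      _ = _ := by ring
  · rintro ⟨a, b⟩ hab
    simp only [pairs, Finset.mem_filter, Finset.mem_product, Finset.mem_powersetCard] at hab
    obtain ⟨⟨⟨ha, hac⟩, hb, hbc⟩, hab⟩ := hab
    exact card_filter_avoids_pair_eq hΩ ha hb hA hB (hac.trans hAc.symm) (hbc.trans hBc.symm)
      (hab.trans ht.symm)

end MatchingCount

/-! ### Moments of the number of half-used pairs that get a new point. -/

section CrossMoments

/-- The terms of `crossCount`, as real numbers. -/
noncomputable def crossTerm (ν u s : ℕ) : ℝ := u.choose s * (ν.choose (u - s) * 2 ^ (u - s))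

lemma crossTerm_nonneg (ν u s : ℕ) : 0 ≤ crossTerm ν u s := by
  unfold crossTerm; positivity

lemma crossCount_eq_sum (ν u : ℕ) :
    (crossCount ν u : ℝ) = ∑ s ∈ Finset.range (u + 1), crossTerm ν u s := by
  simp [crossCount, crossTerm]

lemma crossCount_pos (ν u : ℕ) : (0 : ℝ) < crossCount ν u := by
  rw [crossCount_eq_sum]
  refine Finset.sum_pos' (fun s _ => crossTerm_nonneg ν u s) ⟨u, by simp, ?_⟩
  simp [crossTerm]

lemma crossTerm_succ_succ (ν u s : ℕ) :
    ((s : ℝ) + 1) * crossTerm ν (u + 1) (s + 1) = (u + 1) * crossTerm ν u s := by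
  have h := Nat.add_one_mul_choose_eq u s
  have h' : ((u : ℝ) + 1) * u.choose s = (u + 1).choose (s + 1) * (s + 1) := by exact_mod_cast h
  unfold crossTerm
  rw [Nat.add_sub_add_right]
  linear_combination (-(ν.choose (u - s) * 2 ^ (u - s) : ℝ)) * h'

/-- The ratio of consecutive weights; all moment information below comes from this recursion. -/
lemma crossTerm_succ {ν u s : ℕ} (hs : s ≤ u) (hu : u ≤ ν) :
    ((s : ℝ) + 1) * (2 * (ν - u + (s + 1))) * crossTerm ν u (s + 1) =
      (u - s) ^ 2 * crossTerm ν u s := by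
  rcases hs.eq_or_lt with rfl | hs
  · simp [crossTerm]
  obtain ⟨w, rfl⟩ : ∃ w, u = s + w + 1 := ⟨u - s - 1, by omega⟩
  obtain ⟨v, rfl⟩ : ∃ v, ν = s + w + 1 + v := ⟨ν - (s + w + 1), by omega⟩
  have h1 := Nat.choose_succ_right_eq (s + w + 1) s
  have h2 := Nat.choose_succ_right_eq (s + w + 1 + v) w
  rw [show s + w + 1 - s = w + 1 by omega] at h1
  rw [show s + w + 1 + v - w = s + 1 + v by omega] at h2
  have h1' : ((s + w + 1).choose (s + 1) : ℝ) * (s + 1) = (s + w + 1).choose s * (w + 1) := by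
    exact_mod_cast h1
  have h2' : ((s + w + 1 + v).choose (w + 1) : ℝ) * (w + 1) =
      (s + w + 1 + v).choose w * (s + 1 + v) := by exact_mod_cast h2
  unfold crossTerm
  rw [show s + w + 1 - (s + 1) = w by omega, show s + w + 1 - s = w + 1 by omega]
  push_cast
  rw [pow_succ]
  linear_combination (2 * (v + s + 1) * ((s + w + 1 + v).choose w) * 2 ^ w : ℝ) * h1' -
    (2 * (w + 1) * ((s + w + 1).choose s) * 2 ^ w : ℝ) * h2'

/-- Stein-type identity: summing the recursion against a test function `φ`. Taking `φ = 1` and `φ(s)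
= s` gives the two moment relations needed. -/
lemma sum_crossTerm_shift {ν u : ℕ} (hu : u ≤ ν) (φ : ℕ → ℝ) :
    ∑ s ∈ Finset.range (u + 1), φ s * (s * (2 * (ν - u + s))) * crossTerm ν u s =
      ∑ s ∈ Finset.range (u + 1), φ (s + 1) * (u - s) ^ 2 * crossTerm ν u s := by
  rw [Finset.sum_range_succ', Finset.sum_range_succ]
  simp only [CharP.cast_eq_zero, zero_mul, mul_zero, add_zero, sub_self, ne_eq, OfNat.ofNat_ne_zero,
    not_false_eq_true, zero_pow]
  refine Finset.sum_congr rfl fun s hs => ?_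
  have := crossTerm_succ (Finset.mem_range.1 hs).le hu
  push_cast
  linear_combination φ (s + 1) * this

/-- Chebyshev's correlation inequality, by expanding the nonnegative double sum of `a i a j (f i - f
j)(g i - g j)`. -/
lemma sum_mul_sum_le_of_monovary (I : Finset ℕ) (a f g : ℕ → ℝ) (ha : ∀ i ∈ I, 0 ≤ a i)
    (hfg : ∀ i ∈ I, ∀ j ∈ I, 0 ≤ (f i - f j) * (g i - g j)) :
    (∑ i ∈ I, f i * a i) * (∑ i ∈ I, g i * a i) ≤
      (∑ i ∈ I, a i) * (∑ i ∈ I, f i * g i * a i) := by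
  have h : 0 ≤ ∑ i ∈ I, ∑ j ∈ I, a i * a j * ((f i - f j) * (g i - g j)) :=
    Finset.sum_nonneg fun i hi => Finset.sum_nonneg fun j hj =>
      mul_nonneg (mul_nonneg (ha i hi) (ha j hj)) (hfg i hi j hj)
  have h2 : ∑ i ∈ I, ∑ j ∈ I, a i * a j * ((f i - f j) * (g i - g j)) =
      2 * ((∑ i ∈ I, a i) * (∑ i ∈ I, f i * g i * a i) -
        (∑ i ∈ I, f i * a i) * (∑ i ∈ I, g i * a i)) := by
    have e : ∀ i j, a i * a j * ((f i - f j) * (g i - g j)) =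
        (f i * g i * a i) * a j + a i * (f j * g j * a j) - (f i * a i) * (g j * a j)
          - (g i * a i) * (f j * a j) := fun i j => by ring
    simp only [e, Finset.sum_sub_distrib, Finset.sum_add_distrib, ← Finset.mul_sum,
      ← Finset.sum_mul]
    ring
  linarith

/-- Moments of the law on `s` with weights `crossTerm ν u s`. -/
theorem exists_cross_moments {ν u : ℕ} (hu : u ≤ ν) :
    ∃ E V : ℝ, 0 ≤ E ∧ E ^ 2 ≤ V ∧ 2 * ν * E + V = u ^ 2 ∧
      (2 * ((ν : ℝ) - u) - 2) * V ≤ 2 * ((ν : ℝ) - u) * (E ^ 2 + E) ∧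
      (1 ≤ u → (u : ℝ) * crossCount ν (u - 1) = E * crossCount ν u) := by
  set I := Finset.range (u + 1) with hI
  set a := crossTerm ν u with ha
  have ha0 : ∀ i ∈ I, 0 ≤ a i := fun i _ => crossTerm_nonneg ν u i
  set A := ∑ s ∈ I, a s with hA
  have hAc : (crossCount ν u : ℝ) = A := crossCount_eq_sum ν u
  have hApos : 0 < A := hAc ▸ crossCount_pos ν u
  set S1 := ∑ s ∈ I, (s : ℝ) * a s with hS1
  set S2 := ∑ s ∈ I, (s : ℝ) * (s : ℝ) * a s with hS2
  set S3 := ∑ s ∈ I, (s : ℝ) * ((s : ℝ) * (s : ℝ)) * a s with hS3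
  have hS1n : 0 ≤ S1 := Finset.sum_nonneg fun i hi => mul_nonneg (Nat.cast_nonneg _) (ha0 i hi)
  have hS2n : 0 ≤ S2 := Finset.sum_nonneg fun i hi => mul_nonneg (by positivity) (ha0 i hi)
  have c12 : S1 * S1 ≤ A * S2 := sum_mul_sum_le_of_monovary I a (fun s => (s : ℝ))
    (fun s => (s : ℝ)) ha0 fun i _ j _ => mul_self_nonneg _
  have c13 : S1 * S2 ≤ A * S3 := by
    refine sum_mul_sum_le_of_monovary I a (fun s => (s : ℝ)) (fun s => (s : ℝ) * s) ha0
      fun i _ j _ => ?_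
    have : ((i : ℝ) - j) * ((i : ℝ) * i - j * j) = ((i : ℝ) - j) ^ 2 * (i + j) := by ring
    rw [this]; positivity
  set Q := ∑ s ∈ I, ((u : ℝ) - s) ^ 2 * a s with hQ
  have hQe : Q = u ^ 2 * A - 2 * u * S1 + S2 := by
    simp only [hQ, hA, hS1, hS2, Finset.mul_sum, ← Finset.sum_sub_distrib, ← Finset.sum_add_distrib]
    exact Finset.sum_congr rfl fun s _ => by ring
  have r1 : 2 * ((ν : ℝ) - u) * S1 + 2 * S2 = Q := by
    have := sum_crossTerm_shift hu (fun _ => 1)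
    simp only [one_mul] at this
    rw [hQ, ha, ← this, hS1, hS2, Finset.mul_sum, Finset.mul_sum, ← Finset.sum_add_distrib]
    exact Finset.sum_congr rfl fun s _ => by ring
  have r2 : 2 * ((ν : ℝ) - u) * S2 + 2 * S3 =
      ∑ s ∈ I, ((s : ℝ) + 1) * ((u : ℝ) - s) ^ 2 * a s := by
    have := sum_crossTerm_shift hu (fun s => (s : ℝ))
    push_cast at this
    rw [ha, ← this, hS2, hS3, Finset.mul_sum, Finset.mul_sum, ← Finset.sum_add_distrib]
    exact Finset.sum_congr rfl fun s _ => by ring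
  -- `s + 1` increases and `(u - s)²` decreases on `s ≤ u`, so they are negatively correlated.
  -- Combined with `c13` and `r1` this bounds the second moment `V` by roughly `E² + E`, as for a
  -- Poisson variable.
  have c4 : A * (2 * ((ν : ℝ) - u) * S2 + 2 * S3) ≤ (S1 + A) * Q := by
    have h := sum_mul_sum_le_of_monovary I a (fun s => -((s : ℝ) + 1))
      (fun s => ((u : ℝ) - s) ^ 2) ha0 ?_
    · have e1 : ∑ i ∈ I, -((i : ℝ) + 1) * a i = -(S1 + A) := by
        rw [hS1, hA, ← Finset.sum_add_distrib, ← Finset.sum_neg_distrib]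
        exact Finset.sum_congr rfl fun s _ => by ring
      have e2 : ∑ i ∈ I, -((i : ℝ) + 1) * ((u : ℝ) - i) ^ 2 * a i =
          -(2 * ((ν : ℝ) - u) * S2 + 2 * S3) := by
        rw [r2, ← Finset.sum_neg_distrib]
        exact Finset.sum_congr rfl fun s _ => by ring
      rw [e1, e2] at h
      linarith
    · intro i hi j hj
      have hi' : (i : ℝ) ≤ u := by
        exact_mod_cast Nat.lt_succ_iff.1 (Finset.mem_range.1 hi)
      have hj' : (j : ℝ) ≤ u := by
        exact_mod_cast Nat.lt_succ_iff.1 (Finset.mem_range.1 hj)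
      have : (-((i : ℝ) + 1) - -((j : ℝ) + 1)) * (((u : ℝ) - i) ^ 2 - ((u : ℝ) - j) ^ 2) =
          ((i : ℝ) - j) ^ 2 * ((u - i) + (u - j)) := by ring
      rw [this]
      exact mul_nonneg (sq_nonneg _) (by linarith)
  refine ⟨S1 / A, S2 / A, by positivity, ?_, ?_, ?_, ?_⟩
  · rw [div_pow, div_le_div_iff₀ (by positivity) hApos]
    nlinarith
  · field_simp
    linarith
  · have h5 : (2 * ((ν : ℝ) - u) - 2) * S2 * A ≤ 2 * ((ν : ℝ) - u) * (S1 ^ 2 + S1 * A) := by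
      rw [← r1] at c4
      nlinarith
    have e1 : (2 * ((ν : ℝ) - u) - 2) * (S2 / A) = (2 * ((ν : ℝ) - u) - 2) * S2 * A / A ^ 2 := by
      field_simp
    have e2 : 2 * ((ν : ℝ) - u) * ((S1 / A) ^ 2 + S1 / A) =
        2 * ((ν : ℝ) - u) * (S1 ^ 2 + S1 * A) / A ^ 2 := by field_simp
    rw [e1, e2]
    gcongr
  · intro h1
    obtain ⟨v, rfl⟩ : ∃ v, u = v + 1 := ⟨u - 1, by omega⟩
    rw [hAc, Nat.add_sub_cancel, div_mul_cancel₀ _ hApos.ne', crossCount_eq_sum, hS1, hI,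
      Finset.sum_range_succ' (fun s : ℕ => (s : ℝ) * a s), Finset.mul_sum]
    simp only [CharP.cast_eq_zero, zero_mul, add_zero]
    refine Finset.sum_congr rfl fun s _ => ?_
    have := crossTerm_succ_succ ν v s
    push_cast
    rw [ha]
    linarith

end CrossMoments

/-! ### One-step growth of the pair correlation in the overlap. -/

section PairRatio

/-- The probability that `h` given points contain no pair of a uniform matching of `2m` points. -/
noncomputable def avoidProb (m h : ℕ) : ℝ := m.choose h * 2 ^ h / (2 * m).choose h

/-- The joint avoidance probability of two `h`-sets with overlap `t`, divided by the square of
`avoidProb`. -/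
noncomputable def pairRatio (m h t : ℕ) : ℝ :=
  crossCount (m - h) (h - t) / (2 * m - h).choose (h - t) / avoidProb m h

lemma avoidProb_pos {m h : ℕ} (hm : h ≤ m) : 0 < avoidProb m h := by
  have h1 := Nat.choose_pos hm
  have h2 : 0 < (2 * m).choose h := Nat.choose_pos (by omega)
  unfold avoidProb
  positivity

lemma avoidProb_nonneg (m h : ℕ) : 0 ≤ avoidProb m h := by
  unfold avoidProb
  positivity

lemma pairRatio_pos {m h t : ℕ} (hm : h ≤ m) : 0 < pairRatio m h t := by
  have h1 := avoidProb_pos hm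
  have h2 : 0 < (2 * m - h).choose (h - t) := Nat.choose_pos (by omega)
  have h3 := crossCount_pos (m - h) (h - t)
  unfold pairRatio
  positivity

/-- The quotient `crossCount (u - 1) / crossCount u` is `E / u`, with `E` the mean from
`exists_cross_moments` for `ν = m - h` and `u = h - t`. One step of `pairRatio` is thus governed by
`E`, and `E`, `V` are tied by the moment relations. -/
lemma pairRatio_succ {m h t : ℕ} (ht : t < h) (hm : 2 * h ≤ m) :
    ∃ E V : ℝ, 0 ≤ E ∧ E ^ 2 ≤ V ∧ (2 * m - 2 * h) * E + V = ((h : ℝ) - t) ^ 2 ∧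
      (2 * ((m : ℝ) - 2 * h + t) - 2) * V ≤ 2 * ((m : ℝ) - 2 * h + t) * (E ^ 2 + E) ∧
      pairRatio m h (t + 1) * ((h : ℝ) - t) ^ 2 =
        pairRatio m h t * (E * (2 * m - 2 * h + t + 1)) := by
  obtain ⟨v, rfl⟩ : ∃ v, h = t + v + 1 := ⟨h - t - 1, by omega⟩
  obtain ⟨E, V, hE, hEV, h1, h2, h3⟩ :=
    exists_cross_moments (ν := m - (t + v + 1)) (u := v + 1) (by omega)
  have hc : ((m - (t + v + 1) : ℕ) : ℝ) = (m : ℝ) - (t + v + 1) := by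
    rw [Nat.cast_sub (by omega)]; push_cast; ring
  rw [hc] at h1 h2
  push_cast at h1 h2 h3 ⊢
  refine ⟨E, V, hE, hEV, by linarith, ?_, ?_⟩
  · convert h2 using 2 <;> ring
  have h3 := h3 trivial
  have h4 := Nat.choose_succ_right_eq (2 * m - (t + v + 1)) v
  have h4' : ((2 * m - (t + v + 1)).choose (v + 1) : ℝ) * (v + 1) =
      (2 * m - (t + v + 1)).choose v * (2 * m - (t + v + 1) - v) := by
    have e : ((2 * m - (t + v + 1) - v : ℕ) : ℝ) = 2 * (m : ℝ) - (t + v + 1) - v := by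
      rw [Nat.cast_sub (by omega), Nat.cast_sub (by omega)]; push_cast; ring
    rw [← e]
    exact_mod_cast h4
  have p1 : (0 : ℝ) < (2 * m - (t + v + 1)).choose (v + 1) := by
    exact_mod_cast Nat.choose_pos (by omega)
  have p2 : (0 : ℝ) < (2 * m - (t + v + 1)).choose v := by
    exact_mod_cast Nat.choose_pos (by omega)
  have p3 := avoidProb_pos (m := m) (h := t + v + 1) (by omega)
  unfold pairRatio
  rw [show t + v + 1 - (t + 1) = v by omega, show t + v + 1 - t = v + 1 by omega]
  have hv : ((t : ℝ) + v + 1 - t) ^ 2 = ((v : ℝ) + 1) ^ 2 := by ring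
  rw [hv]
  field_simp
  set c := ((2 * m - (t + v + 1)).choose v : ℝ)
  set c' := ((2 * m - (t + v + 1)).choose (v + 1) : ℝ)
  linear_combination (c' * (v + 1)) * h3 +
    (E * (crossCount (m - (t + v + 1)) (v + 1) : ℝ)) * h4'

/-- If `V` were exactly `E²`, then `E` would be the positive root of `x (M - 2h + x) = (h - t)²`,
which equals `T = h²/M` at `t = T`. There the growth factor `E (M - 2h + t) / (h - t)²` is 1, so it
exceeds 1 only by order `(t - T) / (M - 2h)`. -/
lemma moment_upper {M h t E V : ℝ} (hh : 0 < h) (hM : 16 * h ≤ M) (hE : 0 ≤ E) (hEV : E ^ 2 ≤ V)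
    (h1 : (M - 2 * h) * E + V = (h - t) ^ 2) (ht : h ^ 2 / M ≤ t) :
    E * (M - 2 * h + t + 1) ≤
      (h - t) ^ 2 * (1 + ((t - h ^ 2 / M) * (M / (M - 2 * h)) + 1) / (M - 2 * h)) := by
  have hMp : 0 < M := by linarith
  have hD : 0 < M - 2 * h := by linarith
  set T := h ^ 2 / M with hT
  have hTM : T * M = h ^ 2 := by rw [hT]; field_simp
  have hT0 : 0 ≤ T := by positivity
  set γ := 2 * h / (M - 2 * h) with hγ
  have hγD : γ * (M - 2 * h) = 2 * h := by rw [hγ]; field_simp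
  have hγ0 : 0 ≤ γ := by positivity
  have hγ1 : γ ≤ 1 := by rw [hγ, div_le_one hD]; linarith
  set δ := t - T with hδ
  have hδ0 : 0 ≤ δ := by linarith
  have hMD : M / (M - 2 * h) = 1 + γ := by rw [hγ]; field_simp; ring
  -- An affine lower bound for that root when `t ≥ T`, truncated at 0. If `E ≥ l`, then `E² ≤ V`
  -- gives `hEl`; if `E < l`, monotonicity of `x (M - 2h + l)` in `x` does.
  set l := max (T - γ * δ) 0 with hl
  have hl0 : 0 ≤ l := le_max_right _ _
  have hlt : l ≤ t := max_le (by nlinarith) (by linarith)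
  have hlg : T - γ * δ ≤ l := le_max_left _ _
  have hEl : E * (M - 2 * h + l) ≤ (h - t) ^ 2 := by
    rcases le_or_gt l E with h' | h'
    · nlinarith
    · have hpos : 0 < l := lt_of_le_of_lt hE h'
      have hle : l = T - γ * δ := by
        rcases max_choice (T - γ * δ) 0 with h'' | h''
        · rw [hl, h'']
        · rw [hl, h''] at hpos; exact absurd hpos (lt_irrefl _)
      have key : l * (M - 2 * h + l) ≤ (h - t) ^ 2 := by
        have e : (h - t) ^ 2 - l * (M - 2 * h + l) =
            δ * (2 * T + 2 * T * γ + (1 - γ ^ 2) * δ) := by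
          have ht' : t = T + δ := by rw [hδ]; ring
          rw [hle, ht']
          linear_combination (-1) * hTM + δ * hγD
        have : 0 ≤ δ * (2 * T + 2 * T * γ + (1 - γ ^ 2) * δ) := by
          have : 0 ≤ 1 - γ ^ 2 := by nlinarith
          positivity
        linarith
      exact (mul_le_mul_of_nonneg_right h'.le (by linarith)).trans key
  have hstep : M - 2 * h + t + 1 ≤
      (M - 2 * h + l) * (1 + (δ * (M / (M - 2 * h)) + 1) / (M - 2 * h)) := by
    rw [hMD]
    have e1 : t - l + 1 ≤ δ * (1 + γ) + 1 := by nlinarith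
    have e2 : (M - 2 * h) * ((δ * (1 + γ) + 1) / (M - 2 * h)) = δ * (1 + γ) + 1 := by field_simp
    have e3 : 0 ≤ (δ * (1 + γ) + 1) / (M - 2 * h) := by positivity
    nlinarith
  calc E * (M - 2 * h + t + 1)
      ≤ E * ((M - 2 * h + l) * (1 + (δ * (M / (M - 2 * h)) + 1) / (M - 2 * h))) := by gcongr
    _ = E * (M - 2 * h + l) * (1 + (δ * (M / (M - 2 * h)) + 1) / (M - 2 * h)) := by ring
    _ ≤ _ := by
        refine mul_le_mul_of_nonneg_right hEl ?_
        positivity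

/-- The mirror estimate below the mean, where a lower bound on the growth factor is needed. Here `V`
must be bounded from above, which is the purpose of `h2`. -/
lemma moment_lower {M h t E V : ℝ} (hh : 1 ≤ h) (hM : 16 * h ≤ M) (hE : 0 ≤ E) (hEV : E ^ 2 ≤ V)
    (h1 : (M - 2 * h) * E + V = (h - t) ^ 2)
    (h2 : (M - 4 * h + 2 * t - 2) * V ≤ (M - 4 * h + 2 * t) * (E ^ 2 + E))
    (ht0 : 0 ≤ t) (ht : t ≤ h ^ 2 / M) :
    (h - t) ^ 2 ≤ E * (M - 2 * h + t + 1) *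
      (1 + ((h ^ 2 / M - t) * (M / (M - 2 * h)) + 2) / (M - 2 * h)) := by
  have hMp : 0 < M := by linarith
  have hD : 0 < M - 2 * h := by linarith
  set T := h ^ 2 / M with hT
  have hTM : T * M = h ^ 2 := by rw [hT]; field_simp
  have hT0 : 0 ≤ T := by positivity
  have hTh : T ≤ h / 16 := by
    rw [hT, div_le_iff₀ hMp]; nlinarith
  set γ := 2 * h / (M - 2 * h) with hγ
  have hγD : γ * (M - 2 * h) = 2 * h := by rw [hγ]; field_simp
  have hγ0 : 0 ≤ γ := by positivity
  have hγ1 : γ ≤ 1 := by rw [hγ, div_le_one hD]; linarith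
  set δ := T - t with hδ
  have hδ0 : 0 ≤ δ := by linarith
  have hMD : M / (M - 2 * h) = 1 + γ := by rw [hγ]; field_simp; ring
  -- An affine upper bound for the root of `x (M - 2h + x) = (h - t)²`; by `E² ≤ V` it also bounds
  -- `E`.
  set l := T + γ * δ with hl
  have hl0 : 0 ≤ l := by positivity
  have hlh : l ≤ h := by nlinarith
  have hEl : E ≤ l := by
    by_contra! h'
    have key : (h - t) ^ 2 ≤ l * (M - 2 * h + l) := by
      have e : l * (M - 2 * h + l) - (h - t) ^ 2 =
          δ * (2 * T * (1 + γ) - (1 - γ ^ 2) * δ) := by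
        have ht' : t = T - δ := by rw [hδ]; ring
        rw [hl, ht']
        linear_combination hTM + δ * hγD
      have hδT : δ ≤ T := by linarith
      have : 0 ≤ 2 * T * (1 + γ) - (1 - γ ^ 2) * δ := by nlinarith [mul_nonneg hT0 hγ0, mul_nonneg (mul_nonneg hγ0 hγ0) hδ0]
      have := mul_nonneg hδ0 this
      linarith
    nlinarith
  -- The factor `(B + 2)/B` in `h2` is close to 1 because `B ≥ 10 h`; it turns `E + 1` into at most
  -- `l + 3`.
  have hV : V ≤ E * (l + 3) := by
    set B := M - 4 * h + 2 * t - 2 with hB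
    have hB0 : 10 * h ≤ B := by linarith
    have e : M - 4 * h + 2 * t = B + 2 := by rw [hB]; ring
    rw [e] at h2
    have h3 : (B + 2) * (E + 1) ≤ B * (l + 3) := by nlinarith
    have h4 : B * V ≤ B * (E * (l + 3)) := by
      calc B * V ≤ (B + 2) * (E ^ 2 + E) := h2
        _ = E * ((B + 2) * (E + 1)) := by ring
        _ ≤ E * (B * (l + 3)) := by gcongr
        _ = _ := by ring
    exact le_of_mul_le_mul_left h4 (by linarith)
  have h5 : (h - t) ^ 2 ≤ E * (M - 2 * h + l + 3) := by nlinarith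
  have hstep : M - 2 * h + l + 3 ≤
      (M - 2 * h + t + 1) * (1 + (δ * (M / (M - 2 * h)) + 2) / (M - 2 * h)) := by
    rw [hMD]
    have e1 : l - t + 2 = δ * (1 + γ) + 2 := by rw [hl, hδ]; ring
    have e2 : (M - 2 * h) * ((δ * (1 + γ) + 2) / (M - 2 * h)) = δ * (1 + γ) + 2 := by field_simp
    have e3 : 0 ≤ (δ * (1 + γ) + 2) / (M - 2 * h) := by positivity
    nlinarith
  calc (h - t) ^ 2 ≤ E * (M - 2 * h + l + 3) := h5
    _ ≤ E * ((M - 2 * h + t + 1) * (1 + (δ * (M / (M - 2 * h)) + 2) / (M - 2 * h))) := by gcongr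
    _ = _ := by ring

end PairRatio

/-! ### Poisson and Gaussian tails of the hypergeometric overlap. -/

section Hypergeometric

/-- The probability that two independent uniform `k`-subsets of an `N`-set meet in `j` points. -/
noncomputable def overlapProb (N k j : ℕ) : ℝ := k.choose j * (N - k).choose (k - j) / N.choose k

lemma overlapProb_nonneg (N k j : ℕ) : 0 ≤ overlapProb N k j := by
  unfold overlapProb; positivity

lemma sum_overlapProb {N k : ℕ} (hk : k ≤ N) :
    ∑ j ∈ Finset.range (k + 1), overlapProb N k j = 1 := by
  have h := Nat.add_choose_eq k (N - k) k
  rw [Finset.Nat.sum_antidiagonal_eq_sum_range_succ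
    (fun i j => k.choose i * (N - k).choose j), Nat.add_sub_cancel' hk] at h
  unfold overlapProb
  rw [← Finset.sum_div, div_eq_one_iff_eq (by exact_mod_cast (Nat.choose_pos hk).ne'), h]
  push_cast
  rfl

lemma overlapProb_le_one {N k : ℕ} (hk : k ≤ N) {j : ℕ} (hj : j ≤ k) : overlapProb N k j ≤ 1 := by
  rw [← sum_overlapProb hk]
  exact Finset.single_le_sum (fun i _ => overlapProb_nonneg N k i)
    (Finset.mem_range.2 (Nat.lt_succ_of_le hj))

lemma overlapProb_succ {N k j : ℕ} (hk : 2 * k ≤ N) (hj : j < k) :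
    overlapProb N k (j + 1) * ((j + 1) * (N - 2 * k + j + 1)) =
      overlapProb N k j * ((k : ℝ) - j) ^ 2 := by
  obtain ⟨v, rfl⟩ : ∃ v, k = j + v + 1 := ⟨k - j - 1, by omega⟩
  obtain ⟨w, rfl⟩ : ∃ w, N = 2 * (j + v + 1) + w := ⟨N - 2 * (j + v + 1), by omega⟩
  have h1 := Nat.choose_succ_right_eq (j + v + 1) j
  have h2 := Nat.choose_succ_right_eq (2 * (j + v + 1) + w - (j + v + 1)) v
  rw [show j + v + 1 - j = v + 1 by omega] at h1
  rw [show 2 * (j + v + 1) + w - (j + v + 1) - v = j + w + 1 by omega] at h2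
  have h1' : ((j + v + 1).choose (j + 1) : ℝ) * (j + 1) = (j + v + 1).choose j * (v + 1) := by
    exact_mod_cast h1
  have h2' : ((2 * (j + v + 1) + w - (j + v + 1)).choose (v + 1) : ℝ) * (v + 1) =
      (2 * (j + v + 1) + w - (j + v + 1)).choose v * (j + w + 1) := by exact_mod_cast h2
  unfold overlapProb
  rw [show j + v + 1 - (j + 1) = v by omega, show j + v + 1 - j = v + 1 by omega]
  have p1 : (0 : ℝ) < (2 * (j + v + 1) + w).choose (j + v + 1) := by
    exact_mod_cast Nat.choose_pos (by omega)
  field_simp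
  push_cast
  linear_combination
    (((2 * (j + v + 1) + w - (j + v + 1)).choose v : ℝ) * (j + w + 1)) * h1' -
    (((j + v + 1).choose j : ℝ) * (v + 1)) * h2'

/-- The Poisson rate function with mean `μ`. -/
noncomputable def poissonRate (μ x : ℝ) : ℝ := x * Real.log (x / μ) - x + μ

lemma poissonRate_nonneg {μ x : ℝ} (hμ : 0 < μ) (hx : 0 ≤ x) : 0 ≤ poissonRate μ x := by
  unfold poissonRate
  rcases hx.eq_or_lt with rfl | hx
  · simpa using hμ.le
  have h := Real.one_sub_inv_le_log_of_pos (div_pos hx hμ)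
  rw [inv_div] at h
  have : x * (1 - μ / x) = x - μ := by field_simp
  nlinarith [mul_le_mul_of_nonneg_left h hx.le]

lemma poissonRate_le {μ x : ℝ} (hμ : 0 < μ) (hx : 0 < x) :
    poissonRate μ x ≤ (x - μ) ^ 2 / μ := by
  unfold poissonRate
  have h := mul_le_mul_of_nonneg_left (Real.log_le_sub_one_of_pos (div_pos hx hμ)) hx.le
  have : (x - μ) ^ 2 / μ = x * (x / μ - 1) - x + μ := by field_simp; ring
  linarith

/-- Lets a product of ratios `μ / (i + 1)` telescope into a difference of rate functions. -/
lemma poissonRate_succ_le {μ : ℝ} (hμ : 0 < μ) {x : ℝ} (hx : 0 < x) :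
    poissonRate μ (x + 1) - poissonRate μ x ≤ Real.log ((x + 1) / μ) := by
  unfold poissonRate
  have h := Real.log_le_sub_one_of_pos (show 0 < (x + 1) / x by positivity)
  rw [Real.log_div (by positivity) (by positivity)] at h ⊢
  rw [Real.log_div (by positivity) (by positivity)]
  have h2 : x * ((x + 1) / x - 1) = 1 := by field_simp; ring
  nlinarith [mul_le_mul_of_nonneg_left h hx.le]

/-- The mean `μ = k²/N` solves `(k - μ)² = μ (N - 2k + μ)`. Above it, the hypergeometric ratio of
consecutive terms is therefore at most the Poisson ratio `μ / (j + 1)`. -/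
lemma overlapProb_succ_le {N k j : ℕ} (hk : 2 * k ≤ N) (hj : j < k)
    (hμ : (k : ℝ) ^ 2 / N ≤ j) :
    overlapProb N k (j + 1) ≤ overlapProb N k j * (((k : ℝ) ^ 2 / N) / (j + 1)) := by
  have h := overlapProb_succ hk hj
  have hk' : 2 * (k : ℝ) ≤ N := by exact_mod_cast hk
  have hj' : (j : ℝ) + 1 ≤ k := by exact_mod_cast hj
  have hj0 : (0 : ℝ) ≤ j := Nat.cast_nonneg j
  have hN : (0 : ℝ) < N := by linarith
  set μ := (k : ℝ) ^ 2 / N with hμd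
  have hμN : μ * N = (k : ℝ) ^ 2 := by rw [hμd]; field_simp
  have hP := overlapProb_nonneg N k j
  set D := ((N : ℝ) - 2 * k + j + 1) with hD
  have hDp : 0 < D := by rw [hD]; linarith
  have key : ((k : ℝ) - j) ^ 2 ≤ μ * D := by
    have hμk : μ ≤ k := by linarith
    have h1 : ((k : ℝ) - j) ^ 2 ≤ (k - μ) ^ 2 := by
      apply pow_le_pow_left₀ <;> linarith
    have h2 : ((k : ℝ) - μ) ^ 2 = μ * (N - 2 * k + μ) := by linear_combination (-1) * hμN
    have hμ0 : 0 ≤ μ := by positivity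
    have h3 : μ * (N - 2 * k + μ) ≤ μ * D := by
      apply mul_le_mul_of_nonneg_left _ hμ0
      rw [hD]; linarith
    linarith
  rw [← mul_le_mul_iff_left₀ (show 0 < ((j : ℝ) + 1) * D by positivity), h]
  calc overlapProb N k j * ((k : ℝ) - j) ^ 2 ≤ overlapProb N k j * (μ * D) := by gcongr
    _ = _ := by field_simp

/-- The reverse comparison below the mean. Since `j + 1` may exceed `μ` by up to 1, a correction `1
+ 4/N` is paid; `2 μ ≤ k` and `2 k ≤ N` make 4 sufficient. -/
lemma overlapProb_le_succ {N k j : ℕ} (hk : 2 * k ≤ N) (hj : j < k)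
    (hμ : (j : ℝ) ≤ (k : ℝ) ^ 2 / N) :
    overlapProb N k j ≤
      overlapProb N k (j + 1) * (((j + 1) / ((k : ℝ) ^ 2 / N)) * (1 + 4 / N)) := by
  have h := overlapProb_succ hk hj
  have hk' : 2 * (k : ℝ) ≤ N := by exact_mod_cast hk
  have hj' : (j : ℝ) + 1 ≤ k := by exact_mod_cast hj
  have hj0 : (0 : ℝ) ≤ j := Nat.cast_nonneg j
  have hk0 : (0 : ℝ) < k := by linarith
  have hN : (0 : ℝ) < N := by linarith
  set μ := (k : ℝ) ^ 2 / N with hμd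
  have hμp : 0 < μ := by positivity
  have hμN : μ * N = (k : ℝ) ^ 2 := by rw [hμd]; field_simp
  have hP := overlapProb_nonneg N k (j + 1)
  set D := ((N : ℝ) - 2 * k + j + 1) with hD
  have hDp : 0 < D := by rw [hD]; linarith
  have key : μ * D ≤ ((k : ℝ) - j) ^ 2 * (1 + 4 / N) := by
    have hμk : 2 * μ ≤ k := by
      rw [hμd, ← mul_div_assoc, div_le_iff₀ hN]; nlinarith
    have h1 : ((k : ℝ) - μ) ^ 2 ≤ (k - j) ^ 2 := by
      apply pow_le_pow_left₀ <;> linarith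
    have h2 : ((k : ℝ) - μ) ^ 2 = μ * (N - 2 * k + μ) := by linear_combination (-1) * hμN
    have h3 : μ * D ≤ (k - μ) ^ 2 + μ := by
      rw [h2, hD]; nlinarith
    have h4 : μ ≤ (k - μ) ^ 2 * (4 / N) := by
      rw [← mul_div_assoc, le_div_iff₀ hN, hμN]; nlinarith
    have h5 : 0 ≤ 4 / (N : ℝ) := by positivity
    nlinarith
  rw [← mul_le_mul_iff_left₀ (show 0 < ((k : ℝ) - j) ^ 2 from pow_pos (by linarith) 2), ← h]
  calc overlapProb N k (j + 1) * ((j + 1) * D)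
      = overlapProb N k (j + 1) * ((j + 1) / μ) * (μ * D) := by field_simp
    _ ≤ overlapProb N k (j + 1) * ((j + 1) / μ) * (((k : ℝ) - j) ^ 2 * (1 + 4 / N)) := by gcongr
    _ = _ := by ring

variable {N k : ℕ}

lemma ceil_mean_le (hk : 2 * k ≤ N) : ⌈(k : ℝ) ^ 2 / N⌉₊ ≤ k := by
  rw [Nat.ceil_le]
  rcases Nat.eq_zero_or_pos N with rfl | hN
  · simp
  have hN' : (0 : ℝ) < N := by exact_mod_cast hN
  have hk' : 2 * (k : ℝ) ≤ N := by exact_mod_cast hk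
  rw [div_le_iff₀ hN']
  have : (0 : ℝ) ≤ k := Nat.cast_nonneg k
  nlinarith

lemma overlapProb_upper_tail (hk : 2 * k ≤ N) (hμ : 1 ≤ (k : ℝ) ^ 2 / N) {j : ℕ} (hjk : j ≤ k)
    (hj : ⌈(k : ℝ) ^ 2 / N⌉₊ ≤ j) :
    overlapProb N k j ≤ overlapProb N k ⌈(k : ℝ) ^ 2 / N⌉₊ *
      Real.exp (1 - poissonRate ((k : ℝ) ^ 2 / N) j) := by
  set μ := (k : ℝ) ^ 2 / N with hμd
  have hμp : 0 < μ := by linarith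
  set j₀ := ⌈μ⌉₊ with hj₀
  have hj₀μ : μ ≤ j₀ := Nat.le_ceil μ
  have hj₀μ' : (j₀ : ℝ) < μ + 1 := Nat.ceil_lt_add_one hμp.le
  have key : overlapProb N k j ≤
      overlapProb N k j₀ * Real.exp (poissonRate μ j₀ - poissonRate μ j) := by
    induction j, hj using Nat.le_induction with
    | base => simp
    | succ i hi ih =>
      have hiμ : μ ≤ i := hj₀μ.trans (by exact_mod_cast hi)
      have hi0 : (0 : ℝ) < i := by linarith
      refine (overlapProb_succ_le hk (by omega) hiμ).trans ?_
      have ih := ih (by omega)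
      have e : μ / ((i : ℝ) + 1) ≤
          Real.exp (poissonRate μ i - poissonRate μ ((i + 1 : ℕ) : ℝ)) := by
        have h1 := poissonRate_succ_le hμp hi0
        have h2 : Real.exp (-Real.log (((i : ℝ) + 1) / μ)) = μ / (i + 1) := by
          rw [Real.exp_neg, Real.exp_log (by positivity), inv_div]
        rw [← h2]
        apply Real.exp_le_exp.2
        push_cast
        linarith
      calc overlapProb N k i * (μ / (i + 1))
          ≤ (overlapProb N k j₀ * Real.exp (poissonRate μ j₀ - poissonRate μ i)) *
            Real.exp (poissonRate μ i - poissonRate μ ((i + 1 : ℕ) : ℝ)) := by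
            gcongr
            exact mul_nonneg (overlapProb_nonneg _ _ _) (Real.exp_nonneg _)
        _ = _ := by rw [mul_assoc, ← Real.exp_add]; ring_nf
  refine key.trans (mul_le_mul_of_nonneg_left ?_ (overlapProb_nonneg _ _ _))
  apply Real.exp_le_exp.2
  -- Starting from the ceiling of `μ` instead of `μ` itself costs at most `1` in the exponent.
  have h1 := poissonRate_le hμp (show (0 : ℝ) < j₀ by linarith)
  have h2 : ((j₀ : ℝ) - μ) ^ 2 / μ ≤ 1 := by
    rw [div_le_one hμp]; nlinarith
  linarith

lemma overlapProb_lower_tail (hk : 2 * k ≤ N) (hμ : 1 ≤ (k : ℝ) ^ 2 / N) {j : ℕ}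
    (hj : j ≤ ⌈(k : ℝ) ^ 2 / N⌉₊) :
    overlapProb N k j ≤ overlapProb N k ⌈(k : ℝ) ^ 2 / N⌉₊ *
      Real.exp (4 - ((k : ℝ) ^ 2 / N - j) ^ 2 / (2 * ((k : ℝ) ^ 2 / N))) := by
  have hceil := ceil_mean_le hk
  have hk' : 2 * (k : ℝ) ≤ N := by exact_mod_cast hk
  have hN0 : (N : ℝ) ≠ 0 := by
    intro h; rw [h] at hμ; simp at hμ; linarith
  have hN : (0 : ℝ) < N := lt_of_le_of_ne (Nat.cast_nonneg N) hN0.symm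
  set μ := (k : ℝ) ^ 2 / N with hμd
  have hμp : 0 < μ := by linarith
  set j₀ := ⌈μ⌉₊ with hj₀
  have hj₀μ : μ ≤ j₀ := Nat.le_ceil μ
  have hj₀μ' : (j₀ : ℝ) < μ + 1 := Nat.ceil_lt_add_one hμp.le
  -- Downward induction on the distance `v` to `j₀`. The increments `(i + 1 - μ)/μ` of the exponent
  -- sum to a quadratic; the leftovers, at most `1/(2μ) + 4/N` per step, add up to at most 3.
  have key : ∀ v i : ℕ, i + v = j₀ → overlapProb N k i ≤ overlapProb N k j₀ *
      Real.exp (-(μ - i) ^ 2 / (2 * μ) + (j₀ - μ) ^ 2 / (2 * μ) + v * (1 / (2 * μ) + 4 / N)) := by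
    intro v
    induction v with
    | zero =>
      intro i hi
      rw [show i = j₀ from hi]
      refine le_mul_of_one_le_right (overlapProb_nonneg _ _ _) (Real.one_le_exp ?_)
      simp only [CharP.cast_eq_zero, add_zero, zero_mul]
      rw [← add_div]
      have : -(μ - (j₀ : ℝ)) ^ 2 + ((j₀ : ℝ) - μ) ^ 2 = 0 := by ring
      rw [this]; simp
    | succ v ih =>
      intro i hi
      have ih := ih (i + 1) (by omega)
      have hiμ : (i : ℝ) ≤ μ := by
        by_contra! hlt
        have : μ ≤ ((i : ℕ) : ℝ) := hlt.le
        have := Nat.ceil_le.2 this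
        omega
      refine (overlapProb_le_succ hk (by omega) hiμ).trans ?_
      have e : (((i : ℝ) + 1) / μ) * (1 + 4 / N) ≤ Real.exp (((i : ℝ) + 1 - μ) / μ + 4 / N) := by
        rw [Real.exp_add]
        have h1 := Real.add_one_le_exp (((i : ℝ) + 1 - μ) / μ)
        have h2 := Real.add_one_le_exp (4 / (N : ℝ))
        have h3 : ((i : ℝ) + 1 - μ) / μ + 1 = ((i : ℝ) + 1) / μ := by field_simp; ring
        rw [h3] at h1
        gcongr
        linarith
      calc overlapProb N k (i + 1) * ((((i : ℝ) + 1) / μ) * (1 + 4 / N))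
          ≤ _ * Real.exp (((i : ℝ) + 1 - μ) / μ + 4 / N) := by
            apply mul_le_mul ih e (by positivity)
            exact mul_nonneg (overlapProb_nonneg _ _ _) (Real.exp_nonneg _)
        _ = _ := by
            rw [mul_assoc, ← Real.exp_add]
            congr 2
            push_cast
            field_simp
            ring
  refine (key (j₀ - j) j (by omega)).trans
    (mul_le_mul_of_nonneg_left ?_ (overlapProb_nonneg _ _ _))
  apply Real.exp_le_exp.2
  have h2 : ((j₀ : ℝ) - μ) ^ 2 / (2 * μ) ≤ 1 / 2 := by
    rw [div_le_iff₀ (by positivity)]; nlinarith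
  have h3 : ((j₀ - j : ℕ) : ℝ) ≤ j₀ := by exact_mod_cast Nat.sub_le _ _
  have h4 : (j₀ : ℝ) * (1 / (2 * μ) + 4 / N) ≤ 3 := by
    have a1 : (j₀ : ℝ) * (1 / (2 * μ)) ≤ 1 := by
      rw [mul_one_div, div_le_one (by positivity)]; linarith
    have a2 : (j₀ : ℝ) * (4 / N) ≤ 2 := by
      rw [← mul_div_assoc, div_le_iff₀ hN]
      have : (j₀ : ℝ) ≤ k := by exact_mod_cast hceil
      linarith
    linarith
  have h5 : ((j₀ - j : ℕ) : ℝ) * (1 / (2 * μ) + 4 / N) ≤ j₀ * (1 / (2 * μ) + 4 / N) := by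
    gcongr
  rw [neg_div]
  linarith

lemma overlapProb_le_mode (hk : 2 * k ≤ N) (hμ : 1 ≤ (k : ℝ) ^ 2 / N) {j : ℕ} (hj : j ≤ k) :
    overlapProb N k j ≤ overlapProb N k ⌈(k : ℝ) ^ 2 / N⌉₊ * Real.exp 4 := by
  rcases le_total ⌈(k : ℝ) ^ 2 / N⌉₊ j with h | h
  · refine (overlapProb_upper_tail hk hμ hj h).trans
      (mul_le_mul_of_nonneg_left ?_ (overlapProb_nonneg _ _ _))
    apply Real.exp_le_exp.2
    linarith [poissonRate_nonneg (show 0 < (k : ℝ) ^ 2 / N by linarith) (Nat.cast_nonneg j)]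
  · refine (overlapProb_lower_tail hk hμ h).trans
      (mul_le_mul_of_nonneg_left ?_ (overlapProb_nonneg _ _ _))
    apply Real.exp_le_exp.2
    have : 0 ≤ ((k : ℝ) ^ 2 / N - j) ^ 2 / (2 * ((k : ℝ) ^ 2 / N)) := by positivity
    linarith

/-- Pigeonhole: the `k + 1` probabilities sum to 1, and each is at most `exp 4` times the one at the
ceiling of the mean. -/
theorem one_le_mode_overlapProb (hk : 2 * k ≤ N) (hμ : 1 ≤ (k : ℝ) ^ 2 / N) :
    1 ≤ (k + 1) * (overlapProb N k ⌈(k : ℝ) ^ 2 / N⌉₊ * Real.exp 4) := by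
  refine (sum_overlapProb (show k ≤ N by omega)).symm.le.trans ?_
  refine (Finset.sum_le_card_nsmul _ _ _ fun j hj => overlapProb_le_mode hk hμ
    (Nat.lt_succ_iff.1 (Finset.mem_range.1 hj))).trans ?_
  simp

end Hypergeometric

/-! ### Gaussian bound for the pair correlation. -/

section PairRatioBound

/-- Given one avoiding `h`-set, the left side is the number of avoiding sets with overlap `h - u`,
the right side the number of all avoiding sets. The proof compares terms in Vandermonde's identity,
indexed by the number `c = s + t` of pairs of the first set that are met, using `(s + t).choose s ≤
2 ^ (s + t)`. -/
lemma choose_mul_crossCount_le {m h u : ℕ} (hu : u ≤ h) (hm : h ≤ m) :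
    h.choose u * crossCount (m - h) u ≤ m.choose h * 2 ^ h := by
  have hV : m.choose h = ∑ c ∈ Finset.range (h + 1), h.choose c * (m - h).choose (h - c) := by
    have := Nat.add_choose_eq h (m - h) h
    rwa [Finset.Nat.sum_antidiagonal_eq_sum_range_succ
      (fun i j => h.choose i * (m - h).choose j), Nat.add_sub_cancel' hm] at this
  rw [hV, Finset.sum_mul, crossCount, Finset.mul_sum]
  obtain ⟨t, rfl⟩ : ∃ t, h = u + t := ⟨h - u, by omega⟩
  have hle : ∀ s ∈ Finset.range (u + 1), (u + t).choose u * (u.choose s *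
      ((m - (u + t)).choose (u - s) * 2 ^ (u - s))) ≤
      (u + t).choose (s + t) * (m - (u + t)).choose (u + t - (s + t)) * 2 ^ (u + t) := by
    intro s hs
    have hs : s ≤ u := Nat.lt_succ_iff.1 (Finset.mem_range.1 hs)
    have e0 : u + t - (s + t) = u - s := by omega
    have e1 : (u + t).choose u * u.choose s = (u + t).choose (s + t) * (s + t).choose s := by
      have a := Nat.choose_mul (n := u + t) (k := s + t) (s := s) (by omega)
      have b := Nat.choose_mul (n := u + t) (k := u) (s := s) hs
      rw [a, b]
      congr 1
      rw [show s + t - s = t by omega]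
      rw [show u + t - s = (u - s) + t by omega]
      exact Nat.choose_symm_add
    rw [e0]
    have e2 : (s + t).choose s ≤ 2 ^ (s + t) := Nat.choose_le_two_pow _ _
    have e3 : 2 ^ (u + t) = 2 ^ (s + t) * 2 ^ (u - s) := by rw [← pow_add]; congr 1; omega
    calc _ = (u + t).choose (s + t) * (s + t).choose s *
          ((m - (u + t)).choose (u - s) * 2 ^ (u - s)) := by rw [← e1]; ring
      _ ≤ (u + t).choose (s + t) * 2 ^ (s + t) *
          ((m - (u + t)).choose (u - s) * 2 ^ (u - s)) := by gcongr
      _ = _ := by rw [e3]; ring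
  refine (Finset.sum_le_sum hle).trans ?_
  rw [← Finset.sum_image (f := fun c => (u + t).choose c * (m - (u + t)).choose (u + t - c) *
    2 ^ (u + t)) (g := fun s => s + t) (fun a _ b _ h => by simpa using h)]
  refine Finset.sum_le_sum_of_subset fun x hx => ?_
  obtain ⟨s, hs, rfl⟩ := Finset.mem_image.1 hx
  simp only [Finset.mem_range] at hs ⊢
  omega

/-- The product is the probability that two random avoiding sets of one matching have overlap `t`.
This bounds `pairRatio` wherever the hypergeometric law is not small. -/
lemma pairRatio_mul_overlapProb_le {m h t : ℕ} (ht : t ≤ h) (hm : h ≤ m) :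
    pairRatio m h t * overlapProb (2 * m) h t ≤ 1 := by
  have h1 := choose_mul_crossCount_le (Nat.sub_le h t) hm
  rw [Nat.choose_symm ht] at h1
  have h1' : (h.choose t : ℝ) * crossCount (m - h) (h - t) ≤ m.choose h * 2 ^ h := by
    exact_mod_cast h1
  have p1 : (0 : ℝ) < (2 * m - h).choose (h - t) := by exact_mod_cast Nat.choose_pos (by omega)
  have p2 : (0 : ℝ) < (2 * m).choose h := by exact_mod_cast Nat.choose_pos (by omega)
  have p3 : (0 : ℝ) < m.choose h := by exact_mod_cast Nat.choose_pos hm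
  unfold pairRatio overlapProb avoidProb
  have : (crossCount (m - h) (h - t) : ℝ) / (2 * m - h).choose (h - t) /
      (m.choose h * 2 ^ h / (2 * m).choose h) *
      (h.choose t * (2 * m - h).choose (h - t) / (2 * m).choose h) =
      (h.choose t : ℝ) * crossCount (m - h) (h - t) / (m.choose h * 2 ^ h) := by
    field_simp
  rw [this]
  exact (div_le_one (by positivity)).2 h1'

lemma pairRatio_succ_le {m h t : ℕ} (ht : t < h) (hm : 8 * h ≤ m)
    (hT : (h : ℝ) ^ 2 / (2 * m) ≤ t) :
    pairRatio m h (t + 1) ≤ pairRatio m h t * Real.exp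
      (((t - (h : ℝ) ^ 2 / (2 * m)) * (2 * m / (2 * m - 2 * h)) + 1) / (2 * m - 2 * h)) := by
  obtain ⟨E, V, hE, hEV, h1, -, h3⟩ := pairRatio_succ ht (by omega : 2 * h ≤ m)
  have hm' : 8 * (h : ℝ) ≤ m := by exact_mod_cast hm
  have ht' : (t : ℝ) + 1 ≤ h := by exact_mod_cast ht
  have ht0 : (0 : ℝ) ≤ t := Nat.cast_nonneg t
  have hu := moment_upper (M := 2 * m) (h := h) (t := t) (by linarith) (by linarith) hE hEV h1 hT
  have hw := (pairRatio_pos (m := m) (h := h) (t := t) (by omega)).le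
  rw [← mul_le_mul_iff_left₀ (show 0 < ((h : ℝ) - t) ^ 2 from pow_pos (by linarith) 2), h3]
  calc _ ≤ pairRatio m h t * _ := mul_le_mul_of_nonneg_left hu hw
    _ ≤ pairRatio m h t * (((h : ℝ) - t) ^ 2 * Real.exp (((t - (h : ℝ) ^ 2 / (2 * m)) *
        (2 * m / (2 * m - 2 * h)) + 1) / (2 * m - 2 * h))) := by
        gcongr
        rw [add_comm]
        exact Real.add_one_le_exp _
    _ = _ := by ring

lemma pairRatio_le_succ {m h t : ℕ} (ht : t < h) (hm : 8 * h ≤ m)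
    (hT : t ≤ (h : ℝ) ^ 2 / (2 * m)) :
    pairRatio m h t ≤ pairRatio m h (t + 1) * Real.exp
      ((((h : ℝ) ^ 2 / (2 * m) - t) * (2 * m / (2 * m - 2 * h)) + 2) / (2 * m - 2 * h)) := by
  obtain ⟨E, V, hE, hEV, h1, h2, h3⟩ := pairRatio_succ ht (by omega : 2 * h ≤ m)
  have hm' : 8 * (h : ℝ) ≤ m := by exact_mod_cast hm
  have ht' : (t : ℝ) + 1 ≤ h := by exact_mod_cast ht
  have ht0 : (0 : ℝ) ≤ t := Nat.cast_nonneg t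
  have hu := moment_lower (M := 2 * m) (h := h) (t := t) (by linarith) (by linarith) hE hEV h1
    (by convert h2 using 2 <;> ring) ht0 hT
  have hw := (pairRatio_pos (m := m) (h := h) (t := t) (by omega)).le
  have hw' := (pairRatio_pos (m := m) (h := h) (t := t + 1) (by omega)).le
  rw [← mul_le_mul_iff_left₀ (show 0 < ((h : ℝ) - t) ^ 2 from pow_pos (by linarith) 2)]
  set x := (((h : ℝ) ^ 2 / (2 * m) - t) * (2 * m / (2 * m - 2 * h)) + 2) / (2 * m - 2 * h)
  calc pairRatio m h t * ((h : ℝ) - t) ^ 2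
      ≤ pairRatio m h t * (E * (2 * m - 2 * h + t + 1) * (1 + x)) :=
        mul_le_mul_of_nonneg_left hu hw
    _ = pairRatio m h (t + 1) * ((h : ℝ) - t) ^ 2 * (1 + x) := by rw [h3]; ring
    _ ≤ pairRatio m h (t + 1) * ((h : ℝ) - t) ^ 2 * Real.exp x := by
        gcongr
        rw [add_comm]
        exact Real.add_one_le_exp _
    _ = _ := by ring

/-- The overlap correlation of the avoidance events is at most Gaussian in the deviation of the
overlap from its mean. -/
theorem pairRatio_le {m h t : ℕ} (hm : 8 * h ≤ m) (ht : t ≤ h)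
    (hμ : 1 ≤ (h : ℝ) ^ 2 / (2 * m)) :
    pairRatio m h t ≤ (h + 1) * Real.exp
      (2 * m / (2 * m - 2 * h) ^ 2 * ((t - (h : ℝ) ^ 2 / (2 * m)) ^ 2 / 2) + 6) := by
  have hm' : 8 * (h : ℝ) ≤ m := by exact_mod_cast hm
  have hm0 : (0 : ℝ) < m := by
    rcases Nat.eq_zero_or_pos m with rfl | h
    · simp at hμ; linarith
    · exact_mod_cast h
  have hceil : ⌈(h : ℝ) ^ 2 / (2 * m)⌉₊ ≤ h := by
    have := ceil_mean_le (k := h) (N := 2 * m) (by omega)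
    push_cast at this
    exact this
  -- The starting value comes without asymptotics: at the mode the overlap probability is at least
  -- `exp(-4)/(h + 1)`, so `pairRatio` is at most `(h + 1) exp 4` there. The mode sits at the
  -- ceiling of the same `T` from which the one-step bounds start in both directions.
  have hbase : pairRatio m h ⌈(h : ℝ) ^ 2 / (2 * m)⌉₊ ≤ (h + 1) * Real.exp 4 := by
    have h1 := pairRatio_mul_overlapProb_le hceil (show h ≤ m by omega)
    have h2 := one_le_mode_overlapProb (k := h) (N := 2 * m) (by omega) (by push_cast; exact hμ)
    push_cast at h2
    have h3 := (pairRatio_pos (m := m) (h := h) (t := ⌈(h : ℝ) ^ 2 / (2 * m)⌉₊) (by omega)).le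
    calc _ ≤ pairRatio m h ⌈(h : ℝ) ^ 2 / (2 * m)⌉₊ * ((h + 1) *
          (overlapProb (2 * m) h ⌈(h : ℝ) ^ 2 / (2 * m)⌉₊ * Real.exp 4)) :=
          le_mul_of_one_le_right h3 h2
      _ = (pairRatio m h ⌈(h : ℝ) ^ 2 / (2 * m)⌉₊ *
          overlapProb (2 * m) h ⌈(h : ℝ) ^ 2 / (2 * m)⌉₊) * ((h + 1) * Real.exp 4) := by ring
      _ ≤ 1 * ((h + 1) * Real.exp 4) := by gcongr
      _ = _ := one_mul _
  set T := (h : ℝ) ^ 2 / (2 * m) with hT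
  have hTp : 0 < T := by linarith
  set t₀ := ⌈T⌉₊ with ht₀
  have ht₀T : T ≤ t₀ := Nat.le_ceil T
  set D := 2 * (m : ℝ) - 2 * h with hD
  have hh0 : (0 : ℝ) ≤ h := Nat.cast_nonneg h
  have hDp : 0 < D := by linarith
  set κ := 2 * m / D ^ 2 with hκ
  have hκ0 : 0 ≤ κ := by positivity
  have hhD : 14 * (h : ℝ) ≤ D := by linarith
  have hw₀ := (pairRatio_pos (m := m) (h := h) (t := t₀) (by omega)).le
  have hexp : ∀ x : ℝ, ∀ c, (x * (2 * m / D) + c) / D = κ * x + c / D := by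
    intro x c; rw [hκ]; field_simp
  have hfin : pairRatio m h t ≤ pairRatio m h t₀ * Real.exp (κ * ((t - T) ^ 2 / 2) + 2) := by
    rcases le_total t₀ t with h' | h'
    -- The increments `κ (i - T) + 1/D` sum to the quadratic plus `(t - t₀)/D`. The last part is
    -- below the allowed 2 because `h ≤ D/14`.
    · have key : pairRatio m h t ≤
          pairRatio m h t₀ * Real.exp (κ * ((t - T) ^ 2 / 2) + (t - t₀) * (1 / D)) := by
        clear hbase
        induction t, h' using Nat.le_induction with
        | base =>
          refine le_mul_of_one_le_right hw₀ (Real.one_le_exp ?_)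
          simp only [sub_self, zero_mul, add_zero]
          positivity
        | succ i hi ih =>
          have hiT : T ≤ i := ht₀T.trans (by exact_mod_cast hi)
          refine (pairRatio_succ_le (by omega) hm hiT).trans ?_
          rw [hexp]
          refine (mul_le_mul_of_nonneg_right (ih (by omega)) (Real.exp_nonneg _)).trans ?_
          rw [mul_assoc, ← Real.exp_add]
          refine mul_le_mul_of_nonneg_left (Real.exp_le_exp.2 ?_) hw₀
          push_cast
          have : κ * ((i + 1 - T) ^ 2 / 2) = κ * ((i - T) ^ 2 / 2) + κ * (i - T) + κ / 2 := by ring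
          rw [this]
          have : ((i : ℝ) + 1 - t₀) * (1 / D) = (i - t₀) * (1 / D) + 1 / D := by ring
          linarith
      refine key.trans ?_
      gcongr
      rw [mul_one_div, div_le_iff₀ hDp]
      have : (t : ℝ) ≤ h := by exact_mod_cast ht
      have : (0 : ℝ) ≤ t₀ := Nat.cast_nonneg _
      linarith
    -- Going down from `t₀`, each step costs `κ (T - i) + 2/D`. The discrete sum differs from the
    -- quadratic by `κ/2` per step, and all leftovers together stay below 2.
    · have key : ∀ v i : ℕ, i + v = t₀ → pairRatio m h i ≤ pairRatio m h t₀ *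
          Real.exp (κ * ((i - T) ^ 2 / 2) + v * (2 / D + κ / 2)) := by
        intro v
        induction v with
        | zero =>
          rintro i rfl
          refine le_mul_of_one_le_right hw₀ (Real.one_le_exp ?_)
          push_cast
          simp only [zero_mul, add_zero]
          positivity
        | succ v ih =>
          intro i hi
          have ih := ih (i + 1) (by omega)
          have hiT : (i : ℝ) ≤ T := by
            by_contra! hlt
            have : T ≤ ((i : ℕ) : ℝ) := hlt.le
            have := Nat.ceil_le.2 this
            omega
          refine (pairRatio_le_succ (by omega) hm hiT).trans ?_
          rw [hexp]
          refine (mul_le_mul_of_nonneg_right ih (Real.exp_nonneg _)).trans ?_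
          rw [mul_assoc, ← Real.exp_add]
          refine mul_le_mul_of_nonneg_left (Real.exp_le_exp.2 ?_) hw₀
          push_cast
          apply le_of_eq
          ring
      refine (key (t₀ - t) t (by omega)).trans ?_
      gcongr
      have h3 : ((t₀ - t : ℕ) : ℝ) ≤ h := by exact_mod_cast (Nat.sub_le _ _).trans hceil
      have h4 : (h : ℝ) * (2 / D + κ / 2) ≤ 2 := by
        have a1 : (h : ℝ) * (2 / D) ≤ 1 := by
          rw [← mul_div_assoc, div_le_one hDp]; linarith
        have a2 : (h : ℝ) * (κ / 2) ≤ 1 := by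
          rw [hκ]
          have : (h : ℝ) * (2 * m / D ^ 2 / 2) = h * m / D ^ 2 := by field_simp
          rw [this, div_le_one (by positivity)]
          nlinarith
        linarith
      have h5 : ((t₀ - t : ℕ) : ℝ) * (2 / D + κ / 2) ≤ h * (2 / D + κ / 2) := by gcongr
      linarith
  refine hfin.trans ((mul_le_mul_of_nonneg_right hbase (Real.exp_nonneg _)).trans ?_)
  rw [mul_assoc, ← Real.exp_add]
  refine mul_le_mul_of_nonneg_left (Real.exp_le_exp.2 ?_) (by positivity)
  linarith

end PairRatioBound

/-! ### Quadratic lower bounds for the Poisson rate. -/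

section QuadraticRate

lemma hasDerivAt_poissonRate {μ x : ℝ} (hμ : 0 < μ) (hx : 0 < x) :
    HasDerivAt (poissonRate μ) (Real.log (x / μ)) x := by
  have h1 : HasDerivAt (fun y : ℝ => Real.log (y / μ)) (x⁻¹) x := by
    have := ((hasDerivAt_id' x).div_const μ).log (div_pos hx hμ).ne'
    exact this.congr_deriv (by field_simp)
  have h2 := (((hasDerivAt_id' x).mul h1).sub (hasDerivAt_id' x)).add_const μ
  refine h2.congr_deriv ?_
  rw [mul_inv_cancel₀ hx.ne']
  ring

/-- The sign of the derivative reduces to `log (x/μ) ≥ 2 (x - μ)/(x + μ)`. -/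
lemma poissonRate_div_sq_antitone {μ : ℝ} (hμ : 0 < μ) :
    AntitoneOn (fun x => poissonRate μ x / (x - μ) ^ 2) (Set.Ioi μ) := by
  have hd : ∀ x ∈ Set.Ioi μ, HasDerivAt (fun x => poissonRate μ x / (x - μ) ^ 2)
      ((Real.log (x / μ) * (x - μ) ^ 2 - poissonRate μ x * (2 * (x - μ))) /
        ((x - μ) ^ 2) ^ 2) x := by
    intro x hx
    have hx' : 0 < x - μ := sub_pos.2 hx
    have h1 : HasDerivAt (fun x => (x - μ) ^ 2) (2 * (x - μ)) x := by
      have := ((hasDerivAt_id' x).sub_const μ).pow 2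
      exact this.congr_deriv (by simp)
    exact (hasDerivAt_poissonRate hμ (hμ.trans hx)).div h1 (by positivity)
  apply antitoneOn_of_deriv_nonpos (convex_Ioi μ)
  · exact fun x hx => (hd x hx).continuousAt.continuousWithinAt
  · rw [interior_Ioi]
    exact fun x hx => (hd x hx).differentiableAt.differentiableWithinAt
  · rw [interior_Ioi]
    intro x hx
    rw [(hd x hx).deriv]
    have hx' : 0 < x - μ := sub_pos.2 hx
    have hxp : 0 < x := hμ.trans hx
    apply div_nonpos_of_nonpos_of_nonneg _ (by positivity)
    have hl := Real.le_log_one_add_of_nonneg (x := (x - μ) / μ) (by positivity)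
    have e1 : 1 + (x - μ) / μ = x / μ := by field_simp; ring
    have e2 : 2 * ((x - μ) / μ) / ((x - μ) / μ + 2) = 2 * (x - μ) / (x + μ) := by
      field_simp; ring
    rw [e1, e2, div_le_iff₀ (by positivity)] at hl
    unfold poissonRate
    nlinarith

/-- By monotonicity of the quotient, a quadratic minorant need only be checked at the right endpoint
`X`. -/
lemma quadratic_le_poissonRate {μ x X κ : ℝ} (hμ : 0 < μ) (hx : μ ≤ x) (hxX : x ≤ X)
    (hX : κ * (X - μ) ^ 2 ≤ poissonRate μ X) : κ * (x - μ) ^ 2 ≤ poissonRate μ x := by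
  rcases hx.eq_or_lt with rfl | hx
  · simpa using poissonRate_nonneg hμ hμ.le
  have h := poissonRate_div_sq_antitone hμ hx (hx.trans_le hxX) hxX
  have h1 : 0 < (x - μ) ^ 2 := pow_pos (sub_pos.2 hx) 2
  have h2 : 0 < (X - μ) ^ 2 := pow_pos (sub_pos.2 (hx.trans_le hxX)) 2
  rw [← le_div_iff₀ h2] at hX
  rw [← le_div_iff₀ h1]
  exact hX.trans h

end QuadraticRate

/-! ### Overlap entropy against pair correlation. -/

section SecondMomentSum

lemma sq_add_le {x y η : ℝ} (hη : 0 < η) :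
    (x + y) ^ 2 ≤ (1 + η) * x ^ 2 + (1 + 1 / η) * y ^ 2 := by
  have h : 0 ≤ (η * x - y) ^ 2 / η := by positivity
  have e : (η * x - y) ^ 2 / η = η * x ^ 2 - 2 * x * y + 1 / η * y ^ 2 := by field_simp; ring
  rw [e] at h
  linarith

/-- Here `(a + d k)²/(2m)` is the mean overlap counted in half-edges and `d k²/N` its value read off
from vertices outside `U`. Relative to `2m = dN` and `a = 0`, the `a` free half-edges at `τ` and the
enlargement of `2m` to at most `d (N + b)` each shift the comparison by at most `d b`. -/
lemma mean_overlap_bounds {N d b a m k : ℝ} (hd : 0 < d) (hN : 0 < N) (hb : 0 ≤ b) (ha : 0 ≤ a)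
    (hk : 0 ≤ k) (hab : a ≤ d * b) (hm1 : d * N ≤ 2 * m) (hm2 : 2 * m ≤ d * N + d * b)
    (hkb : 2 * k + b ≤ N) :
    0 ≤ a - ((a + d * k) ^ 2 / (2 * m) - d * (k ^ 2 / N)) ∧
      a - ((a + d * k) ^ 2 / (2 * m) - d * (k ^ 2 / N)) ≤ 2 * (d * b) := by
  have hdN : 0 < d * N := by positivity
  have hM : 0 < 2 * m := by linarith
  constructor
  · have h1 : (a + d * k) ^ 2 / (2 * m) ≤ (a + d * k) ^ 2 / (d * N) := by gcongr
    have h2 : (a + d * k) ^ 2 / (d * N) ≤ a + d * (k ^ 2 / N) := by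
      rw [div_le_iff₀ hdN]
      have : (a + d * (k ^ 2 / N)) * (d * N) = a * (d * N) + d ^ 2 * k ^ 2 := by field_simp
      rw [this]
      have h3 : a * (2 * (d * k) + a) ≤ a * (d * N) := by
        gcongr
        nlinarith
      nlinarith
    linarith
  · have h1 : d * (k ^ 2 / N) - d * b ≤ (a + d * k) ^ 2 / (2 * m) := by
      rw [le_div_iff₀ hM]
      have hkN : k ^ 2 / N ≤ N := by
        rw [div_le_iff₀ hN]; nlinarith
      have e : k ^ 2 / N * N = k ^ 2 := by field_simp
      have hx0 : 0 ≤ k ^ 2 / N := by positivity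
      set x := k ^ 2 / N
      rcases le_or_gt x b with hxb | hxb
      · have : (d * x - d * b) * (2 * m) ≤ 0 := by
          apply mul_nonpos_of_nonpos_of_nonneg _ hM.le
          nlinarith
        nlinarith [sq_nonneg (a + d * k)]
      · have h3 : (d * x - d * b) * (2 * m) ≤ (d * x - d * b) * (d * N + d * b) := by
          apply mul_le_mul_of_nonneg_left hm2
          nlinarith
        have h4 : (d * x - d * b) * (d * N + d * b) =
            d ^ 2 * (k ^ 2 - b * (N - x) - b ^ 2) := by rw [← e]; ring
        have h5 : 0 ≤ b * (N - x) := mul_nonneg hb (by linarith)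
        have h6 : d ^ 2 * (k ^ 2 - b * (N - x) - b ^ 2) ≤ d ^ 2 * k ^ 2 := by
          gcongr
          nlinarith [sq_nonneg b]
        nlinarith [mul_nonneg ha (mul_nonneg hd.le hk), sq_nonneg a]
    linarith

/-- The Gaussian exponent of `pairRatio_le`, rewritten around the mean overlap `k ^ 2 / N`. -/
lemma pairRatio_exponent_le {N d b m h x T μ y α β η K : ℝ} (hd : 0 < d) (hN : 0 < N)
    (hη : 0 < η) (hK0 : 0 ≤ K) (hαβ : 2 * (α + β) ≤ 1)
    (hK : 1 + η ≤ K * (1 - 2 * (α + β)) ^ 2) (hm : d * N ≤ 2 * m)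
    (hh : h ≤ (α + β) * (2 * m)) (hMD : d * N * m ≤ (2 * m - 2 * h) ^ 2)
    (hDp : 0 < 2 * m - 2 * h)
    (hx : x - T = d * (y - μ) + (x - T - d * (y - μ)))
    (hb0 : 0 ≤ x - T - d * (y - μ)) (hb : x - T - d * (y - μ) ≤ 2 * (d * b)) :
    2 * m / (2 * m - 2 * h) ^ 2 * ((x - T) ^ 2 / 2) ≤
      K * d / (2 * N) * (y - μ) ^ 2 + (1 + 1 / η) * 4 * d * b ^ 2 / N := by
  have hdN : 0 < d * N := by positivity
  have hM : 0 < 2 * m := by linarith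
  set D := 2 * m - 2 * h with hD
  -- The half-edge deviation is `d (y - μ)` plus a shift between 0 and `2 d b`. Young's inequality
  -- charges a factor `1 + η` to the main part, which `K` absorbs along with the ratio of `2m` to
  -- `2m - 2h`.
  have hsq := sq_add_le (x := d * (y - μ)) (y := x - T - d * (y - μ)) hη
  rw [← hx] at hsq
  have hy2 : (x - T - d * (y - μ)) ^ 2 ≤ (2 * (d * b)) ^ 2 := pow_le_pow_left₀ hb0 hb 2
  have hη' : 0 < 1 + 1 / η := by positivity
  have hsq2 : (x - T) ^ 2 ≤ (1 + η) * (d * (y - μ)) ^ 2 + (1 + 1 / η) * (2 * (d * b)) ^ 2 :=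
    hsq.trans (by gcongr)
  have hMD1 : 2 * m / D ^ 2 ≤ 2 / (d * N) := by
    rw [div_le_div_iff₀ (by positivity) hdN]
    linarith
  have hMD2 : 2 * m / D ^ 2 * (1 + η) ≤ K / (d * N) := by
    have hr : (1 - 2 * (α + β)) * (2 * m) ≤ D := by
      rw [hD]; linarith
    have hr0 : 0 ≤ (1 - 2 * (α + β)) * (2 * m) := mul_nonneg (by linarith) hM.le
    have hr2 : ((1 - 2 * (α + β)) * (2 * m)) ^ 2 ≤ D ^ 2 := pow_le_pow_left₀ hr0 hr 2
    rw [div_mul_eq_mul_div, div_le_div_iff₀ (by positivity) hdN]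
    calc 2 * m * (1 + η) * (d * N) ≤ 2 * m * (1 + η) * (2 * m) := by gcongr
      _ ≤ 2 * m * (K * (1 - 2 * (α + β)) ^ 2) * (2 * m) := by gcongr
      _ = K * ((1 - 2 * (α + β)) * (2 * m)) ^ 2 := by ring
      _ ≤ _ := by gcongr
  calc 2 * m / D ^ 2 * ((x - T) ^ 2 / 2)
      ≤ 2 * m / D ^ 2 *
        (((1 + η) * (d * (y - μ)) ^ 2 + (1 + 1 / η) * (2 * (d * b)) ^ 2) / 2) := by gcongr
    _ = (2 * m / D ^ 2 * (1 + η)) * ((d * (y - μ)) ^ 2 / 2) +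
        2 * m / D ^ 2 * ((1 + 1 / η) * (2 * (d * b)) ^ 2 / 2) := by ring
    _ ≤ K / (d * N) * ((d * (y - μ)) ^ 2 / 2) +
        2 / (d * N) * ((1 + 1 / η) * (2 * (d * b)) ^ 2 / 2) := by gcongr
    _ = _ := by field_simp; ring

/-- A Gaussian upper bound for the law of the overlap, valid over its whole range. -/
lemma overlapProb_le_gaussian {N k j : ℕ} {d α K : ℝ} (hd : 0 ≤ d) (hK0 : 0 ≤ K) (hα : 0 < α)
    (hKα : K * d * α / 2 ≤ Real.log (1 / α) - 1) (hKα2 : K * d * α ^ 2 ≤ 1)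
    (hkα : k ≤ α * N) (hk2 : 2 * k ≤ N) (hμ : 1 ≤ (k : ℝ) ^ 2 / N) (hj : j ≤ k) :
    overlapProb N k j ≤ Real.exp (4 - K * d / (2 * N) * (j - (k : ℝ) ^ 2 / N) ^ 2) := by
  have hjr : (j : ℝ) ≤ k := by exact_mod_cast hj
  have hN0 : (0 : ℝ) < N := by
    rcases Nat.eq_zero_or_pos N with rfl | h
    · simp at hμ; linarith
    · exact_mod_cast h
  have hk0 : (0 : ℝ) < k := by
    rcases Nat.eq_zero_or_pos k with rfl | h
    · simp at hμ; linarith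
    · exact_mod_cast h
  have hmode : overlapProb N k ⌈(k : ℝ) ^ 2 / N⌉₊ ≤ 1 :=
    overlapProb_le_one (by omega) (ceil_mean_le hk2)
  set μ := (k : ℝ) ^ 2 / N with hμd
  have hμ0 : 0 < μ := by linarith
  rcases le_total ⌈μ⌉₊ j with hc | hc
  · have hut := overlapProb_upper_tail hk2 hμ hj hc
    refine (hut.trans (mul_le_of_le_one_left (Real.exp_nonneg _) hmode)).trans ?_
    apply Real.exp_le_exp.2
    have hμj : μ ≤ j := Nat.ceil_le.1 hc
    -- Only `j = k` has to be tested. There the rate is at least `k (log (N/k) - 1)`, and the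
    -- comparison becomes `hKα`.
    have hq := quadratic_le_poissonRate (μ := μ) (x := j) (X := k) (κ := K * d / (2 * N)) hμ0 hμj
      hjr ?_
    · linarith
    · have hkμ : (k : ℝ) / μ = N / k := by rw [hμd]; field_simp
      have hμk : μ ≤ k := by linarith
      have hlog : Real.log (1 / α) ≤ Real.log (N / k) := by
        apply Real.log_le_log (by positivity)
        rw [div_le_div_iff₀ hα hk0]
        linarith
      have h1 : K * d * (k / N) / 2 ≤ Real.log (N / k) - 1 := by
        have : (k : ℝ) / N ≤ α := by rwa [div_le_iff₀ hN0]
        have : K * d * (k / N) / 2 ≤ K * d * α / 2 := by gcongr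
        linarith
      unfold poissonRate
      rw [hkμ]
      have h2 : ((k : ℝ) - μ) ^ 2 ≤ k ^ 2 := by
        apply pow_le_pow_left₀ <;> linarith
      calc K * d / (2 * N) * ((k : ℝ) - μ) ^ 2 ≤ K * d / (2 * N) * k ^ 2 := by gcongr
        _ = k * (K * d * (k / N) / 2) := by field_simp
        _ ≤ k * (Real.log (N / k) - 1) := by gcongr
        _ ≤ _ := by linarith
  · have hlt := overlapProb_lower_tail hk2 hμ hc
    refine (hlt.trans (mul_le_of_le_one_left (Real.exp_nonneg _) hmode)).trans ?_
    apply Real.exp_le_exp.2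
    -- Below the mean the overlap has a Gaussian tail of variance `μ ≤ α² N`, and `hKα2` says this
    -- is narrow enough.
    have hκμ : K * d / (2 * N) ≤ 1 / (2 * μ) := by
      rw [div_le_div_iff₀ (by positivity) (by positivity)]
      have h1 : μ ≤ α ^ 2 * N := by
        rw [hμd, div_le_iff₀ hN0]
        calc (k : ℝ) ^ 2 ≤ (α * N) ^ 2 := by gcongr
          _ = _ := by ring
      have h2 : K * d * μ ≤ K * d * (α ^ 2 * N) := by gcongr
      have h3 : K * d * α ^ 2 * N ≤ 1 * N := by gcongr
      linarith
    have : K * d / (2 * N) * (j - μ) ^ 2 ≤ 1 / (2 * μ) * (j - μ) ^ 2 := by gcongr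
    have e : (μ - (j : ℝ)) ^ 2 / (2 * μ) = 1 / (2 * μ) * (j - μ) ^ 2 := by ring
    linarith

/-- The contribution of each overlap to the second moment is subexponential. -/
theorem overlapProb_mul_pairRatio_le {N d b a m k j : ℕ} {α β η K : ℝ} (hd : 2 ≤ d)
    (hη : 0 < η) (hα : 0 < α) (hα' : α ≤ 1 / 64) (hβ0 : 0 ≤ β) (hβ' : β ≤ 1 / 64) (hK0 : 0 ≤ K)
    (hK : 1 + η ≤ K * (1 - 2 * (α + β)) ^ 2)
    (hKα : K * d * α / 2 ≤ Real.log (1 / α) - 1) (hKα2 : K * d * α ^ 2 ≤ 1)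
    (hb : b ≤ β * N) (hab : a ≤ d * b) (hm1 : d * N ≤ 2 * m) (hm2 : 2 * m ≤ d * N + d * b)
    (hkα : k ≤ α * N) (hkN : N ≤ k ^ 2) (hN : 1 ≤ N) (hj : j ≤ k) :
    overlapProb N k j * pairRatio m (a + d * k) (a + d * j) ≤
      ((a + d * k : ℕ) + 1) * Real.exp (10 + (1 + 1 / η) * 4 * d * b ^ 2 / N) := by
  have hN0 : (0 : ℝ) < N := by exact_mod_cast hN
  have hdr : (2 : ℝ) ≤ d := by exact_mod_cast hd
  have habr : (a : ℝ) ≤ d * b := by exact_mod_cast hab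
  have hm1r : (d : ℝ) * N ≤ 2 * m := by exact_mod_cast hm1
  have hm2r : 2 * (m : ℝ) ≤ d * N + d * b := by exact_mod_cast hm2
  have hkNr : (N : ℝ) ≤ k ^ 2 := by exact_mod_cast hkN
  have hjr : (j : ℝ) ≤ k := by exact_mod_cast hj
  have hk0 : (0 : ℝ) ≤ k := Nat.cast_nonneg k
  have ha0 : (0 : ℝ) ≤ a := Nat.cast_nonneg a
  have hb0 : (0 : ℝ) ≤ b := Nat.cast_nonneg b
  have hbN : 64 * (b : ℝ) ≤ N := by
    have : β * (N : ℝ) ≤ 1 / 64 * N := by gcongr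
    linarith
  have hkN64 : 64 * (k : ℝ) ≤ N := by
    have : α * (N : ℝ) ≤ 1 / 64 * N := by gcongr
    linarith
  have hk2 : 2 * k ≤ N := by
    have : 64 * k ≤ N := by exact_mod_cast hkN64
    omega
  have hdN : 0 < (d : ℝ) * N := by positivity
  have hM : 0 < 2 * (m : ℝ) := by linarith
  set h := a + d * k with hh
  have hhr : (h : ℝ) = a + d * k := by rw [hh]; push_cast; ring
  have hdb64 : 64 * ((d : ℝ) * b) ≤ d * N := by
    have : (d : ℝ) * (64 * b) ≤ d * N := by gcongr
    linarith
  have hdk64 : 64 * ((d : ℝ) * k) ≤ d * N := by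
    have : (d : ℝ) * (64 * k) ≤ d * N := by gcongr
    linarith
  have h32 : 32 * (h : ℝ) ≤ 2 * m := by rw [hhr]; linarith
  have hmh : 8 * h ≤ m := by
    have : 32 * h ≤ 2 * m := by exact_mod_cast h32
    omega
  have hμ : 1 ≤ (k : ℝ) ^ 2 / N := by rwa [one_le_div hN0]
  have hT : 1 ≤ (h : ℝ) ^ 2 / (2 * m) := by
    rw [one_le_div hM, hhr]
    have h3 : ((d : ℝ) * k) ^ 2 ≤ (a + d * k) ^ 2 := by
      apply pow_le_pow_left₀ (by positivity); linarith
    have h4 : (2 : ℝ) * (d * N) ≤ d * (d * N) := by gcongr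
    have h5 : (d : ℝ) * (d * N) ≤ d * (d * k ^ 2) := by gcongr
    linarith
  have hbd := mean_overlap_bounds (N := N) (d := d) (b := b) (a := a) (m := m) (k := k)
    (by linarith) hN0 hb0 ha0 hk0 habr hm1r hm2r (by linarith)
  have hpr := pairRatio_le (m := m) (h := h) (t := a + d * j) hmh (by rw [hh]; gcongr) hT
  have hent := overlapProb_le_gaussian (d := d) (by linarith) hK0 hα hKα hKα2 hkα hk2 hμ hj
  rw [← hhr] at hbd
  have hh' : (h : ℝ) ≤ (α + β) * (2 * m) := by
    rw [hhr]
    have h1 : (d : ℝ) * k ≤ α * (2 * m) := by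
      calc (d : ℝ) * k ≤ d * (α * N) := by gcongr
        _ = α * (d * N) := by ring
        _ ≤ _ := by gcongr
    have h2 : (a : ℝ) ≤ β * (2 * m) := by
      calc (a : ℝ) ≤ d * b := habr
        _ ≤ d * (β * N) := by gcongr
        _ = β * (d * N) := by ring
        _ ≤ _ := by gcongr
    linarith
  have hMD : (d : ℝ) * N * m ≤ (2 * m - 2 * h) ^ 2 := by
    have h1 : (3 / 2 * m : ℝ) ^ 2 ≤ (2 * m - 2 * h) ^ 2 := by
      apply pow_le_pow_left₀ <;> linarith
    have h2 : (d : ℝ) * N * m ≤ 2 * m * m := by gcongr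
    have h3 := sq_nonneg (m : ℝ)
    linarith
  have hdev : ((a + d * j : ℕ) : ℝ) - (h : ℝ) ^ 2 / (2 * m) - d * (j - (k : ℝ) ^ 2 / N) =
      a - ((h : ℝ) ^ 2 / (2 * m) - d * ((k : ℝ) ^ 2 / N)) := by push_cast; ring
  have hquad := pairRatio_exponent_le (N := N) (d := d) (b := b) (m := m) (h := h)
    (x := (a + d * j : ℕ)) (T := (h : ℝ) ^ 2 / (2 * m)) (μ := (k : ℝ) ^ 2 / N) (y := j)
    (by linarith) hN0 hη hK0 (by linarith) hK hm1r hh' hMD (by linarith) (by ring)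
    (by rw [hdev]; exact hbd.1) (by rw [hdev]; exact hbd.2)
  have hpos := (pairRatio_pos (m := m) (h := h) (t := a + d * j) (by omega)).le
  refine (mul_le_mul hent hpr hpos (Real.exp_nonneg _)).trans ?_
  rw [mul_left_comm, ← Real.exp_add]
  refine mul_le_mul_of_nonneg_left (Real.exp_le_exp.2 ?_) (by positivity)
  linarith

end SecondMomentSum

/-! ### Avoidance probabilities and the first moment. -/

section AvoidProb

lemma avoidProb_zero (m : ℕ) : avoidProb m 0 = 1 := by simp [avoidProb]

lemma avoidProb_of_lt {m h : ℕ} (hm : m < h) : avoidProb m h = 0 := by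
  simp [avoidProb, Nat.choose_eq_zero_of_lt hm]

/-- Given that `h` points avoid each other, their partners form a uniform `h`-subset of the other
`2m - h` points, so a further point is a partner with probability `h/(2m - h)`. -/
lemma avoidProb_succ {m h : ℕ} (hm : h ≤ m) (hm0 : 0 < m) :
    avoidProb m (h + 1) = avoidProb m h * (1 - h / (2 * m - h)) := by
  have h1 := Nat.choose_succ_right_eq m h
  have h2 := Nat.choose_succ_right_eq (2 * m) h
  have h1' : (m.choose (h + 1) : ℝ) * (h + 1) = m.choose h * (m - h) := by
    rw [← Nat.cast_sub hm]; exact_mod_cast h1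
  have h2' : ((2 * m).choose (h + 1) : ℝ) * (h + 1) = (2 * m).choose h * (2 * m - h) := by
    have : ((2 * m - h : ℕ) : ℝ) = 2 * m - h := by
      rw [Nat.cast_sub (by omega)]; push_cast; ring
    rw [← this]; exact_mod_cast h2
  have p1 : (0 : ℝ) < (2 * m).choose h := by exact_mod_cast Nat.choose_pos (by omega)
  have p2 : (0 : ℝ) < (2 * m).choose (h + 1) := by exact_mod_cast Nat.choose_pos (by omega)
  have hm' : (h : ℝ) ≤ m := by exact_mod_cast hm
  have hm0' : (0 : ℝ) < m := by exact_mod_cast hm0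
  have p3 : 0 < 2 * (m : ℝ) - h := by linarith
  have hne : (0 : ℝ) < h + 1 := by positivity
  have e1 : (m.choose (h + 1) : ℝ) = m.choose h * (m - h) / (h + 1) := by
    rw [eq_div_iff hne.ne', h1']
  have e2 : ((2 * m).choose (h + 1) : ℝ) = (2 * m).choose h * (2 * m - h) / (h + 1) := by
    rw [eq_div_iff hne.ne', h2']
  unfold avoidProb
  rw [e1, e2, pow_succ, one_sub_div p3.ne']
  field_simp
  ring

lemma avoidProb_ge {m h : ℕ} (hm : 2 * h ≤ m) (hm0 : 0 < m) :
    Real.exp (-((h : ℝ) ^ 2 / m)) ≤ avoidProb m h := by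
  have hm0' : (0 : ℝ) < m := by exact_mod_cast hm0
  induction h with
  | zero => simp [avoidProb_zero]
  | succ h ih =>
    have ih := ih (by omega)
    rw [avoidProb_succ (by omega) hm0]
    have hm' : 2 * ((h : ℝ) + 1) ≤ m := by exact_mod_cast hm
    have hh0 : (0 : ℝ) ≤ h := Nat.cast_nonneg h
    have hx : (h : ℝ) / (2 * m - h) ≤ h / m := by
      apply div_le_div_of_nonneg_left hh0 hm0'
      linarith
    have hx2 : (h : ℝ) / m ≤ 1 / 2 := by
      rw [div_le_div_iff₀ hm0' (by norm_num)]; linarith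
    set x := (h : ℝ) / m with hxd
    have hx0 : 0 ≤ x := by positivity
    have h1 : Real.exp (-(2 * x)) ≤ 1 - x := by
      rw [Real.exp_neg]
      have a := Real.add_one_le_exp (2 * x)
      have b : (Real.exp (2 * x))⁻¹ ≤ (2 * x + 1)⁻¹ := by
        gcongr
      refine b.trans ?_
      rw [inv_le_iff_one_le_mul₀ (by positivity)]
      nlinarith
    calc Real.exp (-(((h + 1 : ℕ) : ℝ) ^ 2 / m))
        ≤ Real.exp (-((h : ℝ) ^ 2 / m) + -(2 * x)) := by
          apply Real.exp_le_exp.2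
          push_cast
          have : ((h : ℝ) + 1) ^ 2 / m = h ^ 2 / m + 2 * x + 1 / m := by
            rw [hxd]; field_simp; ring
          have : 0 < 1 / (m : ℝ) := by positivity
          linarith
      _ = Real.exp (-((h : ℝ) ^ 2 / m)) * Real.exp (-(2 * x)) := Real.exp_add _ _
      _ ≤ avoidProb m h * (1 - (h : ℝ) / (2 * m - h)) := by
          apply mul_le_mul ih (h1.trans (by linarith)) (Real.exp_nonneg _)
            (avoidProb_nonneg m h)

/-- At density `x = h/(2m)` the factor in `avoidProb_succ` is `(1 - 2x)/(1 - x)`, which decreases in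
`x`. Beyond `h = m` both `avoidProb` and the claim are trivial. -/
lemma avoidProb_add_le {m h : ℕ} {α : ℝ} (hα : α < 1 / 2) (hm0 : 0 < m)
    (hh : α * (2 * m) ≤ h) (d : ℕ) :
    avoidProb m (h + d) ≤ avoidProb m h * ((1 - 2 * α) / (1 - α)) ^ d := by
  have hθ : 0 ≤ (1 - 2 * α) / (1 - α) := div_nonneg (by linarith) (by linarith)
  induction d with
  | zero => simp
  | succ d ih =>
    rw [← add_assoc, pow_succ, ← mul_assoc]
    rcases le_or_gt (h + d) m with hle | hlt
    · rw [avoidProb_succ hle hm0]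
      apply mul_le_mul ih _ _ (mul_nonneg (avoidProb_nonneg _ _) (pow_nonneg hθ _))
      · have hm0' : (0 : ℝ) < m := by exact_mod_cast hm0
        have hle' : ((h + d : ℕ) : ℝ) ≤ m := by exact_mod_cast hle
        have hge : α * (2 * m) ≤ ((h + d : ℕ) : ℝ) := by push_cast; linarith [Nat.cast_nonneg (α := ℝ) d]
        have hp : 0 < 2 * (m : ℝ) - (h + d : ℕ) := by linarith
        rw [le_div_iff₀ (by linarith), sub_mul, div_mul_eq_mul_div, one_mul]
        have : α ≤ ((h + d : ℕ) : ℝ) * (1 - α) / (2 * m - (h + d : ℕ)) := by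
          rw [le_div_iff₀ hp]; linarith
        linarith
      · have hm0' : (0 : ℝ) < m := by exact_mod_cast hm0
        have hle' : ((h + d : ℕ) : ℝ) ≤ m := by exact_mod_cast hle
        rw [sub_nonneg, div_le_one (by linarith)]
        linarith
    · rw [avoidProb_of_lt (by omega)]
      exact mul_nonneg (mul_nonneg (avoidProb_nonneg _ _) (pow_nonneg hθ _)) hθ

/-- Geometric decay of the first-moment weights above a density `α`. -/
theorem firstMoment_succ_le {N d b a m k : ℕ} {α lam : ℝ} (hα0 : 0 < α) (hα : α < 1 / 2)
    (hlam : 0 ≤ lam) (hm0 : 0 < m) (hm2 : 2 * m ≤ d * N + d * b)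
    (hk : α * ((N : ℝ) + b) ≤ k) (hkN : k ≤ N) :
    (N.choose (k + 1) : ℝ) * avoidProb m (a + d * (k + 1)) * lam ^ (k + 1) ≤
      lam * ((1 - α) / α) * ((1 - 2 * α) / (1 - α)) ^ d *
        (N.choose k * avoidProb m (a + d * k) * lam ^ k) := by
  have hθ : 0 ≤ (1 - 2 * α) / (1 - α) := div_nonneg (by linarith) (by linarith)
  have hm2' : 2 * (m : ℝ) ≤ d * N + d * b := by exact_mod_cast hm2
  have h1 : avoidProb m (a + d * (k + 1)) ≤
      avoidProb m (a + d * k) * ((1 - 2 * α) / (1 - α)) ^ d := by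
    rw [show a + d * (k + 1) = a + d * k + d by ring]
    apply avoidProb_add_le hα hm0
    push_cast
    have : (0 : ℝ) ≤ a := Nat.cast_nonneg a
    calc α * (2 * m) ≤ α * (d * N + d * b) := by gcongr
      _ = d * (α * (N + b)) := by ring
      _ ≤ d * k := by gcongr
      _ ≤ _ := by linarith
  have h2 : (N.choose (k + 1) : ℝ) ≤ N.choose k * ((1 - α) / α) := by
    have e := Nat.choose_succ_right_eq N k
    have e' : (N.choose (k + 1) : ℝ) * (k + 1) = N.choose k * (N - k) := by
      rw [← Nat.cast_sub hkN]; exact_mod_cast e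
    have hkp : (0 : ℝ) < k + 1 := by positivity
    rw [← mul_le_mul_iff_left₀ hkp, e', mul_assoc]
    apply mul_le_mul_of_nonneg_left _ (Nat.cast_nonneg _)
    rw [div_mul_eq_mul_div, le_div_iff₀ hα0]
    have : 0 ≤ α * (b : ℝ) := by positivity
    nlinarith
  calc _ ≤ (N.choose k * ((1 - α) / α)) *
        (avoidProb m (a + d * k) * ((1 - 2 * α) / (1 - α)) ^ d) * lam ^ (k + 1) := by
        apply mul_le_mul_of_nonneg_right _ (pow_nonneg hlam _)
        apply mul_le_mul h2 h1 (avoidProb_nonneg _ _)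
        exact mul_nonneg (Nat.cast_nonneg _) (div_nonneg (by linarith) hα0.le)
    _ = _ := by rw [pow_succ]; ring

end AvoidProb

/-! ### Splitting independent sets by trace and outside size. -/

section Decomposition

open Classical in
/-- Sum over a family of vertex sets, split by the trace on `U` and the size outside `U`. -/
lemma sum_filter_pow_card {n : ℕ} (lam : ℝ) (U : Finset (Fin n)) (Q P : Finset (Fin n) → Prop) :
    ∑ I ∈ Finset.univ.filter (fun I => Q I ∧ P (I ∩ U)), lam ^ I.card =
      ∑ i ∈ (U.powerset.filter P) ×ˢ Finset.range (Uᶜ.card + 1), lam ^ (i.1.card + i.2) *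
        (((Uᶜ).powersetCard i.2).filter fun ω => Q (i.1 ∪ ω)).card := by
  have h : ∀ i ∈ (U.powerset.filter P) ×ˢ Finset.range (Uᶜ.card + 1), lam ^ (i.1.card + i.2) *
        ((((Uᶜ).powersetCard i.2).filter fun ω => Q (i.1 ∪ ω)).card : ℝ) =
      ∑ ω ∈ ((Uᶜ).powersetCard i.2).filter fun ω => Q (i.1 ∪ ω), lam ^ (i.1.card + i.2) := by
    intro i _
    rw [Finset.sum_const, nsmul_eq_mul, mul_comm]
  rw [Finset.sum_congr rfl h, Finset.sum_sigma']
  refine Finset.sum_bij' (fun I _ => ⟨(I ∩ U, (I \ U).card), I \ U⟩) (fun x _ => x.1.1 ∪ x.2)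
    ?_ ?_ ?_ ?_ ?_
  · intro I hI
    simp only [Finset.mem_filter, Finset.mem_univ, true_and] at hI
    have hsub : I \ U ⊆ Uᶜ := fun x hx => Finset.mem_compl.2 (Finset.mem_sdiff.1 hx).2
    have hu : I ∩ U ∪ I \ U = I := by
      rw [Finset.union_comm]; exact Finset.sdiff_union_inter I U
    simp only [Finset.mem_sigma, Finset.mem_product, Finset.mem_filter, Finset.mem_powerset,
      Finset.mem_range, Finset.mem_powersetCard, hu]
    exact ⟨⟨⟨Finset.inter_subset_right, hI.2⟩, Nat.lt_succ_of_le (Finset.card_le_card hsub)⟩,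
      ⟨hsub, trivial⟩, hI.1⟩
  · rintro ⟨⟨τ, k⟩, ω⟩ hx
    simp only [Finset.mem_sigma, Finset.mem_product, Finset.mem_filter, Finset.mem_powerset,
      Finset.mem_range, Finset.mem_powersetCard] at hx
    obtain ⟨⟨⟨hτ, hP⟩, -⟩, ⟨hω, -⟩, hQ⟩ := hx
    have : (τ ∪ ω) ∩ U = τ := by
      ext x
      have h1 := @hτ x
      have h2 := @hω x
      simp only [Finset.mem_inter, Finset.mem_union, Finset.mem_compl] at *
      tauto
    simp only [Finset.mem_filter, Finset.mem_univ, true_and, this]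
    exact ⟨hQ, hP⟩
  · intro I _
    exact (Finset.union_comm _ _).trans (Finset.sdiff_union_inter I U)
  · rintro ⟨⟨τ, k⟩, ω⟩ hx
    simp only [Finset.mem_sigma, Finset.mem_product, Finset.mem_filter, Finset.mem_powerset,
      Finset.mem_range, Finset.mem_powersetCard] at hx
    obtain ⟨⟨⟨hτ, hP⟩, -⟩, ⟨hω, hωk⟩, hQ⟩ := hx
    have e1 : (τ ∪ ω) ∩ U = τ := by
      ext x
      have h1 := @hτ x
      have h2 := @hω x
      simp only [Finset.mem_inter, Finset.mem_union, Finset.mem_compl] at *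
      tauto
    have e2 : (τ ∪ ω) \ U = ω := by
      ext x
      have h1 := @hτ x
      have h2 := @hω x
      simp only [Finset.mem_sdiff, Finset.mem_union, Finset.mem_compl] at *
      tauto
    simp only [e1, e2, hωk]
  · intro I _
    have := Finset.card_sdiff_add_card_inter I U
    simp only
    congr 1
    omega

end Decomposition

/-! ### The puncture: exposed vertices, free half-edges and conditional independence probabilities.
-/

namespace Pairing

variable {n d : ℕ}

lemma apply_apply (p : Pairing n d) (h : HalfEdge n d) : p.1 (p.1 h) = h := (p.2 h).1

lemma apply_ne (p : Pairing n d) (h : HalfEdge n d) : p.1 h ≠ h := (p.2 h).2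

lemma mem_ball {p : Pairing n d} {r : ℕ} {u v : Fin n} :
    v ∈ p.ball r u ↔ p.graph.edist u v ≤ r := by
  simp [ball]

lemma graph_adj {p : Pairing n d} {u v : Fin n} :
    p.graph.Adj u v ↔ u ≠ v ∧ ∃ i j, p.1 (u, i) = (v, j) := by
  rw [graph, SimpleGraph.fromRel_adj]
  refine and_congr_right fun _ => ⟨?_, Or.inl⟩
  rintro (h | ⟨i, j, h⟩)
  · exact h
  · exact ⟨j, i, by rw [← h, apply_apply]⟩

lemma mem_ball_succ_of_apply {p : Pairing n d} {r : ℕ} {u : Fin n} {h : HalfEdge n d}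
    (hh : h.1 ∈ p.ball r u) : (p.1 h).1 ∈ p.ball (r + 1) u := by
  rw [mem_ball] at hh ⊢
  by_cases he : h.1 = (p.1 h).1
  · rw [← he]
    refine hh.trans ?_
    push_cast
    exact le_self_add
  · have hadj : p.graph.Adj h.1 (p.1 h).1 := graph_adj.2 ⟨he, h.2, (p.1 h).2, rfl⟩
    have h1 : p.graph.edist h.1 (p.1 h).1 ≤ 1 := by
      have := hadj.toWalk.edist_le
      simpa using this
    refine (SimpleGraph.edist_triangle (v := h.1)).trans ?_
    push_cast
    exact add_le_add hh h1

open Classical in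
lemma ball_succ_subset (p : Pairing n d) (r : ℕ) (u : Fin n) :
    p.ball (r + 1) u ⊆ (p.ball r u).biUnion fun v =>
      insert v (Finset.univ.image fun i : Fin d => (p.1 (v, i)).1) := by
  intro w hw
  rw [mem_ball] at hw
  rw [Finset.mem_biUnion]
  have hne : p.graph.edist u w ≠ ⊤ := fun h => by
    rw [h, top_le_iff] at hw
    exact ENat.natCast_ne_top _ hw
  obtain ⟨W, hW⟩ := SimpleGraph.exists_walk_of_edist_ne_top hne
  rw [← hW] at hw
  have hlen : W.reverse.length ≤ r + 1 := by
    rw [SimpleGraph.Walk.length_reverse]; exact_mod_cast hw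
  cases hc : W.reverse with
  | nil => exact ⟨u, by rw [mem_ball]; simp, Finset.mem_insert_self _ _⟩
  | cons hadj W' =>
    rename_i v
    rw [hc, SimpleGraph.Walk.length_cons] at hlen
    refine ⟨v, ?_, ?_⟩
    · rw [mem_ball]
      have := W'.reverse.edist_le
      rw [SimpleGraph.Walk.length_reverse] at this
      exact this.trans (by exact_mod_cast Nat.le_of_succ_le_succ hlen)
    · obtain ⟨-, i, j, hij⟩ := graph_adj.1 hadj.symm
      exact Finset.mem_insert_of_mem (Finset.mem_image.2 ⟨i, Finset.mem_univ _, by rw [hij]⟩)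

lemma card_ball_le (p : Pairing n d) (r : ℕ) (u : Fin n) : (p.ball r u).card ≤ (d + 1) ^ r := by
  classical
  induction r with
  | zero =>
    have : p.ball 0 u ⊆ {u} := by
      intro v hv
      rw [mem_ball] at hv
      have : p.graph.edist u v = 0 := by simpa using hv
      rw [SimpleGraph.edist_eq_zero_iff] at this
      simp [this]
    simpa using Finset.card_le_card this
  | succ r ih =>
    refine (Finset.card_le_card (p.ball_succ_subset r u)).trans ?_
    refine (Finset.card_biUnion_le_card_mul _ _ (d + 1) fun v _ => ?_).trans ?_
    · refine (Finset.card_insert_le _ _).trans ?_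
      have : (Finset.univ.image fun i : Fin d => (p.1 (v, i)).1).card ≤ d :=
        Finset.card_image_le.trans (by simp)
      omega
    · rw [pow_succ]
      gcongr

/-- The vertices exposed by the puncture: the deleted ones and the boundary. -/
noncomputable def exposed (p : Pairing n d) (S : Finset (Fin n)) (r : ℕ) : Finset (Fin n) :=
  p.deleted S r ∪ p.boundary S r

open Classical in
/-- The half-edges that the puncture leaves free. -/
noncomputable def free (p : Pairing n d) (S : Finset (Fin n)) (r : ℕ) : Finset (HalfEdge n d) :=
  Finset.univ.filter fun h => h.1 ∉ p.deleted S r ∧ (p.1 h).1 ∉ p.deleted S r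

variable {p : Pairing n d} {S : Finset (Fin n)} {r : ℕ}

lemma mem_free {h : HalfEdge n d} :
    h ∈ p.free S r ↔ h.1 ∉ p.deleted S r ∧ (p.1 h).1 ∉ p.deleted S r := by
  simp [free]

lemma apply_mem_free {h : HalfEdge n d} (hh : h ∈ p.free S r) : p.1 h ∈ p.free S r := by
  rw [mem_free, apply_apply] at *
  exact hh.symm

lemma exposed_subset : p.exposed S r ⊆ S.biUnion (p.ball r) := by
  intro v hv
  have hsub : ∀ s, p.ball (r - 1) s ⊆ p.ball r s := fun s w hw => by
    rw [mem_ball] at *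
    refine hw.trans ?_
    exact_mod_cast Nat.sub_le r 1
  simp only [exposed, boundary, deleted, sphere, Finset.mem_union, Finset.mem_sdiff,
    Finset.mem_biUnion] at *
  rcases hv with ⟨s, hs, hv⟩ | ⟨⟨s, hs, hv, -⟩, -⟩
  · exact ⟨s, hs, hsub s hv⟩
  · exact ⟨s, hs, hv⟩

lemma card_exposed_le : (p.exposed S r).card ≤ S.card * (d + 1) ^ r :=
  (Finset.card_le_card exposed_subset).trans
    (Finset.card_biUnion_le_card_mul _ _ _ fun s _ => p.card_ball_le r s)

/-- A neighbour of a vertex within distance `r - 1` of `s` is within distance `r`; `1 ≤ r` makes the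
truncated subtraction exact. Consequently all `d` half-edges of a vertex outside `exposed` are free.
-/
lemma apply_mem_exposed (hr : 1 ≤ r) {h : HalfEdge n d} (hh : h.1 ∈ p.deleted S r) :
    (p.1 h).1 ∈ p.exposed S r := by
  rw [exposed, Finset.mem_union]
  by_cases hd : (p.1 h).1 ∈ p.deleted S r
  · exact Or.inl hd
  refine Or.inr ?_
  obtain ⟨s, hs, hhs⟩ := Finset.mem_biUnion.1 hh
  rw [boundary, Finset.mem_sdiff, Finset.mem_biUnion]
  refine ⟨⟨s, hs, ?_⟩, hd⟩
  rw [sphere, Finset.mem_sdiff]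
  refine ⟨?_, fun h' => hd (Finset.mem_biUnion.2 ⟨s, hs, h'⟩)⟩
  have := mem_ball_succ_of_apply hhs
  rwa [Nat.sub_add_cancel hr] at this

lemma mem_free_of_notMem_exposed (hr : 1 ≤ r) {h : HalfEdge n d} (hh : h.1 ∉ p.exposed S r) :
    h ∈ p.free S r := by
  rw [mem_free]
  refine ⟨fun h' => hh (Finset.mem_union_left _ h'), fun h' => hh ?_⟩
  have := apply_mem_exposed hr h'
  rwa [apply_apply] at this

lemma mem_conditioned {q : Pairing n d} :
    q ∈ p.conditioned S r ↔ ∀ h : HalfEdge n d, h.1 ∈ p.deleted S r → q.1 h = p.1 h := by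
  simp [conditioned]

lemma apply_eq_of_notMem_free {q : Pairing n d} (hq : q ∈ p.conditioned S r) {h : HalfEdge n d}
    (hh : h ∉ p.free S r) : q.1 h = p.1 h := by
  rw [mem_conditioned] at hq
  rw [mem_free, not_and_or, not_not, not_not] at hh
  rcases hh with hh | hh
  · exact hq h hh
  · have := hq _ hh
    rw [apply_apply] at this
    rw [← this, apply_apply, this]

lemma apply_mem_free_of_conditioned {q : Pairing n d} (hq : q ∈ p.conditioned S r)
    {h : HalfEdge n d} (hh : h ∈ p.free S r) : q.1 h ∈ p.free S r := by
  by_contra hc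
  have h1 := apply_eq_of_notMem_free hq hc
  rw [apply_apply] at h1
  apply hc
  have h2 := apply_mem_free hh
  rwa [h1, apply_apply] at h2

/-- The underlying permutations of the conditioned pairings. -/
noncomputable def conditionedPerms (p : Pairing n d) (S : Finset (Fin n)) (r : ℕ) :
    Finset (Equiv.Perm (HalfEdge n d)) :=
  (p.conditioned S r).map (Function.Embedding.subtype _)

/-- Relabelling free half-edges does not touch the exposed part of the matching; this is the
uniformity of the remaining matching that the counting lemmas use. -/
lemma isMatchingFamily_conditionedPerms :
    IsMatchingFamily (p.free S r) (p.conditionedPerms S r) := by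
  have hmem : ∀ q ∈ p.conditionedPerms S r, ∃ q' ∈ p.conditioned S r, q'.1 = q := by
    intro q hq
    obtain ⟨q', hq', rfl⟩ := Finset.mem_map.1 hq
    exact ⟨q', hq', rfl⟩
  refine ⟨?_, ?_, ?_, ?_⟩
  · intro q hq x
    obtain ⟨q', -, rfl⟩ := hmem q hq
    exact q'.apply_apply x
  · intro q hq x
    obtain ⟨q', -, rfl⟩ := hmem q hq
    exact q'.apply_ne x
  · intro q hq x hx
    obtain ⟨q', hq', rfl⟩ := hmem q hq
    exact apply_mem_free_of_conditioned hq' hx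
  · intro q hq e he
    obtain ⟨q', hq', rfl⟩ := hmem q hq
    refine Finset.mem_map.2 ⟨⟨e * q'.1 * e⁻¹, fun h => ⟨?_, ?_⟩⟩, ?_, rfl⟩
    · simp [apply_apply]
    · intro hc
      simp only [Equiv.Perm.coe_mul, Function.comp_apply] at hc
      rw [← Equiv.Perm.eq_inv_iff_eq] at hc
      exact q'.apply_ne _ hc
    · rw [mem_conditioned] at hq' ⊢
      intro h hh
      have h1 : h ∉ p.free S r := fun h' => (mem_free.1 h').1 hh
      have h2 : p.1 h ∉ p.free S r := fun h' => h1 (by simpa [apply_apply] using apply_mem_free h')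
      have h3 : e⁻¹ h = h := by rw [Equiv.Perm.inv_eq_iff_eq, he h h1]
      simp only [Equiv.Perm.coe_mul, Function.comp_apply, h3, hq' h hh, he _ h2]

/-- Parity from the counting recursion: `|F| (|F| - 2)` is twice the number of avoiding 2-sets. The
value `|F| = 1`, where the subtraction truncates to 0, is excluded because `p` has no fixed point.
-/
lemma exists_card_free : ∃ m, (p.free S r).card = 2 * m := by
  have h := card_avoidingSets_succ (q := p.1) p.apply_apply p.apply_ne
    (F := p.free S r) (fun x hx => apply_mem_free hx) 1
  have h0 := card_avoidingSets_succ (q := p.1) p.apply_apply p.apply_ne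
    (F := p.free S r) (fun x hx => apply_mem_free hx) 0
  have h1 : (avoidingSets p.1 (p.free S r) 0).card = 1 := by
    have : avoidingSets p.1 (p.free S r) 0 = {∅} := by
      ext A
      rw [mem_avoidingSets, Finset.mem_singleton]
      constructor
      · rintro ⟨⟨-, h⟩, -⟩; exact Finset.card_eq_zero.1 h
      · rintro rfl; simp [AvoidsPairs]
    simp [this]
  rw [h1] at h0
  simp only [zero_add, mul_one, mul_zero, Nat.sub_zero, one_mul] at h0
  rw [h0] at h
  rcases Nat.even_or_odd (p.free S r).card with he | ho
  · obtain ⟨m, hm⟩ := he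
    exact ⟨m, by omega⟩
  · exfalso
    have h2 : 1 ≤ (p.free S r).card := ho.pos
    rcases h2.eq_or_lt with h3 | h3
    · obtain ⟨x, hx⟩ := Finset.card_eq_one.1 h3.symm
      have hxm : x ∈ p.free S r := by rw [hx]; exact Finset.mem_singleton_self x
      have := apply_mem_free hxm
      rw [hx, Finset.mem_singleton] at this
      exact p.apply_ne x this
    · have : Odd ((p.free S r).card * ((p.free S r).card - 2)) :=
        ho.mul (Nat.Odd.sub_even (by omega) ho even_two)
      rw [mul_one] at h
      rw [← h] at this
      exact (Nat.not_odd_iff_even.2 (even_two.mul_left _)) this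

lemma le_card_free (hr : 1 ≤ r) : d * ((p.exposed S r)ᶜ).card ≤ (p.free S r).card := by
  have : (p.exposed S r)ᶜ ×ˢ (Finset.univ : Finset (Fin d)) ⊆ p.free S r := by
    intro h hh
    exact mem_free_of_notMem_exposed hr (Finset.mem_compl.1 (Finset.mem_product.1 hh).1)
  have := Finset.card_le_card this
  rw [Finset.card_product, Finset.card_univ, Fintype.card_fin] at this
  rwa [mul_comm]

lemma card_free_le :
    (p.free S r).card ≤ d * ((p.exposed S r)ᶜ).card + d * (p.exposed S r).card := by
  have := Finset.card_le_univ (p.free S r)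
  rw [Fintype.card_prod, Fintype.card_fin, Fintype.card_fin] at this
  rw [← mul_add, Finset.card_compl_add_card, Fintype.card_fin]
  linarith

open Classical in
/-- The free half-edges at the vertices of `I`. -/
noncomputable def freeAt (p : Pairing n d) (S : Finset (Fin n)) (r : ℕ) (I : Finset (Fin n)) :
    Finset (HalfEdge n d) := (p.free S r).filter fun h => h.1 ∈ I

lemma mem_freeAt {I : Finset (Fin n)} {h : HalfEdge n d} :
    h ∈ p.freeAt S r I ↔ h ∈ p.free S r ∧ h.1 ∈ I := by simp [freeAt]

lemma freeAt_inter (I J : Finset (Fin n)) :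
    p.freeAt S r I ∩ p.freeAt S r J = p.freeAt S r (I ∩ J) := by
  ext h
  simp only [Finset.mem_inter, mem_freeAt]
  tauto

lemma freeAt_subset (I : Finset (Fin n)) : p.freeAt S r I ⊆ p.free S r := by
  intro h hh
  exact (mem_freeAt.1 hh).1

lemma card_freeAt_le (I : Finset (Fin n)) : (p.freeAt S r I).card ≤ d * I.card := by
  have : p.freeAt S r I ⊆ I ×ˢ (Finset.univ : Finset (Fin d)) := by
    intro h hh
    exact Finset.mem_product.2 ⟨(mem_freeAt.1 hh).2, Finset.mem_univ _⟩
  have := Finset.card_le_card this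
  rw [Finset.card_product, Finset.card_univ, Fintype.card_fin] at this
  rwa [mul_comm]

lemma card_freeAt_union (hr : 1 ≤ r) {τ ω : Finset (Fin n)} (hτ : τ ⊆ p.exposed S r)
    (hω : ω ⊆ (p.exposed S r)ᶜ) :
    (p.freeAt S r (τ ∪ ω)).card = (p.freeAt S r τ).card + d * ω.card := by
  have h1 : p.freeAt S r (τ ∪ ω) =
      p.freeAt S r τ ∪ ω ×ˢ (Finset.univ : Finset (Fin d)) := by
    ext h
    simp only [Finset.mem_union, mem_freeAt, Finset.mem_product, Finset.mem_univ, and_true]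
    have : h.1 ∈ ω → h ∈ p.free S r := fun h' =>
      mem_free_of_notMem_exposed hr (Finset.mem_compl.1 (hω h'))
    tauto
  rw [h1, Finset.card_union_of_disjoint, Finset.card_product, Finset.card_univ, Fintype.card_fin,
    mul_comm d]
  rw [Finset.disjoint_left]
  intro h hh hh'
  exact Finset.mem_compl.1 (hω (Finset.mem_product.1 hh').1) (hτ (mem_freeAt.1 hh).2)

/-- No exposed edge joins two vertices of `τ`. -/
def Compatible (p : Pairing n d) (S : Finset (Fin n)) (r : ℕ) (τ : Finset (Fin n)) : Prop :=
  ∀ h : HalfEdge n d, h ∉ p.free S r → h.1 ∈ τ → (p.1 h).1 ∉ τ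

/-- Edges inside the exposed part are deterministic and concern only `τ`, since every half-edge at
`ω` is free. What remains random is avoidance on the free half-edges at `τ ∪ ω`. -/
lemma isIndep_iff (hr : 1 ≤ r) {q : Pairing n d} (hq : q ∈ p.conditioned S r)
    {τ ω : Finset (Fin n)} (hω : ω ⊆ (p.exposed S r)ᶜ) :
    q.IsIndep (τ ∪ ω) ↔ p.Compatible S r τ ∧ AvoidsPairs q.1 (p.freeAt S r (τ ∪ ω)) := by
  have hωf : ∀ h : HalfEdge n d, h.1 ∈ ω → h ∈ p.free S r := fun h h' =>
    mem_free_of_notMem_exposed hr (Finset.mem_compl.1 (hω h'))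
  constructor
  · intro hI
    refine ⟨fun h hh hτ hτ' => ?_, fun h hh hh' => ?_⟩
    · rw [← apply_eq_of_notMem_free hq hh] at hτ'
      exact hI h (Finset.mem_union_left _ hτ) (Finset.mem_union_left _ hτ')
    · exact hI h (mem_freeAt.1 hh).2 (mem_freeAt.1 hh').2
  · rintro ⟨hc, ha⟩ h hI hI'
    by_cases hf : h ∈ p.free S r
    · exact ha h (mem_freeAt.2 ⟨hf, hI⟩)
        (mem_freeAt.2 ⟨apply_mem_free_of_conditioned hq hf, hI'⟩)
    · rw [apply_eq_of_notMem_free hq hf] at hI'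
      have hf' : p.1 h ∉ p.free S r := fun h' => hf (by simpa [apply_apply] using apply_mem_free h')
      refine hc h hf ?_ ?_
      · exact (Finset.mem_union.1 hI).resolve_right fun h' => hf (hωf _ h')
      · exact (Finset.mem_union.1 hI').resolve_right fun h' => hf' (hωf _ h')

lemma card_filter_conditioned (Q : Equiv.Perm (HalfEdge n d) → Prop) [DecidablePred Q] :
    ((p.conditioned S r).filter fun q => Q q.1).card =
      ((p.conditionedPerms S r).filter Q).card := by
  rw [conditionedPerms, Finset.filter_map, Finset.card_map]
  rfl

lemma card_conditionedPerms : (p.conditionedPerms S r).card = (p.conditioned S r).card := by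
  rw [conditionedPerms, Finset.card_map]

open Classical in
theorem card_isIndep (hr : 1 ≤ r) {m : ℕ} (hm : (p.free S r).card = 2 * m)
    {τ ω : Finset (Fin n)} (hτ : τ ⊆ p.exposed S r) (hω : ω ⊆ (p.exposed S r)ᶜ)
    (hc : p.Compatible S r τ) :
    (((p.conditioned S r).filter fun q => q.IsIndep (τ ∪ ω)).card : ℝ) =
      (p.conditioned S r).card * avoidProb m ((p.freeAt S r τ).card + d * ω.card) := by
  have h1 : (p.conditioned S r).filter (fun q => q.IsIndep (τ ∪ ω)) =
      (p.conditioned S r).filter fun q => AvoidsPairs q.1 (p.freeAt S r (τ ∪ ω)) :=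
    Finset.filter_congr fun q hq => by rw [isIndep_iff hr hq hω]; exact and_iff_right hc
  have h2 := card_filter_avoids_mul isMatchingFamily_conditionedPerms hm
    (freeAt_subset (p := p) (S := S) (r := r) (τ ∪ ω))
  have h3 := card_filter_conditioned (p := p) (S := S) (r := r)
    fun q => AvoidsPairs q (p.freeAt S r (τ ∪ ω))
  have hle := Finset.card_le_card (freeAt_subset (p := p) (S := S) (r := r) (τ ∪ ω))
  rw [hm] at hle
  rw [h1, h3, ← card_freeAt_union hr hτ hω, ← card_conditionedPerms, avoidProb, ← mul_div_assoc,
    eq_div_iff (by exact_mod_cast (Nat.choose_pos hle).ne')]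
  convert (congrArg (Nat.cast (R := ℝ)) h2) using 1
  · push_cast; congr!
  · push_cast; rfl

open Classical in
theorem card_isIndep_pair_le (hr : 1 ≤ r) {m : ℕ} (hm : (p.free S r).card = 2 * m)
    {τ ω ω' : Finset (Fin n)} (hτ : τ ⊆ p.exposed S r) (hω : ω ⊆ (p.exposed S r)ᶜ)
    (hω' : ω' ⊆ (p.exposed S r)ᶜ) {k j : ℕ} (hk : ω.card = k) (hk' : ω'.card = k)
    (hj : (ω ∩ ω').card = j) (hhm : (p.freeAt S r τ).card + d * k ≤ m) :
    (((p.conditioned S r).filter fun q => q.IsIndep (τ ∪ ω) ∧ q.IsIndep (τ ∪ ω')).card : ℝ) ≤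
      (p.conditioned S r).card * (avoidProb m ((p.freeAt S r τ).card + d * k) ^ 2 *
        pairRatio m ((p.freeAt S r τ).card + d * k) ((p.freeAt S r τ).card + d * j)) := by
  set a := (p.freeAt S r τ).card with ha
  have h1 : (p.conditioned S r).filter (fun q => q.IsIndep (τ ∪ ω) ∧ q.IsIndep (τ ∪ ω')) ⊆
      (p.conditioned S r).filter fun q => AvoidsPairs q.1 (p.freeAt S r (τ ∪ ω)) ∧
        AvoidsPairs q.1 (p.freeAt S r (τ ∪ ω')) := by
    intro q hq
    rw [Finset.mem_filter] at hq ⊢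
    obtain ⟨hq, hi, hi'⟩ := hq
    exact ⟨hq, ((isIndep_iff hr hq hω).1 hi).2, ((isIndep_iff hr hq hω').1 hi').2⟩
  have h3 := card_filter_conditioned (p := p) (S := S) (r := r)
    fun q => AvoidsPairs q (p.freeAt S r (τ ∪ ω)) ∧ AvoidsPairs q (p.freeAt S r (τ ∪ ω'))
  have hjk : j ≤ k := by
    rw [← hj, ← hk]; exact Finset.card_le_card Finset.inter_subset_left
  have hinter : (p.freeAt S r (τ ∪ ω) ∩ p.freeAt S r (τ ∪ ω')).card = a + d * j := by
    rw [freeAt_inter, ← Finset.union_inter_distrib_left, card_freeAt_union hr hτ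
      (Finset.inter_subset_left.trans hω), hj]
  have hu : a + d * k = (a + d * j) + d * (k - j) := by
    have : d * k = d * j + d * (k - j) := by rw [← mul_add]; congr 1; omega
    omega
  have h2 := card_filter_avoids_pair_mul_le isMatchingFamily_conditionedPerms hm
    (freeAt_subset (p := p) (S := S) (r := r) (τ ∪ ω))
    (freeAt_subset (p := p) (S := S) (r := r) (τ ∪ ω'))
    (h := a + d * k) (t := a + d * j) (u := d * (k - j))
    (by rw [card_freeAt_union hr hτ hω, hk]) (by rw [card_freeAt_union hr hτ hω', hk'])
    hinter hu
  have hP := avoidProb_pos hhm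
  have e : avoidProb m (a + d * k) ^ 2 * pairRatio m (a + d * k) (a + d * j) =
      avoidProb m (a + d * k) * (crossCount (m - (a + d * k)) (d * (k - j)) /
        (2 * m - (a + d * k)).choose (d * (k - j))) := by
    unfold pairRatio
    rw [show a + d * k - (a + d * j) = d * (k - j) by omega]
    field_simp
  have p1 : (0 : ℝ) < (2 * m).choose (a + d * k) := by
    exact_mod_cast Nat.choose_pos (by omega)
  have p2 : (0 : ℝ) < (2 * m - (a + d * k)).choose (d * (k - j)) := by
    exact_mod_cast Nat.choose_pos (by omega)
  have h4 : (((p.conditioned S r).filter fun q =>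
      q.IsIndep (τ ∪ ω) ∧ q.IsIndep (τ ∪ ω')).card : ℝ) ≤ (((p.conditionedPerms S r).filter
      fun q => AvoidsPairs q (p.freeAt S r (τ ∪ ω)) ∧
        AvoidsPairs q (p.freeAt S r (τ ∪ ω'))).card : ℝ) := by
    rw [← h3]; exact_mod_cast Finset.card_le_card h1
  refine h4.trans ?_
  rw [e, avoidProb, ← card_conditionedPerms]
  have h2' : (((p.conditionedPerms S r).filter
      fun q => AvoidsPairs q (p.freeAt S r (τ ∪ ω)) ∧
        AvoidsPairs q (p.freeAt S r (τ ∪ ω'))).card : ℝ) *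
        ((2 * m).choose (a + d * k) * (2 * m - (a + d * k)).choose (d * (k - j))) ≤
      (p.conditionedPerms S r).card * (m.choose (a + d * k) * 2 ^ (a + d * k) *
        crossCount (m - (a + d * k)) (d * (k - j))) := by
    have := (Nat.cast_le (α := ℝ)).2 h2
    push_cast at this
    convert this
  rw [← le_div_iff₀ (by positivity)] at h2'
  refine h2'.trans (le_of_eq ?_)
  field_simp

end Pairing

/-! ### The truncated second moment inequality. -/

section TailBound

open Classical in
/-- Truncated second moment: if a subfamily of the weights `X i` exceeds `T` times its mean and is
not negligible, then some weights exceed `T / 4` times their means. -/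
theorem card_filter_exists_subfamily_le {ι Q : Type*} (Ω : Finset Q) (I : Finset ι)
    (X : ι → Q → ℝ) (hX : ∀ i q, 0 ≤ X i q) (good : ι → Prop) {T θ E ε : ℝ} (hT : 0 < T)
    (hθ : 0 < θ) (hE : 0 ≤ E) (hε : 0 ≤ ε)
    (hgood : ∀ i ∈ I, good i → (∑ q ∈ Ω, X i q ^ 2) * Ω.card ≤ E * (∑ q ∈ Ω, X i q) ^ 2)
    (hbad : ∑ i ∈ I.filter (fun i => ¬ good i), ∑ q ∈ Ω, X i q ≤
      ε * ∑ i ∈ I, ∑ q ∈ Ω, X i q) :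
    ((Ω.filter fun q => ∃ J ⊆ I,
      T * ((∑ i ∈ J, ∑ q' ∈ Ω, X i q') / Ω.card) < ∑ i ∈ J, X i q ∧
      θ * ((∑ i ∈ I, ∑ q' ∈ Ω, X i q') / Ω.card) < ∑ i ∈ J, X i q).card : ℝ) / Ω.card ≤
      4 / (3 * θ) * (4 * E / T + ε) := by
  set A := Ω.filter fun q => ∃ J ⊆ I,
      T * ((∑ i ∈ J, ∑ q' ∈ Ω, X i q') / Ω.card) < ∑ i ∈ J, X i q ∧
      θ * ((∑ i ∈ I, ∑ q' ∈ Ω, X i q') / Ω.card) < ∑ i ∈ J, X i q with hA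
  set M : ι → ℝ := fun i => ∑ q ∈ Ω, X i q with hM
  have hM0 : ∀ i, 0 ≤ M i := fun i => Finset.sum_nonneg fun q _ => hX i q
  set Mt := ∑ i ∈ I, M i with hMt
  have hMt0 : 0 ≤ Mt := Finset.sum_nonneg fun i _ => hM0 i
  rcases A.eq_empty_or_nonempty with hAe | ⟨q₀, hq₀⟩
  · rw [hAe]
    simp only [Finset.card_empty, CharP.cast_eq_zero, zero_div]
    positivity
  have hΩ : (0 : ℝ) < Ω.card := by
    exact_mod_cast Finset.card_pos.2 ⟨q₀, (Finset.mem_filter.1 hq₀).1⟩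
  have hMtp : 0 < Mt := by
    obtain ⟨hq, J, hJ, -, h2⟩ := Finset.mem_filter.1 hq₀
    have h3 : ∑ i ∈ J, X i q₀ ≤ Mt :=
      (Finset.sum_le_sum fun i _ => Finset.single_le_sum (fun q _ => hX i q) hq).trans
        (Finset.sum_le_sum_of_subset_of_nonneg hJ fun i _ _ => hM0 i)
    have h4 : 0 ≤ θ * (Mt / Ω.card) := by positivity
    exact (h4.trans_lt h2).trans_le h3
  -- Keep only the values exceeding `T/4` times their mean. This truncation does not depend on `J`.
  set big : ι → Q → ℝ := fun i q => if T / 4 * (M i / Ω.card) < X i q then X i q else 0 with hbig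
  have hbig0 : ∀ i q, 0 ≤ big i q := fun i q => by
    simp only [hbig]; split_ifs <;> simp [hX]
  have hbigX : ∀ i q, big i q ≤ X i q := fun i q => by
    simp only [hbig]; split_ifs <;> simp [hX]
  -- On the event, the discarded values of `J` add up to at most `T/4` times the mean of `J`, less
  -- than a quarter of the sum over `J`.
  have hlow : ∀ q ∈ A, 3 / 4 * (θ * (Mt / Ω.card)) ≤ ∑ i ∈ I, big i q := by
    intro q hq
    obtain ⟨-, J, hJ, h1, h2⟩ := Finset.mem_filter.1 hq
    have h3 : ∑ i ∈ J, X i q ≤ ∑ i ∈ J, big i q + T / 4 * ((∑ i ∈ J, M i) / Ω.card) := by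
      rw [Finset.sum_div, Finset.mul_sum, ← Finset.sum_add_distrib]
      refine Finset.sum_le_sum fun i _ => ?_
      simp only [hbig]
      split_ifs with h
      · have := hM0 i
        have : 0 ≤ T / 4 * (M i / Ω.card) := by positivity
        linarith
      · linarith
    have h4 : ∑ i ∈ J, big i q ≤ ∑ i ∈ I, big i q :=
      Finset.sum_le_sum_of_subset_of_nonneg hJ fun i _ _ => hbig0 i q
    linarith
  have hup : ∀ i ∈ I, good i → ∑ q ∈ Ω, big i q ≤ 4 * E / T * M i := by
    intro i hi hg
    rcases (hM0 i).eq_or_lt with h0 | hpos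
    · have : ∑ q ∈ Ω, big i q ≤ M i := Finset.sum_le_sum fun q _ => hbigX i q
      rw [← h0] at this ⊢
      simpa using this
    · have hc : 0 < T / 4 * (M i / Ω.card) := by positivity
      -- Wherever the truncated value is nonzero, `X` times `T/4` times its mean is at most `X²`.
      -- Hence the second moment controls the truncated first moment.
      have h1 : (∑ q ∈ Ω, big i q) * (T / 4 * (M i / Ω.card)) ≤ ∑ q ∈ Ω, X i q ^ 2 := by
        rw [Finset.sum_mul]
        refine Finset.sum_le_sum fun q _ => ?_
        simp only [hbig]
        split_ifs with h
        · rw [pow_two]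
          exact mul_le_mul_of_nonneg_left h.le (hX i q)
        · rw [zero_mul]; positivity
      have h2 := hgood i hi hg
      have h3 : (∑ q ∈ Ω, big i q) * (T / 4 * M i) ≤ E * M i ^ 2 := by
        have := mul_le_mul_of_nonneg_right h1 hΩ.le
        calc (∑ q ∈ Ω, big i q) * (T / 4 * M i)
            = (∑ q ∈ Ω, big i q) * (T / 4 * (M i / Ω.card)) * Ω.card := by field_simp
          _ ≤ _ := this.trans h2
      have h4 : (∑ q ∈ Ω, big i q) ≤ E * M i ^ 2 / (T / 4 * M i) := by
        rwa [le_div_iff₀ (by positivity)]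
      refine h4.trans (le_of_eq ?_)
      field_simp
  have htot : ∑ i ∈ I, ∑ q ∈ Ω, big i q ≤ (4 * E / T + ε) * Mt := by
    rw [← Finset.sum_filter_add_sum_filter_not I good, add_mul]
    refine add_le_add ?_ ((Finset.sum_le_sum fun i _ =>
      Finset.sum_le_sum fun q _ => hbigX i q).trans hbad)
    calc _ ≤ ∑ i ∈ I.filter good, 4 * E / T * M i := Finset.sum_le_sum fun i hi =>
          hup i (Finset.mem_filter.1 hi).1 (Finset.mem_filter.1 hi).2
      _ ≤ ∑ i ∈ I, 4 * E / T * M i := Finset.sum_le_sum_of_subset_of_nonneg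
          (Finset.filter_subset _ _) fun i _ _ => mul_nonneg (by positivity) (hM0 i)
      _ = _ := by rw [← Finset.mul_sum]
  -- Markov's inequality for the sum of the truncated values over all of `I`.
  have hmark : (A.card : ℝ) * (3 / 4 * (θ * (Mt / Ω.card))) ≤ (4 * E / T + ε) * Mt := by
    calc _ = ∑ q ∈ A, 3 / 4 * (θ * (Mt / Ω.card)) := by rw [Finset.sum_const, nsmul_eq_mul]
      _ ≤ ∑ q ∈ A, ∑ i ∈ I, big i q := Finset.sum_le_sum hlow
      _ ≤ ∑ q ∈ Ω, ∑ i ∈ I, big i q := Finset.sum_le_sum_of_subset_of_nonneg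
          (Finset.filter_subset _ _) fun q _ _ => Finset.sum_nonneg fun i _ => hbig0 i q
      _ = ∑ i ∈ I, ∑ q ∈ Ω, big i q := Finset.sum_comm
      _ ≤ _ := htot
  have h5 : (A.card : ℝ) / Ω.card * (3 / 4 * θ) ≤ 4 * E / T + ε := by
    refine le_of_mul_le_mul_right ?_ hMtp
    calc _ = (A.card : ℝ) * (3 / 4 * (θ * (Mt / Ω.card))) := by field_simp
      _ ≤ _ := hmark
  calc (A.card : ℝ) / Ω.card = 4 / (3 * θ) * ((A.card : ℝ) / Ω.card * (3 / 4 * θ)) := by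
        field_simp
    _ ≤ _ := by gcongr

end TailBound

/-! ### First and second moments of the extension counts. -/

namespace Pairing

variable {n d : ℕ}

open Classical in
/-- The number of `k`-sets outside `U` that extend `τ` to an independent set. -/
noncomputable def extCount (q : Pairing n d) (U τ : Finset (Fin n)) (k : ℕ) : ℕ :=
  (((Uᶜ).powersetCard k).filter fun ω => q.IsIndep (τ ∪ ω)).card

/-- The weight of the independent sets with trace `τ` on `U` and `k` vertices outside. -/
noncomputable def extWeight (lam : ℝ) (U : Finset (Fin n)) (i : Finset (Fin n) × ℕ)
    (q : Pairing n d) : ℝ := lam ^ (i.1.card + i.2) * q.extCount U i.1 i.2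

lemma extWeight_nonneg {lam : ℝ} (hlam : 0 ≤ lam) (U : Finset (Fin n))
    (i : Finset (Fin n) × ℕ) (q : Pairing n d) : 0 ≤ extWeight lam U i q := by
  unfold extWeight; positivity

lemma Z_eq_sum (lam : ℝ) (q : Pairing n d) (U : Finset (Fin n)) :
    q.Z lam = ∑ i ∈ U.powerset ×ˢ Finset.range (Uᶜ.card + 1), extWeight lam U i q := by
  classical
  have h := sum_filter_pow_card lam U q.IsIndep (fun _ => True)
  simp only [and_true, Finset.filter_true] at h
  unfold Z extWeight extCount
  convert h

open Classical in
lemma sum_ZBdry_eq_sum (lam : ℝ) (q : Pairing n d) {U B : Finset (Fin n)} (hB : B ⊆ U)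
    (𝓑 : Finset (Finset (Fin n))) :
    ∑ σ ∈ 𝓑, q.ZBdry lam B σ =
      ∑ i ∈ (U.powerset.filter fun τ => τ ∩ B ∈ 𝓑) ×ˢ Finset.range (Uᶜ.card + 1),
        extWeight lam U i q := by
  have h := sum_filter_pow_card lam U q.IsIndep (fun τ => τ ∩ B ∈ 𝓑)
  have h2 : ∀ I : Finset (Fin n), I ∩ U ∩ B = I ∩ B := fun I => by
    rw [Finset.inter_assoc, Finset.inter_eq_right.2 hB]
  simp only [h2] at h
  have h3 := Finset.sum_fiberwise_of_maps_to
    (s := Finset.univ.filter fun I => q.IsIndep I ∧ I ∩ B ∈ 𝓑) (t := 𝓑) (g := fun I => I ∩ B)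
    (fun I hI => (Finset.mem_filter.1 hI).2.2) (fun I => lam ^ I.card)
  have h4 : ∑ σ ∈ 𝓑, q.ZBdry lam B σ = ∑ I ∈ Finset.univ.filter
      (fun I => q.IsIndep I ∧ I ∩ B ∈ 𝓑), lam ^ I.card := by
    rw [← h3]
    refine Finset.sum_congr rfl fun σ hσ => ?_
    unfold ZBdry
    refine Finset.sum_congr ?_ fun _ _ => rfl
    ext I
    simp only [Finset.mem_filter, Finset.mem_univ, true_and]
    constructor
    · rintro ⟨hI, rfl⟩; exact ⟨⟨hI, hσ⟩, rfl⟩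
    · rintro ⟨⟨hI, -⟩, h⟩; exact ⟨hI, h⟩
  rw [h4]
  unfold extWeight extCount
  convert h

variable {p : Pairing n d} {S : Finset (Fin n)} {r : ℕ}

lemma extCount_eq_zero (hr : 1 ≤ r) {q : Pairing n d} (hq : q ∈ p.conditioned S r)
    {τ : Finset (Fin n)} (hc : ¬ p.Compatible S r τ) (k : ℕ) :
    q.extCount (p.exposed S r) τ k = 0 := by
  classical
  rw [extCount, Finset.card_eq_zero, Finset.filter_eq_empty_iff]
  intro ω hω hI
  exact hc ((isIndep_iff hr hq (Finset.mem_powersetCard.1 hω).1).1 hI).1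

lemma sum_extCount (hr : 1 ≤ r) {m : ℕ} (hm : (p.free S r).card = 2 * m)
    {τ : Finset (Fin n)} (hτ : τ ⊆ p.exposed S r) (hc : p.Compatible S r τ) (k : ℕ) :
    ∑ q ∈ p.conditioned S r, (q.extCount (p.exposed S r) τ k : ℝ) =
      (p.conditioned S r).card * ((p.exposed S r)ᶜ.card.choose k *
        avoidProb m ((p.freeAt S r τ).card + d * k)) := by
  classical
  have h := Finset.sum_card_bipartiteAbove_eq_sum_card_bipartiteBelow
    (s := p.conditioned S r) (t := ((p.exposed S r)ᶜ).powersetCard k)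
    (fun q ω => q.IsIndep (τ ∪ ω))
  have h2 : ∑ q ∈ p.conditioned S r, (q.extCount (p.exposed S r) τ k : ℝ) =
      ∑ ω ∈ ((p.exposed S r)ᶜ).powersetCard k,
        (((p.conditioned S r).filter fun q => q.IsIndep (τ ∪ ω)).card : ℝ) := by
    have h' : ∑ q ∈ p.conditioned S r, q.extCount (p.exposed S r) τ k =
        ∑ ω ∈ ((p.exposed S r)ᶜ).powersetCard k,
          ((p.conditioned S r).filter fun q => q.IsIndep (τ ∪ ω)).card := by
      unfold extCount
      unfold Finset.bipartiteAbove Finset.bipartiteBelow at h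
      convert h
    exact_mod_cast h'
  rw [h2, Finset.sum_congr rfl (g := fun _ => ((p.conditioned S r).card : ℝ) *
    avoidProb m ((p.freeAt S r τ).card + d * k)), Finset.sum_const, Finset.card_powersetCard,
    nsmul_eq_mul]
  · ring
  · intro ω hω
    obtain ⟨h1, h2⟩ := Finset.mem_powersetCard.1 hω
    have := card_isIndep hr hm hτ h1 hc
    rw [h2] at this
    rw [← this]

open Classical in
lemma sum_extCount_sq (U τ : Finset (Fin n)) (k : ℕ) (Ω : Finset (Pairing n d)) :
    ∑ q ∈ Ω, (q.extCount U τ k : ℝ) ^ 2 =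
      ∑ ω ∈ (Uᶜ).powersetCard k, ∑ ω' ∈ (Uᶜ).powersetCard k,
        ((Ω.filter fun q => q.IsIndep (τ ∪ ω) ∧ q.IsIndep (τ ∪ ω')).card : ℝ) := by
  have h1 : ∀ q ∈ Ω, (q.extCount U τ k : ℝ) ^ 2 = ∑ ω ∈ (Uᶜ).powersetCard k,
      ∑ ω' ∈ (Uᶜ).powersetCard k,
        if q.IsIndep (τ ∪ ω) ∧ q.IsIndep (τ ∪ ω') then (1 : ℝ) else 0 := by
    intro q _
    rw [extCount, Finset.card_filter, pow_two]
    push_cast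
    rw [Finset.sum_mul_sum]
    refine Finset.sum_congr rfl fun ω _ => Finset.sum_congr rfl fun ω' _ => ?_
    by_cases a : q.IsIndep (τ ∪ ω) <;> by_cases b : q.IsIndep (τ ∪ ω') <;> simp [a, b]
  rw [Finset.sum_congr rfl h1, Finset.sum_comm]
  refine Finset.sum_congr rfl fun ω _ => ?_
  rw [Finset.sum_comm]
  refine Finset.sum_congr rfl fun ω' _ => ?_
  rw [Finset.card_filter]
  push_cast
  rfl

/-- Group the ordered pairs of `k`-sets by overlap `j`. Given the first set, the proportion of
second sets with overlap `j` is `overlapProb`, and there are `k + 1` values of `j`. -/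
theorem sum_extCount_sq_le (hr : 1 ≤ r) {m : ℕ} (hm : (p.free S r).card = 2 * m)
    {τ : Finset (Fin n)} (hτ : τ ⊆ p.exposed S r) {k : ℕ} (hkN : k ≤ (p.exposed S r)ᶜ.card)
    (hhm : (p.freeAt S r τ).card + d * k ≤ m) {R : ℝ}
    (hR : ∀ j ≤ k, overlapProb (p.exposed S r)ᶜ.card k j *
      pairRatio m ((p.freeAt S r τ).card + d * k) ((p.freeAt S r τ).card + d * j) ≤ R) :
    ∑ q ∈ p.conditioned S r, (q.extCount (p.exposed S r) τ k : ℝ) ^ 2 ≤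
      (p.conditioned S r).card * ((k + 1) * R) * ((p.exposed S r)ᶜ.card.choose k *
        avoidProb m ((p.freeAt S r τ).card + d * k)) ^ 2 := by
  classical
  set O := (p.exposed S r)ᶜ with hO
  set a := (p.freeAt S r τ).card with ha
  set P := avoidProb m (a + d * k) with hP
  set w := fun j => pairRatio m (a + d * k) (a + d * j) with hw
  set Ω := p.conditioned S r with hΩ
  have hNpos : (0 : ℝ) < O.card.choose k := by exact_mod_cast Nat.choose_pos hkN
  rw [sum_extCount_sq]
  have hinner : ∀ ω ∈ O.powersetCard k, ∑ ω' ∈ O.powersetCard k,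
      ((Ω.filter fun q => q.IsIndep (τ ∪ ω) ∧ q.IsIndep (τ ∪ ω')).card : ℝ) ≤
      Ω.card * ((k + 1) * R) * (O.card.choose k * P ^ 2) := by
    intro ω hω
    obtain ⟨hωO, hωk⟩ := Finset.mem_powersetCard.1 hω
    rw [← Finset.sum_fiberwise_of_maps_to (t := Finset.range (k + 1))
      (g := fun ω' => (ω ∩ ω').card)]
    · have hj : ∀ j ∈ Finset.range (k + 1), ∑ ω' ∈ O.powersetCard k with (ω ∩ ω').card = j,
          ((Ω.filter fun q => q.IsIndep (τ ∪ ω) ∧ q.IsIndep (τ ∪ ω')).card : ℝ) ≤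
          Ω.card * (O.card.choose k * P ^ 2) * R := by
        intro j hj
        have hjk : j ≤ k := Nat.lt_succ_iff.1 (Finset.mem_range.1 hj)
        have hb : ∀ ω' ∈ (O.powersetCard k).filter (fun ω' => (ω ∩ ω').card = j),
            ((Ω.filter fun q => q.IsIndep (τ ∪ ω) ∧ q.IsIndep (τ ∪ ω')).card : ℝ) ≤
            Ω.card * (P ^ 2 * w j) := by
          intro ω' hω'
          obtain ⟨h1, h2⟩ := Finset.mem_filter.1 hω'
          obtain ⟨h3, h4⟩ := Finset.mem_powersetCard.1 h1
          have := card_isIndep_pair_le hr hm hτ hωO h3 hωk h4 h2 hhm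
          convert this
        refine (Finset.sum_le_card_nsmul _ _ _ hb).trans ?_
        rw [card_powersetCard_inter hωO hjk, hωk, nsmul_eq_mul]
        have h5 := hR j hjk
        rw [overlapProb] at h5
        push_cast
        calc (k.choose j : ℝ) * ((O.card - k).choose (k - j)) * (Ω.card * (P ^ 2 * w j))
            = Ω.card * (O.card.choose k * P ^ 2) *
              ((k.choose j : ℝ) * ((O.card - k).choose (k - j)) / O.card.choose k * w j) := by
              field_simp
          _ ≤ _ := by gcongr
      refine (Finset.sum_le_card_nsmul _ _ _ hj).trans (le_of_eq ?_)
      rw [Finset.card_range, nsmul_eq_mul]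
      push_cast
      ring
    · intro ω' _
      refine Finset.mem_range.2 (Nat.lt_succ_of_le ?_)
      rw [← hωk]
      exact Finset.card_le_card Finset.inter_subset_left
  refine (Finset.sum_le_card_nsmul _ _ _ hinner).trans (le_of_eq ?_)
  rw [Finset.card_powersetCard, nsmul_eq_mul]
  ring

/-- The count is at most `N.choose k`, so its square costs only a factor `1 / avoidProb` over the
squared mean. This serves small `k`, where the overlap estimates are unavailable because `k²/N < 1`.
-/
theorem sum_extCount_sq_le_simple (hr : 1 ≤ r) {m : ℕ} (hm : (p.free S r).card = 2 * m)
    {τ : Finset (Fin n)} (hτ : τ ⊆ p.exposed S r) (hc : p.Compatible S r τ) (k : ℕ) :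
    ∑ q ∈ p.conditioned S r, (q.extCount (p.exposed S r) τ k : ℝ) ^ 2 ≤
      (p.conditioned S r).card * (((p.exposed S r)ᶜ.card.choose k : ℝ) ^ 2 *
        avoidProb m ((p.freeAt S r τ).card + d * k)) := by
  have h : ∀ q ∈ p.conditioned S r, (q.extCount (p.exposed S r) τ k : ℝ) ^ 2 ≤
      ((p.exposed S r)ᶜ.card.choose k : ℝ) * q.extCount (p.exposed S r) τ k := by
    intro q _
    rw [pow_two]
    refine mul_le_mul_of_nonneg_right ?_ (Nat.cast_nonneg _)
    have : q.extCount (p.exposed S r) τ k ≤ (p.exposed S r)ᶜ.card.choose k := by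
      classical
      rw [← Finset.card_powersetCard]
      unfold extCount
      exact Finset.card_filter_le _ _
    exact_mod_cast this
  refine (Finset.sum_le_sum h).trans (le_of_eq ?_)
  rw [← Finset.mul_sum, sum_extCount hr hm hτ hc]
  ring

end Pairing

/-! ### Choice of constants and the role of the critical density. -/

section DensityConstants

-- Write `L = log d` and `s = d α = 2L - C (log L + 1)`. The decisive inequality is `K d α / 2 ≤ log
-- (1/α) - 1`: its left side is at most `s/2 + 1`, its right side is `L - log s - 1 ≥ L - log L -
-- log 2 - 1`. The subtracted `C (log L + 1)/2` with `C > 3` pays for `log L` and the constants once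
-- `log L ≥ 3`.
open Filter in
theorem exists_density_constants {C : ℝ} (hC : 3 < C) :
    ∃ d₀ : ℕ, ∀ d : ℕ, d₀ ≤ d → ∃ η K β : ℝ, 2 ≤ d ∧ 0 < η ∧ 0 < β ∧ β ≤ 1 / 64 ∧ 0 ≤ K ∧
      0 < criticalDensity C d ∧ criticalDensity C d ≤ 1 / 64 ∧
      1 + η ≤ K * (1 - 2 * (criticalDensity C d + β)) ^ 2 ∧
      K * d * criticalDensity C d / 2 ≤ Real.log (1 / criticalDensity C d) - 1 ∧
      K * d * criticalDensity C d ^ 2 ≤ 1 := by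
  have hL : Tendsto (fun d : ℕ => Real.log (d : ℝ)) atTop atTop :=
    Real.tendsto_log_atTop.comp tendsto_natCast_atTop_atTop
  have e1 : ∀ᶠ d : ℕ in atTop, 3 ≤ Real.log (Real.log (d : ℝ)) :=
    (Real.tendsto_log_atTop.comp hL).eventually_ge_atTop 3
  have e2 : ∀ᶠ d : ℕ in atTop, C * (Real.log (Real.log (d : ℝ)) + 1) ≤ Real.log (d : ℝ) := by
    have h1 : ∀ᶠ y : ℝ in atTop, C * (Real.log y + 1) ≤ y := by
      have h := Real.isLittleO_log_id_atTop.bound (show (0 : ℝ) < 1 / (2 * C) by positivity)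
      filter_upwards [h, eventually_ge_atTop (max 1 (2 * C))] with y hy hy2
      have hy1 : 1 ≤ y := (le_max_left _ _).trans hy2
      have hy3 : 2 * C ≤ y := (le_max_right _ _).trans hy2
      rw [Real.norm_of_nonneg (Real.log_nonneg hy1), id,
        Real.norm_of_nonneg (by linarith), one_div_mul_eq_div, le_div_iff₀ (by linarith)] at hy
      linarith
    exact hL.eventually h1
  have e3 : ∀ᶠ d : ℕ in atTop, 200 * Real.log (d : ℝ) ^ 2 ≤ d := by
    have h := (Real.isLittleO_pow_log_id_atTop (n := 2)).bound (show (0 : ℝ) < 1 / 200 by norm_num)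
    have h' : ∀ᶠ y : ℝ in atTop, 200 * Real.log y ^ 2 ≤ y := by
      filter_upwards [h, eventually_ge_atTop 0] with y hy hy0
      rw [Real.norm_of_nonneg (by positivity), id, Real.norm_of_nonneg hy0] at hy
      linarith
    exact tendsto_natCast_atTop_atTop.eventually h'
  have e4 : ∀ᶠ d : ℕ in atTop, 3 ≤ Real.log (d : ℝ) := hL.eventually_ge_atTop 3
  obtain ⟨d₀, hd₀⟩ := eventually_atTop.1 (e1.and (e2.and (e3.and e4)))
  refine ⟨d₀, fun d hd => ?_⟩
  obtain ⟨h1, h2, h3, h4⟩ := hd₀ d hd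
  have hx200 : (1800 : ℝ) ≤ d := by nlinarith
  have hlogd : Real.exp (Real.log (d : ℝ)) = d := Real.exp_log (by linarith)
  set x : ℝ := (d : ℝ) with hx
  set L := Real.log x with hLdef
  set l := Real.log L with hl
  have hL0 : 0 < L := by linarith
  have hx0 : 0 < x := by linarith
  set s := 2 * L - C * (l + 1) with hs
  have hsL : L ≤ s := by linarith
  have hCl : 3 * (l + 1) ≤ C * (l + 1) := by
    apply mul_le_mul_of_nonneg_right hC.le; linarith
  have hs2 : s ≤ 2 * L := by linarith
  have hs0 : 0 < s := by linarith
  have hα : criticalDensity C d = s / x := by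
    rw [criticalDensity, ← hx, ← hLdef, ← hl, hs]
    field_simp
  rw [hα]
  have hLx : L / x ≤ 1 / (200 * L) := by
    rw [div_le_div_iff₀ hx0 (by positivity)]; nlinarith
  have hαL : s / x ≤ 2 * (L / x) := by
    rw [← mul_div_assoc]; gcongr
  have hL3 : 1 / (200 * L) ≤ 1 / 600 := by
    apply one_div_le_one_div_of_le <;> linarith
  have h2d : 2 ≤ d := by
    have : ((2 : ℕ) : ℝ) ≤ d := by push_cast; linarith
    exact_mod_cast this
  -- `K - 1 = 1/L` is small enough to change `s/2` by at most 1, yet large compared with `α + β`,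
  -- which is at most `3/(200 L)`. This leaves room for `η = 1/(4L)`.
  refine ⟨1 / (4 * L), 1 + 1 / L, 1 / x, h2d, by positivity, by positivity, ?_, by positivity,
    by positivity, by linarith, ?_, ?_, ?_⟩
  · apply one_div_le_one_div_of_le <;> linarith
  · have hβ : 1 / x ≤ L / x := by gcongr; linarith
    set y := s / x + 1 / x with hy
    have hy0 : 0 ≤ y := by positivity
    have hyL : y ≤ 3 * (1 / (200 * L)) := by linarith
    have e5 : 1 / (200 * L) = (1 / L) / 200 := by field_simp
    have e6 : 1 / (4 * L) = (1 / L) / 4 := by field_simp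
    rw [e5] at hyL
    rw [e6]
    have hv1 : 1 / L ≤ 1 / 3 := one_div_le_one_div_of_le (by norm_num) h4
    have hv0 : 0 < 1 / L := by positivity
    set v := 1 / L
    have : 1 - 4 * y ≤ (1 - 2 * y) ^ 2 := by nlinarith [sq_nonneg y]
    have : (1 + v) * (1 - 4 * y) ≤ (1 + v) * (1 - 2 * y) ^ 2 := by gcongr
    nlinarith
  · have e7 : (1 + 1 / L) * x * (s / x) / 2 = s / 2 + s / (2 * L) := by field_simp
    have e8 : s / (2 * L) ≤ 1 := by rw [div_le_one (by positivity)]; exact hs2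
    have e9 : Real.log (1 / (s / x)) = L - Real.log s := by
      rw [one_div_div, Real.log_div hx0.ne' hs0.ne']
    have e10 : Real.log s ≤ Real.log 2 + l := by
      rw [hl, ← Real.log_mul (by norm_num) hL0.ne']
      exact Real.log_le_log hs0 hs2
    have e11 := Real.log_two_lt_d9
    rw [e7, e9]
    linarith
  · have e12 : (1 + 1 / L) * x * (s / x) ^ 2 = (1 + 1 / L) * (s ^ 2 / x) := by field_simp
    have e13 : s ^ 2 / x ≤ 1 / 50 := by
      rw [div_le_iff₀ hx0]
      have : s ^ 2 ≤ (2 * L) ^ 2 := by gcongr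
      linarith
    have hv1 : 1 / L ≤ 1 / 3 := one_div_le_one_div_of_le (by norm_num) h4
    rw [e12]
    have : 0 ≤ s ^ 2 / x := by positivity
    nlinarith [show (0 : ℝ) < 1 / L by positivity]

/-- The displayed quantity is `lam / fugacityOfDensity d α'`, and by continuity `lam` stays below
the fugacity slightly to the left of `α`. -/
lemma exists_density_lt {d : ℕ} (hd : 1 ≤ d) {α lam : ℝ} (hα0 : 0 < α) (hα : α < 1 / 2)
    (hlam0 : 0 < lam) (hlam : lam < fugacityOfDensity d α) :
    ∃ α', 0 < α' ∧ α' < α ∧ 0 < lam * ((1 - α') / α') * ((1 - 2 * α') / (1 - α')) ^ d ∧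
      lam * ((1 - α') / α') * ((1 - 2 * α') / (1 - α')) ^ d < 1 := by
  have hcont : ContinuousAt (fugacityOfDensity d) α := by
    unfold fugacityOfDensity
    have : 1 - 2 * α ≠ 0 := by linarith
    fun_prop (disch := assumption)
  have h1 : ∀ᶠ a in nhds α, lam < fugacityOfDensity d a := hcont.eventually (lt_mem_nhds hlam)
  have h2 : ∀ᶠ a in nhds α, 0 < a := lt_mem_nhds hα0
  obtain ⟨α', ⟨h3, h4⟩, h5⟩ := (((h1.and h2).filter_mono
    (nhdsWithin_le_nhds (s := Set.Iio α))).and self_mem_nhdsWithin).exists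
  have h5 : α' < α := h5
  have p1 : 0 < 1 - 2 * α' := by linarith
  have p2 : 0 < 1 - α' := by linarith
  refine ⟨α', h4, h5, by positivity, ?_⟩
  obtain ⟨e, rfl⟩ : ∃ e, d = e + 1 := ⟨d - 1, by omega⟩
  rw [fugacityOfDensity, Nat.add_sub_cancel] at h3
  calc lam * ((1 - α') / α') * ((1 - 2 * α') / (1 - α')) ^ (e + 1)
      < α' / (1 - 2 * α') * ((1 - α') / (1 - 2 * α')) ^ e * ((1 - α') / α') *
        ((1 - 2 * α') / (1 - α')) ^ (e + 1) := by gcongr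
    _ = 1 := by
        rw [pow_succ, div_pow, div_pow]
        have h6 := p1.ne'
        have h7 := p2.ne'
        generalize 1 - 2 * α' = u at *
        generalize 1 - α' = v at *
        field_simp

end DensityConstants

/-! ### The two moment estimates for the pieces. -/

namespace Pairing

variable {n d : ℕ} {p : Pairing n d} {S : Finset (Fin n)} {r : ℕ}

set_option maxHeartbeats 1000000 in
/-- Subexponential second moment of the number of independent sets of a given size `k` extending a
given configuration on the exposed vertices. -/
theorem second_moment_le {α β η K c₁ : ℝ} (hr : 1 ≤ r) (hd : 2 ≤ d) (hη : 0 < η) (hα : 0 < α)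
    (hα' : α ≤ 1 / 64) (hβ0 : 0 ≤ β) (hβ' : β ≤ 1 / 64) (hK0 : 0 ≤ K)
    (hK : 1 + η ≤ K * (1 - 2 * (α + β)) ^ 2)
    (hKα : K * d * α / 2 ≤ Real.log (1 / α) - 1) (hKα2 : K * d * α ^ 2 ≤ 1) (hn : 1 ≤ n)
    (hc₁ : 0 ≤ c₁) (hb : ((p.exposed S r).card : ℝ) ≤ c₁ * (n : ℝ) ^ (3 / 5 : ℝ))
    (hbn : 2 * (c₁ * (n : ℝ) ^ (3 / 5 : ℝ)) ≤ β * n)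
    {τ : Finset (Fin n)} (hτ : τ ⊆ p.exposed S r) {k : ℕ}
    (hk : (k : ℝ) ≤ α * (p.exposed S r)ᶜ.card) :
    (∑ q ∈ p.conditioned S r, (q.extCount (p.exposed S r) τ k : ℝ) ^ 2) *
        (p.conditioned S r).card ≤
      ((n + 1) * (d * n + 1) *
        Real.exp (10 + 8 * (1 + 1 / η) * d * (c₁ + 1) ^ 2 * (n : ℝ) ^ (1 / 5 : ℝ))) *
      (∑ q ∈ p.conditioned S r, (q.extCount (p.exposed S r) τ k : ℝ)) ^ 2 := by
  -- An exposed edge inside `τ` makes every count vanish.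
  by_cases hc : p.Compatible S r τ
  swap
  · rw [Finset.sum_eq_zero fun q hq => by rw [extCount_eq_zero hr hq hc]; simp]
    rw [zero_mul]
    positivity
  obtain ⟨m, hm⟩ := exists_card_free (p := p) (S := S) (r := r)
  have hbc : (p.exposed S r)ᶜ.card + (p.exposed S r).card = n := by
    rw [Finset.card_compl_add_card, Fintype.card_fin]
  have hm1 := le_card_free (p := p) (S := S) (d := d) hr
  have hm2 := card_free_le (p := p) (S := S) (r := r)
  rw [hm] at hm1 hm2
  have hab : (p.freeAt S r τ).card ≤ d * (p.exposed S r).card :=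
    (card_freeAt_le τ).trans (Nat.mul_le_mul_left d (Finset.card_le_card hτ))
  have hsum := sum_extCount hr hm hτ hc k
  have hsq := sum_extCount_sq_le hr hm hτ (k := k)
  have hsq' := sum_extCount_sq_le_simple hr hm hτ hc k
  set b := (p.exposed S r).card with hbdef
  set N := (p.exposed S r)ᶜ.card with hNdef
  set a := (p.freeAt S r τ).card with hadef
  set Ω := p.conditioned S r with hΩ
  have hΩ0 : (0 : ℝ) ≤ Ω.card := Nat.cast_nonneg _
  have hnr : (1 : ℝ) ≤ n := by exact_mod_cast hn
  have hn0 : (0 : ℝ) < n := by linarith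
  have hbc' : (N : ℝ) + b = n := by exact_mod_cast hbc
  have hdr : (2 : ℝ) ≤ d := by exact_mod_cast hd
  have hbβ : (b : ℝ) ≤ β * n / 2 := by linarith
  have hNn : (n : ℝ) / 2 ≤ N := by
    have : β * (n : ℝ) ≤ 1 / 64 * n := by gcongr
    linarith
  have hN0 : (0 : ℝ) < N := by linarith
  have hN1 : 1 ≤ N := by exact_mod_cast hN0
  have hbN : (b : ℝ) ≤ β * N := by
    have : β * (n / 2) ≤ β * N := by gcongr
    linarith
  have hkN : k ≤ N := by
    have : α * (N : ℝ) ≤ 1 * N := by gcongr; linarith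
    have : (k : ℝ) ≤ N := by linarith
    exact_mod_cast this
  have habr : (a : ℝ) ≤ d * b := by exact_mod_cast hab
  have hm1r : (d : ℝ) * N ≤ 2 * m := by exact_mod_cast hm1
  have h32 : 32 * ((a + d * k : ℕ) : ℝ) ≤ 2 * m := by
    push_cast
    have h1 : (d : ℝ) * k ≤ d * (1 / 64 * N) := by
      gcongr
      refine hk.trans ?_
      gcongr
    have h2 : (d : ℝ) * b ≤ d * (1 / 64 * N) := by
      gcongr
      refine hbN.trans ?_
      gcongr
    linarith
  have h32n : 32 * (a + d * k) ≤ 2 * m := by exact_mod_cast h32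
  have hm0 : 0 < m := by
    have : 0 < (d : ℝ) * N := by positivity
    have : (0 : ℝ) < m := by linarith
    exact_mod_cast this
  set P := avoidProb m (a + d * k) with hP
  have hPpos : 0 < P := avoidProb_pos (by omega)
  set x := (n : ℝ) ^ (1 / 5 : ℝ) with hx
  have hx0 : 0 < x := Real.rpow_pos_of_pos hn0 _
  set y := (n : ℝ) ^ (3 / 5 : ℝ) with hy
  have hy0 : 0 < y := Real.rpow_pos_of_pos hn0 _
  have hxy : y ^ 2 = x * n := by
    rw [hy, hx, ← Real.rpow_natCast, ← Real.rpow_mul hn0.le, ← Real.rpow_add_one hn0.ne']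
    norm_num
  have hη' : 1 ≤ 1 + 1 / η := by
    have : 0 < 1 / η := by positivity
    linarith
  set E := (n + 1) * (d * n + 1) *
    Real.exp (10 + 8 * (1 + 1 / η) * d * (c₁ + 1) ^ 2 * x) with hE
  have hhn : ((a + d * k : ℕ) : ℝ) ≤ d * n := by
    push_cast
    have : (d : ℝ) * k ≤ d * N := by gcongr
    rw [← hbc']
    linarith
  have hkn : (k : ℝ) ≤ n := by
    have : (k : ℝ) ≤ N := by exact_mod_cast hkN
    have : (0 : ℝ) ≤ b := Nat.cast_nonneg b
    linarith
  have hge := avoidProb_ge (m := m) (h := a + d * k) (by omega) hm0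
  rw [← hP] at hge
  clear_value E P Ω x y a b N
  -- If `k² ≥ N`, the mean overlap is at least 1 and the Gaussian comparison applies, with loss of
  -- order `d b²/N = O(n^(1/5))`. Otherwise `k ≤ n^(3/5)`, so `h = a + d k = O(n^(3/5))` and
  -- `avoidProb` is at least `exp(-h²/m) = exp(-O(n^(1/5)))`.
  rcases le_or_gt N (k ^ 2) with hcase | hcase
  · have h1 := hsq hkN (by omega) (R := ((a + d * k : ℕ) + 1) *
      Real.exp (10 + (1 + 1 / η) * 4 * d * b ^ 2 / N)) (fun j hj =>
        overlapProb_mul_pairRatio_le hd hη hα hα' hβ0 hβ' hK0 hK hKα hKα2 hbN hab hm1 hm2 hk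
          hcase hN1 hj)
    have hexp : (1 + 1 / η) * 4 * d * b ^ 2 / N ≤ 8 * (1 + 1 / η) * d * (c₁ + 1) ^ 2 * x := by
      rw [div_le_iff₀ hN0]
      have hb2 : (b : ℝ) ^ 2 ≤ (c₁ + 1) ^ 2 * (x * n) := by
        rw [← hxy, ← mul_pow]
        apply pow_le_pow_left₀ (Nat.cast_nonneg b)
        refine hb.trans ?_
        gcongr
        linarith
      calc (1 + 1 / η) * 4 * d * (b : ℝ) ^ 2
          ≤ (1 + 1 / η) * 4 * d * ((c₁ + 1) ^ 2 * (x * n)) := by gcongr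
        _ = 8 * (1 + 1 / η) * d * (c₁ + 1) ^ 2 * x * (n / 2) := by ring
        _ ≤ _ := by gcongr
    have hR : ((k : ℝ) + 1) * (((a + d * k : ℕ) + 1) *
        Real.exp (10 + (1 + 1 / η) * 4 * d * b ^ 2 / N)) ≤ E := by
      rw [hE, ← mul_assoc]
      gcongr
    calc _ ≤ Ω.card * ((k + 1) * (((a + d * k : ℕ) + 1) *
          Real.exp (10 + (1 + 1 / η) * 4 * d * b ^ 2 / N))) * (N.choose k * P) ^ 2 * Ω.card :=
          mul_le_mul_of_nonneg_right h1 hΩ0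
      _ = ((k + 1) * (((a + d * k : ℕ) + 1) *
          Real.exp (10 + (1 + 1 / η) * 4 * d * b ^ 2 / N))) *
          (Ω.card * (N.choose k * P)) ^ 2 := by ring
      _ ≤ E * (Ω.card * (N.choose k * P)) ^ 2 := by gcongr
      _ = _ := by rw [hsum]
  · have hk2 : (k : ℝ) ≤ y := by
      have h1 : (k : ℝ) ^ 2 ≤ y ^ 2 := by
        have h2 : (k : ℝ) ^ 2 < N := by exact_mod_cast hcase
        have h3 : 1 ≤ x := by rw [hx]; exact Real.one_le_rpow hnr (by norm_num)
        have h4 : (N : ℝ) ≤ n := by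
          have : (0 : ℝ) ≤ b := Nat.cast_nonneg b
          linarith
        rw [hxy]
        nlinarith
      exact le_of_sq_le_sq h1 hy0.le
    have hexp : ((a + d * k : ℕ) : ℝ) ^ 2 / m ≤ 8 * (1 + 1 / η) * d * (c₁ + 1) ^ 2 * x := by
      have hm0' : (0 : ℝ) < m := by exact_mod_cast hm0
      rw [div_le_iff₀ hm0']
      have h1 : ((a + d * k : ℕ) : ℝ) ≤ d * ((c₁ + 1) * y) := by
        push_cast
        have : (d : ℝ) * k ≤ d * y := by gcongr
        have : (d : ℝ) * b ≤ d * (c₁ * y) := by gcongr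
        linarith
      have h2 : (d : ℝ) * n / 4 ≤ m := by
        have : (d : ℝ) * (n / 2) ≤ d * N := by gcongr
        linarith
      calc ((a + d * k : ℕ) : ℝ) ^ 2 ≤ (d * ((c₁ + 1) * y)) ^ 2 := by gcongr
        _ = d ^ 2 * (c₁ + 1) ^ 2 * (x * n) := by rw [← hxy]; ring
        _ = (8 * (1 / 2) * d * (c₁ + 1) ^ 2 * x) * (d * n / 4) := by ring
        _ ≤ (8 * (1 + 1 / η) * d * (c₁ + 1) ^ 2 * x) * m := by
            gcongr
            linarith
    have hinv : 1 ≤ E * P := by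
      have h1 : Real.exp (8 * (1 + 1 / η) * d * (c₁ + 1) ^ 2 * x) ≤ E := by
        rw [hE]
        have h2 : Real.exp (8 * (1 + 1 / η) * d * (c₁ + 1) ^ 2 * x) ≤
            Real.exp (10 + 8 * (1 + 1 / η) * d * (c₁ + 1) ^ 2 * x) := by
          apply Real.exp_le_exp.2; linarith
        refine h2.trans (le_mul_of_one_le_left (Real.exp_nonneg _) ?_)
        have : (0 : ℝ) ≤ d * n := by positivity
        nlinarith
      calc (1 : ℝ) = Real.exp (8 * (1 + 1 / η) * d * (c₁ + 1) ^ 2 * x) *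
            Real.exp (-(8 * (1 + 1 / η) * d * (c₁ + 1) ^ 2 * x)) := by
            rw [← Real.exp_add, add_neg_cancel, Real.exp_zero]
        _ ≤ E * P := by
            refine mul_le_mul h1 (le_trans ?_ hge) (Real.exp_nonneg _) ((Real.exp_nonneg _).trans h1)
            apply Real.exp_le_exp.2
            linarith
    have hnn : 0 ≤ Ω.card * ((N.choose k : ℝ) ^ 2 * P) * Ω.card := by positivity
    calc _ ≤ Ω.card * ((N.choose k : ℝ) ^ 2 * P) * Ω.card := mul_le_mul_of_nonneg_right hsq' hΩ0
      _ ≤ (E * P) * (Ω.card * ((N.choose k : ℝ) ^ 2 * P) * Ω.card) :=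
          le_mul_of_one_le_left hnn hinv
      _ = E * (Ω.card * (N.choose k * P)) ^ 2 := by ring
      _ = _ := by rw [hsum]

/-- Densities above `α` carry an exponentially small part of the first moment. -/
theorem first_moment_le {α α' lam s : ℝ} (hr : 1 ≤ r) (hd : 2 ≤ d) (hlam : 0 < lam)
    (hα0 : 0 < α') (hαα : α' < α) (hα : α < 1 / 2)
    (hs : lam * ((1 - α') / α') * ((1 - 2 * α') / (1 - α')) ^ d = Real.exp (-s)) (hs0 : 0 < s)
    (hbn : α * (p.exposed S r).card + 1 ≤ (α - α') / 2 * n)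
    (hN : 0 < (p.exposed S r)ᶜ.card)
    {τ : Finset (Fin n)} (hτ : τ ⊆ p.exposed S r) {k : ℕ} (hkN : k ≤ (p.exposed S r)ᶜ.card)
    (hk : α * (p.exposed S r)ᶜ.card < k) :
    ∃ k₁ ≤ (p.exposed S r)ᶜ.card,
      ∑ q ∈ p.conditioned S r, extWeight lam (p.exposed S r) (τ, k) q ≤
        Real.exp (-(s * ((α - α') / 2) * n)) *
          ∑ q ∈ p.conditioned S r, extWeight lam (p.exposed S r) (τ, k₁) q := by
  by_cases hc : p.Compatible S r τ
  swap
  · refine ⟨k, hkN, ?_⟩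
    have : ∀ q ∈ p.conditioned S r, extWeight lam (p.exposed S r) (τ, k) q = 0 := fun q hq => by
      unfold extWeight
      simp [extCount_eq_zero hr hq hc]
    rw [Finset.sum_eq_zero this, mul_zero]
  obtain ⟨m, hm⟩ := exists_card_free (p := p) (S := S) (r := r)
  have hbc : (p.exposed S r)ᶜ.card + (p.exposed S r).card = n := by
    rw [Finset.card_compl_add_card, Fintype.card_fin]
  have hm1 := le_card_free (p := p) (S := S) (d := d) hr
  have hm2 := card_free_le (p := p) (S := S) (r := r)
  rw [hm] at hm1 hm2
  have hM : ∀ i, ∑ q ∈ p.conditioned S r, extWeight lam (p.exposed S r) (τ, i) q =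
      lam ^ τ.card * (p.conditioned S r).card * ((p.exposed S r)ᶜ.card.choose i *
        avoidProb m ((p.freeAt S r τ).card + d * i) * lam ^ i) := by
    intro i
    unfold extWeight
    rw [← Finset.mul_sum, sum_extCount hr hm hτ hc, pow_add]
    ring
  simp only [hM]
  set b := (p.exposed S r).card with hbdef
  set N := (p.exposed S r)ᶜ.card with hNdef
  set a := (p.freeAt S r τ).card with hadef
  have hbc' : (N : ℝ) + b = n := by exact_mod_cast hbc
  have hm0 : 0 < m := by
    have : 0 < d * N := by positivity
    omega
  set g : ℕ → ℝ := fun i => (N.choose i : ℝ) * avoidProb m (a + d * i) * lam ^ i with hg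
  have hg0 : ∀ i, 0 ≤ g i := fun i =>
    mul_nonneg (mul_nonneg (Nat.cast_nonneg _) (avoidProb_nonneg _ _)) (pow_nonneg hlam.le _)
  -- The geometric decay is already valid from density `α'` relative to `n = N + b`, and `k` lies at
  -- least `(α - α') n / 2` above this starting point.
  set k₁ := ⌈α' * (n : ℝ)⌉₊ with hk₁
  have hk₁l : α' * n ≤ k₁ := Nat.le_ceil _
  have hk₁u : (k₁ : ℝ) < α' * n + 1 := Nat.ceil_lt_add_one (by positivity)
  have hgap : (α - α') / 2 * n ≤ (k : ℝ) - k₁ := by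
    have : α * (N : ℝ) = α * n - α * b := by rw [← hbc']; ring
    linarith
  have hk₁k : k₁ ≤ k := by
    have h1 : 0 ≤ (α - α') / 2 * (n : ℝ) := mul_nonneg (by linarith) (Nat.cast_nonneg n)
    have : (k₁ : ℝ) ≤ k := by linarith
    exact_mod_cast this
  refine ⟨k₁, hk₁k.trans hkN, ?_⟩
  have key : g k ≤ Real.exp (-s * ((k : ℝ) - k₁)) * g k₁ := by
    clear hgap hk
    induction k, hk₁k using Nat.le_induction with
    | base => simp
    | succ i hi ih =>
      have ih := ih (by omega)
      have hstep := firstMoment_succ_le (N := N) (d := d) (b := b) (a := a) (m := m) (k := i)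
        hα0 (by linarith) hlam.le hm0 hm2
        (by rw [hbc']; exact hk₁l.trans (by exact_mod_cast hi)) (by omega)
      rw [hs] at hstep
      refine hstep.trans ?_
      calc Real.exp (-s) * g i ≤ Real.exp (-s) * (Real.exp (-s * ((i : ℝ) - k₁)) * g k₁) := by
            gcongr
        _ = _ := by
            rw [← mul_assoc, ← Real.exp_add]
            push_cast
            ring_nf
  have hexp : Real.exp (-s * ((k : ℝ) - k₁)) ≤ Real.exp (-(s * ((α - α') / 2) * n)) := by
    apply Real.exp_le_exp.2
    have := mul_le_mul_of_nonneg_left hgap hs0.le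
    linarith
  have hkey : g k ≤ Real.exp (-(s * ((α - α') / 2) * n)) * g k₁ :=
    key.trans (mul_le_mul_of_nonneg_right hexp (hg0 _))
  calc lam ^ τ.card * (p.conditioned S r).card * g k
      ≤ lam ^ τ.card * (p.conditioned S r).card *
        (Real.exp (-(s * ((α - α') / 2) * n)) * g k₁) := by gcongr
    _ = _ := by ring

end Pairing

/-! ### Comparison of the powers of `n`. -/

section Asymptotics

open Filter

lemma eventually_mul_rpow_le (A : ℝ) {a b : ℝ} (hab : a < b) :
    ∀ᶠ n : ℕ in atTop, A * (n : ℝ) ^ a ≤ (n : ℝ) ^ b := by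
  have h := ((tendsto_rpow_atTop (sub_pos.2 hab)).comp
    tendsto_natCast_atTop_atTop).eventually_ge_atTop A
  filter_upwards [h, eventually_ge_atTop 1] with n hn h1
  have h0 : (0 : ℝ) < n := by exact_mod_cast h1
  have : (n : ℝ) ^ b = (n : ℝ) ^ (b - a) * (n : ℝ) ^ a := by
    rw [← Real.rpow_add h0]; congr 1; ring
  rw [this]
  exact mul_le_mul_of_nonneg_right hn (Real.rpow_nonneg h0.le _)

/-- Asymptotics of the truncated second moment bound. -/
lemma eventually_tail_le (d : ℕ) (κ c : ℝ) {s : ℝ} (hs : 0 < s) :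
    ∀ᶠ n : ℕ in atTop, 4 / (3 * Real.exp (-(n : ℝ) ^ (4 / 7 : ℝ))) *
      (4 * ((n + 1) * (d * n + 1) * Real.exp (10 + κ * (n : ℝ) ^ (1 / 5 : ℝ))) /
        Real.exp (c * (n : ℝ) ^ (3 / 5 : ℝ)) + (n + 1) * Real.exp (-(s * n))) ≤
      Real.exp (-((n : ℝ) ^ (3 / 5 : ℝ) * (c - (n : ℝ) ^ (-(1 / 70) : ℝ)))) := by
  have hlog : ∀ᶠ n : ℕ in atTop, Real.log (n : ℝ) ≤ (n : ℝ) ^ (1 / 5 : ℝ) := by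
    have h := (isLittleO_log_rpow_atTop (show (0 : ℝ) < 1 / 5 by norm_num)).bound one_pos
    filter_upwards [tendsto_natCast_atTop_atTop.eventually h] with n hn
    rw [one_mul, Real.norm_of_nonneg (Real.rpow_nonneg (Nat.cast_nonneg n) _)] at hn
    exact (le_abs_self _).trans hn
  set L := Real.log (32 * (2 * (d + 1))) + 10 with hL
  -- The error exponent is `3/5 - 1/70 = 41/70`, just above `4/7 = 40/70`, so it absorbs the factor
  -- `exp(n^(4/7))`. In `h2`, `h3`, `h4` the constants, `n^(4/7)` and `n^(1/5)` each use a quarter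
  -- of it.
  filter_upwards [hlog, eventually_ge_atTop 1,
    eventually_mul_rpow_le (4 * L) (show (0 : ℝ) < 41 / 70 by norm_num),
    eventually_mul_rpow_le 4 (show (4 / 7 : ℝ) < 41 / 70 by norm_num),
    eventually_mul_rpow_le (4 * (κ + 2)) (show (1 / 5 : ℝ) < 41 / 70 by norm_num),
    eventually_mul_rpow_le (4 / s * Real.log 32) (show (0 : ℝ) < 1 by norm_num),
    eventually_mul_rpow_le (4 / s) (show (4 / 7 : ℝ) < 1 by norm_num),
    eventually_mul_rpow_le (4 / s) (show (1 / 5 : ℝ) < 1 by norm_num),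
    eventually_mul_rpow_le (4 / s * c) (show (3 / 5 : ℝ) < 1 by norm_num)] with
    n h0 h1 h2 h3 h4 h5 h6 h7 h8
  have hn : (1 : ℝ) ≤ n := by exact_mod_cast h1
  have hn0 : (0 : ℝ) < n := by linarith
  have hv : (n : ℝ) ^ (3 / 5 : ℝ) * (n : ℝ) ^ (-(1 / 70) : ℝ) = (n : ℝ) ^ (41 / 70 : ℝ) := by
    rw [← Real.rpow_add hn0]; norm_num
  have hv0 : 0 ≤ (n : ℝ) ^ (41 / 70 : ℝ) := by positivity
  rw [mul_sub, hv]
  rw [Real.rpow_zero] at h2 h5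
  rw [Real.rpow_one] at h5 h6 h7 h8
  generalize (n : ℝ) ^ (41 / 70 : ℝ) = v at *
  generalize (n : ℝ) ^ (3 / 5 : ℝ) = z at *
  generalize (n : ℝ) ^ (4 / 7 : ℝ) = w at *
  generalize (n : ℝ) ^ (1 / 5 : ℝ) = y at *
  have hny : (n : ℝ) ≤ Real.exp y := by
    rw [← Real.log_le_iff_le_exp hn0]; exact h0
  have hn1 : (n : ℝ) + 1 ≤ 2 * Real.exp y := by linarith
  have hdn : (d : ℝ) * n + 1 ≤ (d + 1) * Real.exp y := by
    have : (d : ℝ) * n ≤ d * Real.exp y := by gcongr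
    linarith
  have hd0 : (0 : ℝ) < 32 * (2 * (d + 1)) := by positivity
  have e1 : 4 / (3 * Real.exp (-w)) = 4 / 3 * Real.exp w := by
    rw [Real.exp_neg]; field_simp
  have e2 : 4 * ((n + 1) * (d * n + 1) * Real.exp (10 + κ * y)) / Real.exp (c * z) ≤
      4 * ((2 * Real.exp y) * ((d + 1) * Real.exp y) * Real.exp (10 + κ * y)) /
        Real.exp (c * z) := by gcongr
  have e3 : 4 * ((2 * Real.exp y) * ((d + 1) * Real.exp y) * Real.exp (10 + κ * y)) /
        Real.exp (c * z) = 1 / 8 * Real.exp (L + (κ + 2) * y - c * z) := by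
    have : L + (κ + 2) * y - c * z = Real.log (32 * (2 * (d + 1))) + y + y + (10 + κ * y) -
      c * z := by rw [hL]; ring
    rw [this, Real.exp_sub, Real.exp_add _ (10 + κ * y), Real.exp_add _ y, Real.exp_add _ y,
      Real.exp_log hd0]
    ring
  have e4 : (n + 1) * Real.exp (-(s * n)) ≤ 2 * Real.exp y * Real.exp (-(s * n)) := by gcongr
  have e5 : 2 * Real.exp y * Real.exp (-(s * n)) =
      1 / 16 * Real.exp (Real.log 32 + y - s * n) := by
    rw [sub_eq_add_neg, Real.exp_add, Real.exp_add, Real.exp_log (by norm_num)]; ring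
  have f1 : L + (κ + 2) * y - c * z ≤ -(z * c - v) - w := by linarith
  have f2 : Real.log 32 + y - s * n ≤ -(z * c - v) - w := by
    have g : ∀ t : ℝ, 4 / s * t ≤ n → t ≤ s * n / 4 := fun t ht => by
      have := mul_le_mul_of_nonneg_left ht hs.le
      have h' : s * (4 / s * t) = 4 * t := by field_simp
      linarith
    have g1 := g _ (by linarith : 4 / s * Real.log 32 ≤ n)
    have g2 := g _ h6
    have g3 := g _ h7
    have g4 := g (c * z) (by rw [← mul_assoc]; exact h8)
    linarith
  rw [e1]
  calc _ ≤ 4 / 3 * Real.exp w * (1 / 8 * Real.exp (-(z * c - v) - w) +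
        1 / 16 * Real.exp (-(z * c - v) - w)) := by
        refine mul_le_mul_of_nonneg_left (add_le_add ?_ ?_) (by positivity)
        · exact (e2.trans e3.le).trans
            (mul_le_mul_of_nonneg_left (Real.exp_le_exp.2 f1) (by norm_num))
        · exact (e4.trans e5.le).trans
            (mul_le_mul_of_nonneg_left (Real.exp_le_exp.2 f2) (by norm_num))
    _ = 1 / 4 * Real.exp (-(z * c - v)) := by
        rw [Real.exp_sub _ w]
        field_simp
        ring
    _ ≤ _ := by linarith [Real.exp_pos (-(z * c - v))]

end Asymptotics

/-! ### From moments to the probability of an exceptional family. -/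

namespace Pairing

variable {n d : ℕ} {p : Pairing n d} {S : Finset (Fin n)} {r : ℕ}

lemma condP_le_one (A : Pairing n d → Prop) : p.condP S r A ≤ 1 := by
  classical
  unfold condP
  refine div_le_one_of_le₀ ?_ (Nat.cast_nonneg _)
  exact_mod_cast Finset.card_filter_le _ _

/-- If sets of size `k ≤ α N` outside the exposed set have second moment at most `E` times the
squared first moment, and larger sets are negligible in expectation, then the weight of no large
family of boundary configurations exceeds its expectation by much. -/
theorem condP_exists_family_le {α lam c E e : ℝ} (hlam : 0 ≤ lam) (hE : 0 ≤ E) (he : 0 ≤ e)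
    (hgood : ∀ τ ⊆ p.exposed S r, ∀ k : ℕ, (k : ℝ) ≤ α * (p.exposed S r)ᶜ.card →
      (∑ q ∈ p.conditioned S r, (q.extCount (p.exposed S r) τ k : ℝ) ^ 2) *
        (p.conditioned S r).card ≤
      E * (∑ q ∈ p.conditioned S r, (q.extCount (p.exposed S r) τ k : ℝ)) ^ 2)
    (hbad : ∀ τ ⊆ p.exposed S r, ∀ k ≤ (p.exposed S r)ᶜ.card,
      α * (p.exposed S r)ᶜ.card < k → ∃ k₁ ≤ (p.exposed S r)ᶜ.card,
        ∑ q ∈ p.conditioned S r, extWeight lam (p.exposed S r) (τ, k) q ≤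
          e * ∑ q ∈ p.conditioned S r, extWeight lam (p.exposed S r) (τ, k₁) q) :
    p.condP S r (fun q => ∃ 𝓑 : Finset (Finset (Fin n)), 𝓑 ⊆ (p.boundary S r).powerset ∧
        p.EventE1 lam c S r 𝓑 q ∧ p.EventE2 lam S r 𝓑 q) ≤
      4 / (3 * Real.exp (-(n : ℝ) ^ (4 / 7 : ℝ))) *
        (4 * E / Real.exp (c * (n : ℝ) ^ (3 / 5 : ℝ)) + (n + 1) * e) := by
  classical
  set U := p.exposed S r with hU
  set Ω := p.conditioned S r with hΩ
  have hBU : p.boundary S r ⊆ U := by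
    rw [hU, exposed]; exact Finset.subset_union_right
  have hUn : Uᶜ.card ≤ n := by simpa using Finset.card_le_univ Uᶜ
  set R := Finset.range (Uᶜ.card + 1) with hR
  have hmain := card_filter_exists_subfamily_le Ω (U.powerset ×ˢ R) (extWeight lam U)
    (fun i q => extWeight_nonneg hlam U i q) (fun i => (i.2 : ℝ) ≤ α * Uᶜ.card)
    (Real.exp_pos (c * (n : ℝ) ^ (3 / 5 : ℝ))) (Real.exp_pos (-(n : ℝ) ^ (4 / 7 : ℝ))) hE
    (show 0 ≤ ((n : ℝ) + 1) * e by positivity) ?_ ?_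
  · refine le_trans ?_ hmain
    unfold condP
    refine div_le_div_of_nonneg_right ?_ (Nat.cast_nonneg _)
    refine Nat.cast_le.2 (Finset.card_le_card ?_)
    intro q hq
    obtain ⟨hqΩ, 𝓑, -, h1, h2⟩ := (@Finset.mem_filter _ _ (_) _ _).1 hq
    -- The subfamily `J` for `𝓑` consists of all traces `τ` on the exposed set whose restriction to
    -- the boundary lies in `𝓑`, with every size `k`.
    refine Finset.mem_filter.2 ⟨hqΩ, (U.powerset.filter fun τ => τ ∩ p.boundary S r ∈ 𝓑) ×ˢ R,
      Finset.product_subset_product_left (Finset.filter_subset _ _), ?_⟩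
    have hs : ∑ σ ∈ 𝓑, p.condE S r (fun q' => q'.ZBdry lam (p.boundary S r) σ) =
        (∑ i ∈ (U.powerset.filter fun τ => τ ∩ p.boundary S r ∈ 𝓑) ×ˢ R,
          ∑ q' ∈ Ω, extWeight lam U i q') / Ω.card := by
      unfold condE
      rw [← Finset.sum_div, Finset.sum_comm, Finset.sum_comm (t := Ω)]
      congr 1
      refine Finset.sum_congr rfl fun q' _ => ?_
      convert sum_ZBdry_eq_sum lam q' hBU 𝓑
    have hz : p.condE S r (fun q' => q'.Z lam) =
        (∑ i ∈ U.powerset ×ˢ R, ∑ q' ∈ Ω, extWeight lam U i q') / Ω.card := by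
      unfold condE
      rw [Finset.sum_comm (t := Ω)]
      congr 1
      exact Finset.sum_congr rfl fun q' _ => Z_eq_sum lam q' U
    have hq2 : ∑ σ ∈ 𝓑, q.ZBdry lam (p.boundary S r) σ =
        ∑ i ∈ (U.powerset.filter fun τ => τ ∩ p.boundary S r ∈ 𝓑) ×ˢ R,
          extWeight lam U i q := by
      convert sum_ZBdry_eq_sum lam q hBU 𝓑
    unfold EventE1 at h1
    unfold EventE2 at h2
    rw [hs, hq2] at h1
    rw [hz, hq2] at h2
    exact ⟨h1, h2⟩
  · rintro ⟨τ, k⟩ hi hk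
    rw [Finset.mem_product, Finset.mem_powerset] at hi
    have h := hgood τ hi.1 k hk
    unfold extWeight
    simp only [mul_pow, ← Finset.mul_sum]
    have h0 : 0 ≤ (lam ^ (τ.card + k)) ^ 2 := by positivity
    nlinarith [mul_le_mul_of_nonneg_left h h0]
  · have hM0 : ∀ i, 0 ≤ ∑ q ∈ Ω, extWeight lam U i q :=
      fun i => Finset.sum_nonneg fun q _ => extWeight_nonneg hlam U i q
    -- Each of the at most `n + 1` dense sizes is charged to the full weight of its own trace `τ`;
    -- this produces the factor `n + 1`.
    have hb : ∀ τ ∈ U.powerset, ∀ k ∈ R,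
        (if ¬ (k : ℝ) ≤ α * Uᶜ.card then ∑ q ∈ Ω, extWeight lam U (τ, k) q else 0) ≤
          e * ∑ k₁ ∈ R, ∑ q ∈ Ω, extWeight lam U (τ, k₁) q := by
      intro τ hτ k hk
      have hpos : 0 ≤ e * ∑ k₁ ∈ R, ∑ q ∈ Ω, extWeight lam U (τ, k₁) q :=
        mul_nonneg he (Finset.sum_nonneg fun k₁ _ => hM0 _)
      split_ifs with hk'
      · exact hpos
      · obtain ⟨k₁, hk₁, h⟩ := hbad τ (Finset.mem_powerset.1 hτ) k
          (Nat.lt_succ_iff.1 (Finset.mem_range.1 hk)) (not_le.1 hk')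
        refine h.trans (mul_le_mul_of_nonneg_left ?_ he)
        exact Finset.single_le_sum (f := fun k₁ => ∑ q ∈ Ω, extWeight lam U (τ, k₁) q)
          (fun k _ => hM0 _) (Finset.mem_range.2 (Nat.lt_succ_iff.2 hk₁))
    rw [Finset.sum_filter, Finset.sum_product, Finset.sum_product, Finset.mul_sum]
    refine Finset.sum_le_sum fun τ hτ => ?_
    refine (Finset.sum_le_sum fun k hk => hb τ hτ k hk).trans ?_
    rw [Finset.sum_const, nsmul_eq_mul, hR, Finset.card_range, mul_assoc]
    refine mul_le_mul_of_nonneg_right ?_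
      (mul_nonneg he (Finset.sum_nonneg fun k₁ _ => hM0 _))
    have : (Uᶜ.card : ℝ) ≤ n := by exact_mod_cast hUn
    push_cast
    linarith

end Pairing

/-! ### Assembly of the estimates. -/

theorem mainTheorem8 (C : ℝ) (hC : 3 < C) :
    ∃ d₀ : ℕ, ∀ d : ℕ, d₀ ≤ d →
      ∀ lam : ℝ, 0 < lam → lam < fugacityOfDensity d (criticalDensity C d) →
      ∀ r : ℕ, 1 ≤ r → ∀ K c : ℝ, 0 < c →
      ∃ δ : ℕ → ℝ, Filter.Tendsto δ Filter.atTop (nhds 0) ∧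
        ∀ (n : ℕ) (S : Finset (Fin n)), S.card = ⌊(n : ℝ) ^ (3 / 5 : ℝ)⌋₊ →
        ∀ p : Pairing n d, p.Typical S r K →
          p.condP S r (fun q => ∃ 𝓑 : Finset (Finset (Fin n)),
              𝓑 ⊆ (p.boundary S r).powerset ∧
              p.EventE1 lam c S r 𝓑 q ∧ p.EventE2 lam S r 𝓑 q)
            ≤ Real.exp (-((n : ℝ) ^ (3 / 5 : ℝ) * (c - δ n))) := by
  obtain ⟨d₀, hd₀⟩ := exists_density_constants hC
  refine ⟨d₀, fun d hdd lam hlam0 hlam r hr _ c _ => ?_⟩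
  obtain ⟨η, κ, β, hd, hη, hβ0, hβ, hκ0, hα0, hα, h1, h2, h3⟩ := hd₀ d hdd
  generalize criticalDensity C d = α at *
  obtain ⟨α', hα'0, hα'α, hρ0, hρ1⟩ :=
    exists_density_lt (by omega : 1 ≤ d) hα0 (by linarith) hlam0 hlam
  set ρ := lam * ((1 - α') / α') * ((1 - 2 * α') / (1 - α')) ^ d with hρ
  have hs0 : 0 < -Real.log ρ := neg_pos.2 (Real.log_neg hρ0 hρ1)
  have hρs : ρ = Real.exp (-(-Real.log ρ)) := by rw [neg_neg, Real.exp_log hρ0]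
  have hss : 0 < -Real.log ρ * ((α - α') / 2) := mul_pos hs0 (by linarith)
  -- Bounds the size of a ball of radius `r`, hence the exposed set has at most `c₁ n^(3/5)`
  -- vertices, uniformly in the puncture.
  set c₁ : ℝ := (d + 1) ^ r with hc₁
  have hc₁0 : 0 < c₁ := by positivity
  have hγ : 0 < (α - α') / 4 := by linarith
  obtain ⟨n₀, hn₀⟩ := Filter.eventually_atTop.1
    ((eventually_tail_le d (8 * (1 + 1 / η) * d * (c₁ + 1) ^ 2) c hss).and
    ((Filter.eventually_ge_atTop 1).and
    ((eventually_mul_rpow_le (2 * c₁ / β) (show (3 / 5 : ℝ) < 1 by norm_num)).and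
    ((eventually_mul_rpow_le (α * c₁ / ((α - α') / 4)) (show (3 / 5 : ℝ) < 1 by norm_num)).and
    (eventually_mul_rpow_le (1 / ((α - α') / 4)) (show (0 : ℝ) < 1 by norm_num))))))
  -- For `n < n₀` the value `c` makes the claimed bound `exp 0 = 1`.
  refine ⟨fun n => if n₀ ≤ n then (n : ℝ) ^ (-(1 / 70) : ℝ) else c, ?_, fun n S hS p _ => ?_⟩
  · refine ((tendsto_rpow_neg_atTop (show (0 : ℝ) < 1 / 70 by norm_num)).comp
      tendsto_natCast_atTop_atTop).congr' ?_
    filter_upwards [Filter.eventually_ge_atTop n₀] with n hn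
    simp [hn]
  by_cases hn : n₀ ≤ n
  swap
  · simp only [hn, if_false, sub_self, mul_zero, neg_zero, Real.exp_zero]
    exact Pairing.condP_le_one _
  simp only [hn, if_true]
  obtain ⟨g1, g2, g3, g4, g5⟩ := hn₀ n hn
  have hn1 : (1 : ℝ) ≤ n := by exact_mod_cast g2
  rw [Real.rpow_one] at g3 g4 g5
  rw [Real.rpow_zero, mul_one, div_le_iff₀ hγ] at g5
  have hb : ((p.exposed S r).card : ℝ) ≤ c₁ * (n : ℝ) ^ (3 / 5 : ℝ) := by
    have hS' : (S.card : ℝ) ≤ (n : ℝ) ^ (3 / 5 : ℝ) := by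
      rw [hS]; exact Nat.floor_le (by positivity)
    calc ((p.exposed S r).card : ℝ) ≤ ((S.card * (d + 1) ^ r : ℕ) : ℝ) := by
          exact_mod_cast Pairing.card_exposed_le
      _ = c₁ * S.card := by rw [hc₁]; push_cast; ring
      _ ≤ _ := by gcongr
  rw [div_mul_eq_mul_div, div_le_iff₀ hβ0] at g3
  rw [div_mul_eq_mul_div, div_le_iff₀ hγ] at g4
  have hbn : α * (p.exposed S r).card + 1 ≤ (α - α') / 2 * n := by
    have := mul_le_mul_of_nonneg_left hb hα0.le
    linarith
  have hN : 0 < (p.exposed S r)ᶜ.card := by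
    have h4 : ((p.exposed S r).card : ℝ) < n := by
      have := mul_le_mul_of_nonneg_right hβ (by linarith : (0 : ℝ) ≤ n)
      linarith
    have h5 : (p.exposed S r).card < n := by exact_mod_cast h4
    rw [Finset.card_compl, Fintype.card_fin]
    omega
  refine le_trans ?_ g1
  refine Pairing.condP_exists_family_le (α := α) hlam0.le (by positivity) (Real.exp_pos _).le ?_ ?_
  · intro τ hτ k hk
    exact Pairing.second_moment_le hr hd hη hα0 hα hβ0.le hβ hκ0 h1 h2 h3 g2 hc₁0.le hb
      (by linarith) hτ hk
  · intro τ hτ k hkN hk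
    exact Pairing.first_moment_le hr hd hlam0 hα'0 hα'α (by linarith) hρs hs0 hbn hN hτ hkN hk
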